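/- Conventions. Machines are deterministic multitape Turing machines with a read-only input tape, work tapes and a write-only output tape; the space used is the number of work-tape cells visited. An FPSPACE function is a function on strings computed by such a machine that halts on every input and works in polynomial space, with output of polynomial length; a PTIME function is one computed in polynomial time. A *PSPACE test* consists of an FPSPACE function $G:\{1\}^*\times\{0,1\}^*\to\{0,1\}$ and a strictly length-increasing PTIME function $f:\{1\}^*\to\{1\}^*$ such that for every $n\ge 0$ the set $U_n=\{X\in\{0,1\}^\omega : \text{some initial segment } \tau \text{ of } X \text{ has } |\tau|\le |f(1^n)| \text{ and } G(1^n,\tau)=1\}$ has measure at most $2^{-n}$ under the fair coin measure. A sequence $X\in\{0,1\}^\omega$ is (Martin-Löf) *BPS random* if for every PSPACE test there is an $n$ with $X\notin U_n$. A *PSPACE martingale* is a function $d:\{0,1\}^*\to\mathbb{Q}\cap[0,\infty)$ with $d(\emptyset)=1$ and $d(\sigma)=\frac12(d(\sigma 0)+d(\sigma 1))$ for all $\sigma$, all of whose values have finite binary expansions, and such that an FPSPACE function maps each $\sigma$ to a binary expansion of $d(\sigma)$; it *succeeds* on $X$ if $\sup_m d(X(0)\cdots X(m-1))=\infty$. $X$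 is *PSPACE random in Lutz's sense* if no PSPACE martingale succeeds on $X$. $X$ is *computable in* $\mathrm{DSPACE}(t(n))$ if some machine outputs $X(n)$ on the unary input $1^n$, for every $n$, using space $O(t(n))$. Theorem. For every real $\epsilon>0$ there is a BPS random sequence $X\in\{0,1\}^\omega$ such that 1. $X$ is computable in $\mathrm{DSPACE}(2^{\epsilon(\log_2 n)^2})$ (where $(\log_2 n)^2$ is read as $0$ for $n=0$); 2. the limit $\lim_{n\to\infty}\frac1n\,\bigl|\{i<n : X(i)=1\}\bigr|$ does not exist; and 3. $X$ is not PSPACE random in Lutz's sense. -/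

import Mathlib

open Filter Topology MeasureTheory

namespace BPS

/-! ### Turing machines with a read-only input tape, work tapes and a write-only output tape -/

/-- The possible moves of a tape head. -/
inductive Move where
  | left
  | stay
  | right

/-- The effect of a move on the position of a head on a one-way infinite tape whose cells are
numbered `0, 1, 2, …`; a head that would fall off the left end stays on cell `0`. -/
def Move.apply : Move → ℕ → ℕ
  | .left, p => p - 1
  | .stay, p => p
  | .right, p => p + 1

/-- What the input head can see: one of the two end markers, or an input symbol. -/
inductive InSym (α : Type) where
  | leftEnd
  | sym (a : α)
  | rightEnd

/-- A deterministic multitape Turing machine with input alphabet `α` and output alphabet `β`: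
a two-way read-only input tape, `tapes` work tapes over the finite alphabet `Sym`, and a
one-way write-only output tape. Given the state, the scanned input symbol and the scanned work
symbols, `δ` is either `none` (the machine halts) or gives the new state, the move of the input
head, for each work tape the symbol to write and the move of the head, and possibly a symbol to be
appended to the output. -/
structure Machine (α β : Type) where
  State : Type
  Sym : Type
  [finiteState : Finite State]
  [finiteSym : Finite Sym]
  tapes : ℕ
  start : State
  blank : Sym
  δ : State → InSym α → (Fin tapes → Sym) →
    Option (State × Move × (Fin tapes → Sym × Move) × Option β)

namespace Machine

variable {α β : Type}

/-- A configuration: the state, the position of the input head, the contents of the work tapes,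
the positions of the work heads, and the output written so far. -/
structure Cfg (M : Machine α β) where
  state : M.State
  inPos : ℕ
  tape : Fin M.tapes → ℕ → M.Sym
  pos : Fin M.tapes → ℕ
  out : List β

/-- The content of cell `p` of the input tape on input `x`: cell `0` holds the left end marker,
cells `1, …, |x|` hold `x`, and cell `|x| + 1` holds the right end marker. -/
def inputCell (x : List α) : ℕ → InSym α
  | 0 => .leftEnd
  | p + 1 => match x[p]? with
    | some a => .sym a
    | none => .rightEnd

/-- The initial configuration: all work tapes blank, all heads on cell `0`, no output. -/
def init (M : Machine α β) : M.Cfg where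
  state := M.start
  inPos := 0
  tape := fun _ _ => M.blank
  pos := fun _ => 0
  out := []

/-- The instruction that `M` executes in the configuration `c` on input `x`. -/
def instr (M : Machine α β) (x : List α) (c : M.Cfg) :
    Option (M.State × Move × (Fin M.tapes → M.Sym × Move) × Option β) :=
  M.δ c.state (inputCell x c.inPos) (fun i => c.tape i (c.pos i))

/-- `M` has halted in the configuration `c` on input `x`. -/
def Halted (M : Machine α β) (x : List α) (c : M.Cfg) : Prop :=
  M.instr x c = none

/-- One step of `M` on input `x`; a halted configuration does not change. The input head never
leaves the cells `0, …, |x| + 1`. -/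
def next (M : Machine α β) (x : List α) (c : M.Cfg) : M.Cfg :=
  match M.instr x c with
  | none => c
  | some (q, m, w, o) =>
    { state := q
      inPos := min (m.apply c.inPos) (x.length + 1)
      tape := fun i => Function.update (c.tape i) (c.pos i) (w i).1
      pos := fun i => (w i).2.apply (c.pos i)
      out := c.out ++ o.toList }

/-- The configuration of `M` on input `x` after `t` steps. -/
def run (M : Machine α β) (x : List α) (t : ℕ) : M.Cfg :=
  (M.next x)^[t] M.init

/-- On input `x`, `M` halts within `T` steps with output `y`. -/
def OutputsWithin (M : Machine α β) (x : List α) (y : List β) (T : ℕ) : Prop :=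
  M.Halted x (M.run x T) ∧ (M.run x T).out = y

/-- On input `x`, `M` halts with output `y`. -/
def Outputs (M : Machine α β) (x : List α) (y : List β) : Prop :=
  ∃ T, M.OutputsWithin x y T

/-- On input `x`, `M` visits only the first `s` cells of each of its work tapes. -/
def UsesSpace (M : Machine α β) (x : List α) (s : ℕ) : Prop :=
  ∀ t i, (M.run x t).pos i < s

end Machine

/-! ### Complexity classes

The arguments of a function are presented to a machine through an encoding `enc` into strings;
the machine is required to work on the strings that encode an argument. -/

/-- Functions computable in polynomial time. -/
def PTIME {ι α β : Type} (enc : ι → List α) (F : ι → List β) : Prop :=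
  ∃ (M : Machine α β) (p : Polynomial ℕ),
    ∀ x, M.OutputsWithin (enc x) (F x) (p.eval (enc x).length)

/-- Functions computable in polynomial space (on the work tapes), by a machine that halts on all
inputs, and with output of polynomial length. -/
def FPSPACE {ι α β : Type} (enc : ι → List α) (F : ι → List β) : Prop :=
  ∃ (M : Machine α β) (p : Polynomial ℕ), ∀ x,
    M.Outputs (enc x) (F x) ∧
    M.UsesSpace (enc x) (p.eval (enc x).length) ∧
    (F x).length ≤ p.eval (enc x).length

/-- The unary string `1ⁿ`. -/
def unary (n : ℕ) : List Unit := List.replicate n ()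

/-- The string `1ⁿ # τ`, where `none` is the separator `#`. -/
def unaryPair (x : ℕ × List Bool) : List (Option Bool) :=
  List.replicate x.1 (some true) ++ none :: x.2.map some

/-- `X` is a `DSPACE(t(n))` real: some machine computes `X(n)` from `1ⁿ` in space `O(t(n))`. -/
def IsDSPACEReal (t : ℕ → ℝ) (X : ℕ → Bool) : Prop :=
  ∃ (M : Machine Unit Bool) (s : ℕ → ℕ) (C : ℝ), ∀ n,
    M.Outputs (unary n) [X n] ∧ M.UsesSpace (unary n) (s n) ∧ (s n : ℝ) ≤ C * t n

/-! ### Cantor space -/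

/-- The initial segment of length `n` of the infinite sequence `X`. -/
def res (X : ℕ → Bool) (n : ℕ) : List Bool := List.ofFn (fun i : Fin n => X i)

/-- The set `[S]` of all infinite sequences that have an initial segment in `S`. -/
def openSet (S : Set (List Bool)) : Set (ℕ → Bool) :=
  {X | ∃ τ ∈ S, res X τ.length = τ}

/-- The fair coin measure on Cantor space. -/
noncomputable def cantorMeasure : Measure (ℕ → Bool) :=
  Measure.infinitePi (fun _ => (PMF.uniformOfFintype Bool).toMeasure)

/-! ### Martin-Löf BPS randomness -/

/-- A `PSPACE` test, given by an `FPSPACE` function `G : {1}* × {0,1}* → {0,1}` and a strictly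
length increasing `PTIME` function `f : {1}* → {1}*`. -/
structure PSPACETest where
  G : ℕ → List Bool → Bool
  f : ℕ → ℕ
  G_mem : FPSPACE unaryPair (fun x => [G x.1 x.2])
  f_mem : PTIME unary (fun n => unary (f n))
  f_strictMono : StrictMono f
  measure_le : ∀ n, cantorMeasure (openSet {τ | τ.length ≤ f n ∧ G n τ = true}) ≤ 2⁻¹ ^ n

/-- The `n`-th clopen set `U n` of a `PSPACE` test. -/
def PSPACETest.U (T : PSPACETest) (n : ℕ) : Set (ℕ → Bool) :=
  openSet {τ | τ.length ≤ T.f n ∧ T.G n τ = true}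

/-- `X` is (Martin-Löf) BPS random: it passes every `PSPACE` test. -/
def IsBPSRandom (X : ℕ → Bool) : Prop :=
  ∀ T : PSPACETest, ∃ n, X ∉ T.U n

/-! ### PSPACE randomness in the sense of Lutz -/

/-- The number with binary expansion `σ`, most significant bit first. -/
def binVal (σ : List Bool) : ℕ := σ.foldl (fun a b => 2 * a + b.toNat) 0

/-- The string `σ 2 τ` (with `none` in the role of the symbol `2`) codes the rational number with
binary expansion `σ.τ`. -/
def Codes (w : List (Option Bool)) (q : ℚ) : Prop :=
  ∃ σ τ : List Bool, w = σ.map some ++ none :: τ.map some ∧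
    q = (binVal (σ ++ τ) : ℚ) / 2 ^ τ.length

/-- A martingale `{0,1}* → ℚ ∩ [0,∞)` with initial capital `1`. -/
structure IsMartingale (d : List Bool → ℚ) : Prop where
  nonneg : ∀ σ, 0 ≤ d σ
  init : d [] = 1
  fair : ∀ σ, d σ = (d (σ ++ [false]) + d (σ ++ [true])) / 2

/-- A martingale that is computable in `FPSPACE` with respect to the coding of rationals above. -/
def IsPSPACEMartingale (d : List Bool → ℚ) : Prop :=
  IsMartingale d ∧ ∃ F : List Bool → List (Option Bool),
    FPSPACE (id : List Bool → List Bool) F ∧ ∀ σ, Codes (F σ) (d σ)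

/-- `d` succeeds on `X`: its capital along `X` is unbounded. -/
def Succeeds (d : List Bool → ℚ) (X : ℕ → Bool) : Prop :=
  ∀ n : ℕ, ∃ m : ℕ, 2 ^ n ≤ d (res X m)

/-- `X` is `PSPACE` random in the sense of Lutz: no `PSPACE` martingale succeeds on `X`. -/
def IsLutzPSPACERandom (X : ℕ → Bool) : Prop :=
  ∀ d, IsPSPACEMartingale d → ¬ Succeeds d X

/-! ### Density -/

/-- The fraction of `1`s among `X(0), …, X(n-1)`. -/
noncomputable def density (X : ℕ → Bool) (n : ℕ) : ℝ :=
  (((Finset.range n).filter (fun i => X i = true)).card : ℝ) / n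

end BPS

/-! The sequence is built in stages; stage `k` extends a prefix of length `ell k` to one of length
`ell (k + 1)`. The number `k` is read as a pair `(b, W)`, which may code a machine deciding a test.
For `n = ell k + 1` the test set `U n` has at most half the measure of the cylinder of the current
prefix, so some extension avoids it (`exists_notMem_of_measure_le`). The stage tries all extensions
by `seg k` bits and takes one whose first rejected prefix comes as late as possible. Maximizing in
this way makes it unnecessary to know the length bound `f` of the test or the space bound of its
machine: every machine has arbitrarily large codes, because its table `W` can be padded, and `seg k
= ell k ^ (k + 1)` eventually exceeds any fixed polynomial in `ell k`. So at some stage coding the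
machine the segment is longer than `f n` and the simulation has enough room. Randomness needs only
one `n` with `X` outside `U n`, so this one stage settles the test (`randomSeq_isBPSRandom`).

The rest of the stage is therefore free. It is filled with a constant bit, the parity of `k`. Since
`ell (k + 1) = ell k * seg k`, this run makes up almost all of the new prefix, so the density of
ones comes close to 0 and to 1 in turn. The last bit of each stage is predictable, and a martingale
that stakes everything on it doubles its capital at every stage.

Stage `k` is computed with numbers polynomial in `cap k = 2 ^ ell (k + 1) ^ 2`, hence in space of
order `ell (k + 1) ^ 2`. As `ell k = 2 ^ (2 * (k + 1)!)`, the logarithm of `ell (k + 1)` is `k + 2`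
times that of `ell k`, and `k + 2` is negligible against `log (ell k)`; this gives the bound for
every `ε`.

Concrete machines come from counter programs. `E2` is the class of functions computable with
polynomially bounded counters (in the manner of Grzegorczyk's second class); it is closed under
composition and bounded recursion, and binary counters on tapes turn its programs into space-bounded
machines (`exists_machine_of_cmd`). Universality is arithmetical: a Turing machine becomes a
cellular automaton whose table and rows are numbers, so that its simulation is itself an `E2`
predicate (`exists_program`). -/

namespace BPS

/-! ### Programs on counters -/

/-- The state of a counter program: the counters, the unread input and the output so far. -/
structure Store (β : Type) where
  reg : ℕ → ℕ
  inp : List Bool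
  out : List β

/-- Structured programs on counters. `loop r c` repeats "decrement `r`, then `c`" until the counter
`r` is zero; `forIn c d` runs `c` or `d` for every remaining bit of the input. -/
inductive Cmd (β : Type) where
  | skip
  | inc (r : ℕ)
  | out (b : β)
  | seq (c d : Cmd β)
  | loop (r : ℕ) (c : Cmd β)
  | forIn (c d : Cmd β)

variable {α β : Type}

/-- `Exec B c s s'`: the program `c` started in `s` terminates in `s'`, and no counter is ever
incremented beyond `B`. -/
inductive Exec (B : ℕ) : Cmd β → Store β → Store β → Prop
  | skip (s) : Exec B .skip s s
  | inc (s r) : s.reg r + 1 ≤ B →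
      Exec B (.inc r) s { s with reg := Function.update s.reg r (s.reg r + 1) }
  | out (s b) : Exec B (.out b) s { s with out := s.out ++ [b] }
  | seq {c d s s' s''} : Exec B c s s' → Exec B d s' s'' → Exec B (.seq c d) s s''
  | loopZero {r c s} : s.reg r = 0 → Exec B (.loop r c) s s
  | loopSucc {r c s s' s'' v} : s.reg r = v + 1 →
      Exec B c { s with reg := Function.update s.reg r v } s' → Exec B (.loop r c) s' s'' →
      Exec B (.loop r c) s s''
  | forInNil {c d s} : s.inp = [] → Exec B (.forIn c d) s s
  | forInCons {c d s s' s'' b l} : s.inp = b :: l →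
      Exec B (bif b then c else d) { s with inp := l } s' → Exec B (.forIn c d) s' s'' →
      Exec B (.forIn c d) s s''

/-! ### Flat code -/

/-- Instructions of flat counter programs. `jzdec r a` jumps to `a` if `r` is zero and decrements
`r` otherwise; `read t f e` reads an input bit and jumps accordingly (to `e` at the end). -/
inductive Instr (β : Type) where
  | inc (r : ℕ)
  | jzdec (r a : ℕ)
  | jmp (a : ℕ)
  | out (b : β)
  | read (t f e : ℕ)

/-- The counter used by an instruction. -/
def Instr.regs : Instr β → ℕ
  | .inc r => r + 1
  | .jzdec r _ => r + 1
  | _ => 0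

/-- A step of a flat program. -/
inductive FStep (P : List (Instr β)) (B : ℕ) : ℕ × Store β → ℕ × Store β → Prop
  | inc {pc r s} : P[pc]? = some (.inc r) → s.reg r + 1 ≤ B →
      FStep P B (pc, s) (pc + 1, { s with reg := Function.update s.reg r (s.reg r + 1) })
  | jz {pc r a s} : P[pc]? = some (.jzdec r a) → a ≤ P.length → s.reg r = 0 →
      FStep P B (pc, s) (a, s)
  | dec {pc r a s v} : P[pc]? = some (.jzdec r a) → s.reg r = v + 1 →
      FStep P B (pc, s) (pc + 1, { s with reg := Function.update s.reg r v })
  | jmp {pc a s} : P[pc]? = some (.jmp a) → a ≤ P.length → FStep P B (pc, s) (a, s)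
  | out {pc b s} : P[pc]? = some (.out b) →
      FStep P B (pc, s) (pc + 1, { s with out := s.out ++ [b] })
  | readNil {pc t f e s} : P[pc]? = some (.read t f e) → e ≤ P.length → s.inp = [] →
      FStep P B (pc, s) (e, s)
  | readCons {pc t f e s b l} : P[pc]? = some (.read t f e) → t ≤ P.length → f ≤ P.length →
      s.inp = b :: l →
      FStep P B (pc, s) (bif b then t else f, { s with inp := l })

/-- Compilation of structured programs, placed at address `base`. -/
def Cmd.compile : Cmd β → ℕ → List (Instr β)
  | .skip, _ => []
  | .inc r, _ => [.inc r]
  | .out b, _ => [.out b]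
  | .seq c d, base => c.compile base ++ d.compile (base + (c.compile base).length)
  | .loop r c, base =>
      .jzdec r (base + (c.compile (base + 1)).length + 2) :: (c.compile (base + 1) ++ [.jmp base])
  | .forIn c d, base =>
      .read (base + 1) (base + (c.compile (base + 1)).length + 2)
        (base + (c.compile (base + 1)).length +
          (d.compile (base + (c.compile (base + 1)).length + 2)).length + 3) ::
      (c.compile (base + 1) ++ .jmp base ::
        (d.compile (base + (c.compile (base + 1)).length + 2) ++ [.jmp base]))

/-- The list `Q` occurs in `P` at position `base`. -/
def CodeAt (P : List (Instr β)) (base : ℕ) (Q : List (Instr β)) : Prop :=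
  ∃ A C, P = A ++ Q ++ C ∧ A.length = base

theorem CodeAt.left {P Q R : List (Instr β)} {n : ℕ} (h : CodeAt P n (Q ++ R)) : CodeAt P n Q := by
  obtain ⟨A, C, rfl, hA⟩ := h
  exact ⟨A, R ++ C, by simp, hA⟩

theorem CodeAt.right {P Q R : List (Instr β)} {n : ℕ} (h : CodeAt P n (Q ++ R)) :
    CodeAt P (n + Q.length) R := by
  obtain ⟨A, C, rfl, hA⟩ := h
  exact ⟨A ++ Q, C, by simp, by simp [hA]⟩

theorem CodeAt.get {P R : List (Instr β)} {i : Instr β} {n : ℕ} (h : CodeAt P n (i :: R)) :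
    P[n]? = some i := by
  obtain ⟨A, C, rfl, rfl⟩ := h
  simp

theorem CodeAt.tail {P R : List (Instr β)} {i : Instr β} {n : ℕ} (h : CodeAt P n (i :: R)) :
    CodeAt P (n + 1) R :=
  CodeAt.right (Q := [i]) h

theorem CodeAt.le {P Q : List (Instr β)} {n : ℕ} (h : CodeAt P n Q) : n + Q.length ≤ P.length := by
  obtain ⟨A, C, rfl, rfl⟩ := h
  simp

/-- Induction on the execution, not on the program: each further round of a loop re-enters the same
code at the same address, so the second induction hypothesis applies to the unchanged `hP`. -/
theorem Exec.flat {B : ℕ} {c : Cmd β} {s s' : Store β} (h : Exec B c s s')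
    (P : List (Instr β)) (base : ℕ) (hP : CodeAt P base (c.compile base)) :
    Relation.ReflTransGen (FStep P B) (base, s) (base + (c.compile base).length, s') := by
  induction h generalizing base with
  | skip s => exact .refl
  | inc s r hr => exact .single (.inc hP.get hr)
  | out s b => exact .single (.out hP.get)
  | seq _ _ ih1 ih2 =>
    simp only [Cmd.compile] at hP ⊢
    have h2 := ih2 _ hP.right
    rw [List.length_append, ← add_assoc]
    exact (ih1 _ hP.left).trans h2
  | @loopZero r c s hr =>
    have hle := hP.le
    simp only [Cmd.compile, List.length_cons, List.length_append, List.length_nil] at hP hle ⊢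
    have := FStep.jz (B := B) hP.get (by omega) hr
    exact .single (by convert this using 2; omega)
  | @loopSucc r c s s' s'' v hr _ _ ih1 ih2 =>
    have hle := hP.le
    have hP' := hP
    simp only [Cmd.compile] at hP
    simp only [Cmd.compile, List.length_cons, List.length_append, List.length_nil] at hle
    have h1 := FStep.dec (B := B) hP.get hr
    have h2 := ih1 _ hP.tail.left
    have h3 := FStep.jmp (B := B) (s := s') hP.tail.right.get (by omega)
    exact ((Relation.ReflTransGen.single h1).trans h2).trans
      ((Relation.ReflTransGen.single h3).trans (ih2 _ hP'))
  | @forInNil c d s hi =>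
    have hle := hP.le
    simp only [Cmd.compile, List.length_cons, List.length_append, List.length_nil] at hP hle ⊢
    have := FStep.readNil (B := B) hP.get (by omega) hi
    exact .single (by convert this using 2; omega)
  | @forInCons c d s s' s'' b l hi _ _ ih1 ih2 =>
    have hle := hP.le
    have hP' := hP
    simp only [Cmd.compile] at hP
    simp only [Cmd.compile, List.length_cons, List.length_append, List.length_nil] at hle
    have h1 := FStep.readCons (B := B) hP.get (by omega) (by omega) hi
    refine (Relation.ReflTransGen.single h1).trans (Relation.ReflTransGen.trans ?_ (ih2 _ hP'))
    cases b
    · have h0 := hP.tail.right.tail.left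
      rw [show base + 1 + (c.compile (base + 1)).length + 1 =
        base + (c.compile (base + 1)).length + 2 by omega] at h0
      have h2 := ih1 _ h0
      have h0 := hP.tail.right.tail.right
      rw [show base + 1 + (c.compile (base + 1)).length + 1 =
        base + (c.compile (base + 1)).length + 2 by omega] at h0
      exact h2.trans (.single (FStep.jmp (B := B) (s := s') h0.get (by omega)))
    · exact (ih1 _ hP.tail.left).trans
        (.single (FStep.jmp (B := B) (s := s') hP.tail.right.get (by omega)))

/-! ### Counters on tapes -/

/-- Tape symbols: `none` is the blank, `some none` marks cell `0`, `some (some b)` is a digit. -/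
abbrev TSym := Option (Option Bool)

/-- The tape with a mark in cell `0` followed by the digits `l`. -/
def tapeOf (l : List Bool) : ℕ → TSym
  | 0 => some none
  | j + 1 => l[j]?.map some

/-- The number with binary digits `l`, least significant first. -/
def bitsVal : List Bool → ℕ
  | [] => 0
  | b :: l => b.toNat + 2 * bitsVal l

/-- Binary increment. -/
def incBits : List Bool → List Bool
  | [] => [true]
  | true :: l => false :: incBits l
  | false :: l => true :: l

/-! ### Binary increment and decrement on digit lists, and their effect on tapes. -/

theorem bitsVal_incBits (l : List Bool) : bitsVal (incBits l) = bitsVal l + 1 := by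
  induction l with
  | nil => rfl
  | cons b l ih => cases b <;> simp [incBits, bitsVal, ih] <;> omega

/-- A new digit appears only on a carry out of an all-ones list; the equation lets the new length be
charged to the new value. -/
theorem incBits_length (l : List Bool) :
    (incBits l).length = l.length ∨
      ((incBits l).length = l.length + 1 ∧ bitsVal l + 1 = 2 ^ l.length) := by
  induction l with
  | nil => exact Or.inr ⟨rfl, rfl⟩
  | cons b l ih =>
    cases b
    · simp [incBits]
    · simp only [incBits, List.length_cons, bitsVal, Bool.toNat_true, pow_succ]
      omega

/-- Decrement as the machine performs it: the low zeros become ones and the first one becomes zero.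
The number of digits is kept, so zeros may accumulate at the top. -/
theorem exists_of_bitsVal_ne_zero {l : List Bool} (h : bitsVal l ≠ 0) :
    ∃ n l', l = List.replicate n false ++ true :: l' ∧
      bitsVal (List.replicate n true ++ false :: l') + 1 = bitsVal l := by
  induction l with
  | nil => simp [bitsVal] at h
  | cons b l ih =>
    cases b
    · have : bitsVal l ≠ 0 := by simpa [bitsVal] using h
      obtain ⟨n, l', rfl, h2⟩ := ih this
      refine ⟨n + 1, l', by simp [List.replicate_succ], ?_⟩
      simp only [List.replicate_succ, List.cons_append, bitsVal, Bool.toNat_true, Bool.toNat_false]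
      omega
    · exact ⟨0, l, rfl, by simp [bitsVal]; omega⟩

theorem eq_replicate_of_bitsVal_eq_zero {l : List Bool} (h : bitsVal l = 0) :
    l = List.replicate l.length false := by
  induction l with
  | nil => rfl
  | cons b l ih =>
    cases b
    · have : bitsVal l = 0 := by simpa [bitsVal] using h
      rw [List.length_cons, List.replicate_succ, ← ih this]
    · simp [bitsVal] at h

theorem tapeOf_at (p l : List Bool) (b : Bool) :
    tapeOf (p ++ b :: l) (p.length + 1) = some (some b) := by
  simp [tapeOf]

theorem tapeOf_end (p : List Bool) : tapeOf p (p.length + 1) = none := by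
  simp [tapeOf]

theorem tapeOf_update (p l : List Bool) (b b' : Bool) :
    Function.update (tapeOf (p ++ b :: l)) (p.length + 1) (some (some b')) =
      tapeOf (p ++ b' :: l) := by
  funext j
  rcases j with _ | j
  · simp [tapeOf]
  · by_cases h : j = p.length
    · subst h; simp [tapeOf]
    · rw [Function.update_of_ne (by omega)]
      simp only [tapeOf]
      rcases lt_or_gt_of_ne h with h | h
      · rw [List.getElem?_append_left h, List.getElem?_append_left h]
      · rw [List.getElem?_append_right h.le, List.getElem?_append_right h.le]
        obtain ⟨i, hi⟩ : ∃ i, j - p.length = i + 1 := ⟨j - p.length - 1, by omega⟩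
        simp [hi]

theorem tapeOf_update_end (p : List Bool) (b' : Bool) :
    Function.update (tapeOf p) (p.length + 1) (some (some b')) = tapeOf (p ++ [b']) := by
  funext j
  rcases j with _ | j
  · simp [tapeOf]
  · by_cases h : j = p.length
    · subst h; simp [tapeOf]
    · rw [Function.update_of_ne (by omega)]
      simp only [tapeOf]
      rcases lt_or_gt_of_ne h with h | h
      · rw [List.getElem?_append_left h]
      · rw [List.getElem?_eq_none (by omega), List.getElem?_eq_none (by simp; omega)]

end BPS

namespace BPS

variable {α β : Type}

/-! ### From flat code to Turing machines -/

/-- The symbol scanned on tape `r`. -/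
def look {R : ℕ} (v : Fin R → TSym) (r : ℕ) : TSym := if h : r < R then v ⟨r, h⟩ else none

/-- Write `a` on tape `r` and move its head; leave the other tapes alone. -/
def act {R : ℕ} (v : Fin R → TSym) (r : ℕ) (a : TSym) (m : Move) : Fin R → TSym × Move :=
  fun i => if i.val = r then (a, m) else (v i, .stay)

/-- Leave all tapes alone. -/
def idle {R : ℕ} (v : Fin R → TSym) : Fin R → TSym × Move := fun i => (v i, .stay)

/-- The control states: `none` is the start state; otherwise a program address and a phase
(`none`: normal, `some true`: returning to the left end, `some false`: returning to the left end
while resetting all digits). -/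
abbrev CtlState (L : ℕ) := Option (Fin (L + 1) × Option Bool)

/-- The control state at address `a`. -/
def ctl {L : ℕ} (a : ℕ) (ph : Option Bool) : CtlState L :=
  some (⟨min a L, by omega⟩, ph)

/-- The transition function of the machine executing flat code. -/
def instrStep (toBool : α → Bool) (L R : ℕ) (pc : ℕ) (ph : Option Bool) (a : InSym α)
    (v : Fin R → TSym) :
    Instr β → CtlState L × Move × (Fin R → TSym × Move) × Option β
  | .inc r => match ph with
    | none => match look v r with
      | some (some true) => (ctl pc none, .stay, act v r (some (some false)) .right, none)
      | _ => (ctl pc (some true), .stay, act v r (some (some true)) .left, none)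
    | some _ => match look v r with
      | some none => (ctl (pc + 1) none, .stay, act v r (some none) .right, none)
      | s => (ctl pc ph, .stay, act v r s .left, none)
  | .jzdec r e => match ph with
    | none => match look v r with
      | some (some true) => (ctl pc (some true), .stay, act v r (some (some false)) .left, none)
      | some (some false) => (ctl pc none, .stay, act v r (some (some true)) .right, none)
      | s => (ctl pc (some false), .stay, act v r s .left, none)
    | some true => match look v r with
      | some none => (ctl (pc + 1) none, .stay, act v r (some none) .right, none)
      | s => (ctl pc ph, .stay, act v r s .left, none)
    | some false => match look v r with
      | some none => (ctl e none, .stay, act v r (some none) .right, none)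
      | _ => (ctl pc ph, .stay, act v r (some (some false)) .left, none)
  | .jmp e => (ctl e none, .stay, idle v, none)
  | .out b => (ctl (pc + 1) none, .stay, idle v, some b)
  | .read t f e => match ph with
    | none => (ctl pc (some true), .right, idle v, none)
    | some _ => match a with
      | .sym a => (ctl (bif toBool a then t else f) none, .stay, idle v, none)
      | _ => (ctl e none, .stay, idle v, none)

/-- The machine executing the flat code `P` with `R` counters. -/
abbrev flatMachine (toBool : α → Bool) (P : List (Instr β)) (R : ℕ) : Machine α β where
  State := CtlState P.length
  Sym := TSym
  tapes := R
  start := none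
  blank := none
  δ := fun q a v => match q with
    | none => some (ctl 0 none, .stay, fun _ => (some none, .right), none)
    | some (pc, ph) => P[pc.val]?.map (instrStep toBool P.length R pc.val ph a v)

/-- `M` can go from `c` to `c'`, with all heads staying in the first `s` cells. -/
def Machine.Reach (M : Machine α β) (x : List α) (s : ℕ) : M.Cfg → M.Cfg → Prop :=
  Relation.ReflTransGen fun c c' => M.next x c = c' ∧ ∀ i, c'.pos i < s

/-! ### Reachability within bounded space. -/

theorem Machine.Reach.exists_run {M : Machine α β} {x : List α} {s : ℕ} {c c' : M.Cfg}
    (h : M.Reach x s c c') (hc : ∀ i, c.pos i < s) :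
    ∃ t, (M.next x)^[t] c = c' ∧ ∀ u ≤ t, ∀ i, ((M.next x)^[u] c).pos i < s := by
  induction h with
  | refl => exact ⟨0, rfl, fun u hu => by obtain rfl : u = 0 := by omega
                                          exact hc⟩
  | tail _ h2 ih =>
    obtain ⟨t, rfl, ht⟩ := ih
    refine ⟨t + 1, by rw [Function.iterate_succ_apply', h2.1], fun u hu i => ?_⟩
    rcases Nat.lt_or_ge u (t + 1) with h | h
    · exact ht u (by omega) i
    · obtain rfl : u = t + 1 := by omega
      rw [Function.iterate_succ_apply', h2.1]
      exact h2.2 i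

theorem Machine.next_of_halted {M : Machine α β} {x : List α} {c : M.Cfg} (h : M.Halted x c) :
    M.next x c = c := by
  unfold Machine.Halted at h
  simp [Machine.next, h]

/-- After halting the configuration is constant, so a space bound along the finite run holds at all
times. -/
theorem Machine.Reach.halted {M : Machine α β} {x : List α} {s : ℕ} {c' : M.Cfg}
    (h : M.Reach x s M.init c') (hs : 0 < s) (hc : M.Halted x c') :
    M.Outputs x c'.out ∧ M.UsesSpace x s := by
  obtain ⟨t, ht, hp⟩ := h.exists_run (fun i => hs)
  refine ⟨⟨t, ?_, ?_⟩, fun u i => ?_⟩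
  · rw [Machine.run, ht]; exact hc
  · rw [Machine.run, ht]
  · rcases le_total u t with h | h
    · exact hp u h i
    · obtain ⟨v, rfl⟩ := Nat.exists_eq_add_of_le' h
      rw [Machine.run, Function.iterate_add_apply, ht,
        Function.iterate_fixed (Machine.next_of_halted hc), ← ht]
      exact hp t le_rfl i

section Flat

variable (toBool : α → Bool) (P : List (Instr β)) (R : ℕ) (x : List α)

/-- Change the control state, and the contents and the head position of tape `r`. -/
def setTape {P : List (Instr β)} {R : ℕ} (c : (flatMachine toBool P R).Cfg)
    (q : CtlState P.length) (r : Fin R) (T : ℕ → TSym) (p : ℕ) :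
    (flatMachine toBool P R).Cfg where
  state := q
  inPos := c.inPos
  tape := Function.update c.tape r T
  pos := Function.update c.pos r p
  out := c.out

variable {P R x}

/-- A phase of a counter instruction affects one tape only. `hstep` is a lookup in `instrStep` that
must come out the same whatever the input head and the other tapes show. -/
theorem setTape_next (c : (flatMachine toBool P R).Cfg) (hin : c.inPos ≤ x.length + 1)
    (r : Fin R) (T : ℕ → TSym) (p pc : ℕ) (ph : Option Bool) (i : Instr β) (hi : P[pc]? = some i)
    (q : CtlState P.length) (a : TSym) (m : Move)
    (hstep : ∀ b v, look v r.val = T p → instrStep toBool P.length R pc ph b v i =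
      (q, .stay, act v r.val a m, none)) :
    (flatMachine toBool P R).next x (setTape toBool c (ctl pc ph) r T p) =
      setTape toBool c q r (Function.update T p a) (m.apply p) := by
  have hpc : pc < P.length := (List.getElem?_eq_some_iff.1 hi).1
  have key : (flatMachine toBool P R).instr x (setTape toBool c (ctl pc ph) r T p) =
      some (q, .stay, act (fun i => (setTape toBool c (ctl pc ph) r T p).tape i
        ((setTape toBool c (ctl pc ph) r T p).pos i)) r.val a m, none) := by
    have hst : (setTape toBool c (ctl pc ph) r T p).state =
        some (⟨pc, by omega⟩, ph) := by
      simp [setTape, ctl, min_eq_left hpc.le]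
    simp only [Machine.instr]
    rw [hst]
    show Option.map _ (P[pc]?) = _
    rw [hi]
    simp only [Option.map_some]
    rw [← hstep (Machine.inputCell x c.inPos)]
    · rfl
    · simp only [look, r.isLt, dif_pos, Fin.eta, setTape, Function.update_self]
  unfold Machine.next
  rw [key]
  refine (Machine.Cfg.mk.injEq ..).mpr ⟨rfl, ?_, ?_, ?_, by simp [setTape]⟩
  · simp only [setTape, Move.apply]; omega
  · funext j
    by_cases h : j = r
    · subst h; simp [act, setTape]
    · have : j.val ≠ r.val := fun e => h (Fin.ext e)
      simp [act, this, h, setTape]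
  · funext j
    by_cases h : j = r
    · subst h; simp [act, setTape]
    · have : j.val ≠ r.val := fun e => h (Fin.ext e)
      simp [act, this, h, Move.apply, setTape]

theorem setTape_reach {s : ℕ} (c : (flatMachine toBool P R).Cfg) (hin : c.inPos ≤ x.length + 1)
    (r : Fin R) (T : ℕ → TSym) (p pc : ℕ) (ph : Option Bool) (i : Instr β) (hi : P[pc]? = some i)
    (hc : ∀ i, c.pos i < s)
    (q : CtlState P.length) (a : TSym) (m : Move)
    (hstep : ∀ b v, look v r.val = T p → instrStep toBool P.length R pc ph b v i =
      (q, .stay, act v r.val a m, none)) (hs : m.apply p < s) :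
    (flatMachine toBool P R).Reach x s (setTape toBool c (ctl pc ph) r T p)
      (setTape toBool c q r (Function.update T p a) (m.apply p)) := by
  refine .single ⟨setTape_next toBool c hin r T p pc ph i hi q a m hstep, fun j => ?_⟩
  simp only [setTape]
  by_cases h : j = r
  · subst h; simpa using hs
  · simpa [h] using hc j

theorem tapeOf_ne_mark (l : List Bool) (p : ℕ) : tapeOf l (p + 1) ≠ some none := by
  simp only [tapeOf]
  cases l[p]? <;> simp

/-- Returning to the left end. -/
theorem return_reach {s : ℕ} (c : (flatMachine toBool P R).Cfg) (hin : c.inPos ≤ x.length + 1)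
    (hc : ∀ i, c.pos i < s) (hs1 : 1 < s)
    (r : Fin R) (l : List Bool) (pc : ℕ) (i : Instr β) (hi : P[pc]? = some i)
    (hr : i = .inc r ∨ ∃ e, i = .jzdec r e) (p : ℕ) (hp : p < s) :
    (flatMachine toBool P R).Reach x s (setTape toBool c (ctl pc (some true)) r (tapeOf l) p)
      (setTape toBool c (ctl (pc + 1) none) r (tapeOf l) 1) := by
  induction p with
  | zero =>
    have := setTape_reach toBool c hin r (tapeOf l) 0 pc (some true) i hi hc
      (ctl (pc + 1) none) (some none) .right (s := s) ?_ (by simpa [Move.apply] using hs1)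
    · have h0 : Function.update (tapeOf l) 0 (some none) = tapeOf l := by
        rw [Function.update_eq_self_iff]; rfl
      rw [h0] at this
      exact this
    · intro b v hv
      have hv : look v r.val = some none := hv
      rcases hr with rfl | ⟨e, rfl⟩ <;> simp [instrStep, hv]
  | succ p ih =>
    have := setTape_reach toBool c hin r (tapeOf l) (p + 1) pc (some true) i hi hc
      (ctl pc (some true)) (tapeOf l (p + 1)) .left (s := s) ?_ (by simp [Move.apply]; omega)
    · rw [Function.update_eq_self] at this
      exact this.trans (ih (by omega))
    · intro b v hv
      have h2 := tapeOf_ne_mark l p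
      rw [← hv] at h2
      rw [← hv]
      rcases hr with rfl | ⟨e, rfl⟩
      · simp only [instrStep]
      · simp only [instrStep]

theorem inc_scan_reach {s : ℕ} (c : (flatMachine toBool P R).Cfg) (hin : c.inPos ≤ x.length + 1)
    (hc : ∀ i, c.pos i < s) (r : Fin R) (pc : ℕ) (hi : P[pc]? = some (.inc r)) (l p : List Bool)
    (hs : p.length + l.length + 1 < s) :
    ∃ q < s, (flatMachine toBool P R).Reach x s
      (setTape toBool c (ctl pc none) r (tapeOf (p ++ l)) (p.length + 1))
      (setTape toBool c (ctl pc (some true)) r (tapeOf (p ++ incBits l)) q) := by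
  induction l generalizing p with
  | nil =>
    have := setTape_reach toBool c hin r (tapeOf p) (p.length + 1) pc none _ hi hc
      (ctl pc (some true)) (some (some true)) .left (s := s) ?_ (by simp [Move.apply]; omega)
    · rw [tapeOf_update_end] at this
      rw [List.append_nil, incBits]
      exact ⟨_, by simp [Move.apply]; omega, this⟩
    · intro b v hv
      rw [tapeOf_end] at hv
      simp [instrStep, hv]
  | cons b l ih =>
    cases b
    · have := setTape_reach toBool c hin r (tapeOf (p ++ false :: l)) (p.length + 1) pc none _ hi hc
        (ctl pc (some true)) (some (some true)) .left (s := s) ?_ (by simp [Move.apply]; omega)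
      · rw [tapeOf_update] at this
        exact ⟨_, by simp [Move.apply]; omega, this⟩
      · intro b v hv
        rw [tapeOf_at] at hv
        simp [instrStep, hv]
    · have := setTape_reach toBool c hin r (tapeOf (p ++ true :: l)) (p.length + 1) pc none _ hi hc
        (ctl pc none) (some (some false)) .right (s := s) ?_
        (by simp [Move.apply] at hs ⊢; omega)
      · rw [tapeOf_update] at this
        obtain ⟨q, hq, h2⟩ := ih (p ++ [false]) (by simp at hs ⊢; omega)
        refine ⟨q, hq, this.trans ?_⟩
        simp only [List.length_append, List.length_cons, List.length_nil, List.append_assoc,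
          List.cons_append, List.nil_append] at h2
        exact h2
      · intro b v hv
        rw [tapeOf_at] at hv
        simp [instrStep, hv]

/-- A speculative borrow: zeros are overwritten by ones before it is known whether a one follows. If
none does, `dec_undo_reach` restores them. -/
theorem dec_zeros_reach {s : ℕ} (c : (flatMachine toBool P R).Cfg) (hin : c.inPos ≤ x.length + 1)
    (hc : ∀ i, c.pos i < s) (r : Fin R) (pc e : ℕ) (hi : P[pc]? = some (.jzdec r e)) (n : ℕ)
    (l p : List Bool) (hs : p.length + n + 1 < s) :
    (flatMachine toBool P R).Reach x s
      (setTape toBool c (ctl pc none) r (tapeOf (p ++ (List.replicate n false ++ l)))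
        (p.length + 1))
      (setTape toBool c (ctl pc none) r (tapeOf (p ++ (List.replicate n true ++ l)))
        (p.length + n + 1)) := by
  induction n generalizing p with
  | zero => exact .refl
  | succ n ih =>
    have := setTape_reach toBool c hin r (tapeOf (p ++ (List.replicate (n + 1) false ++ l)))
      (p.length + 1) pc none _ hi hc
      (ctl pc none) (some (some true)) .right (s := s) ?_ (by simp [Move.apply]; omega)
    · rw [List.replicate_succ, List.cons_append, tapeOf_update] at this
      have h2 := ih (p ++ [true]) (by simp at hs ⊢; omega)
      refine this.trans ?_
      simp only [List.length_append, List.length_cons, List.length_nil, List.append_assoc,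
        List.cons_append, List.nil_append] at h2
      rw [show p.length + (n + 1) + 1 = p.length + (0 + 1) + n + 1 by omega]
      exact h2
    · intro b v hv
      rw [List.replicate_succ, List.cons_append, tapeOf_at] at hv
      simp [instrStep, hv]

theorem dec_undo_reach {s : ℕ} (c : (flatMachine toBool P R).Cfg) (hin : c.inPos ≤ x.length + 1)
    (hc : ∀ i, c.pos i < s) (hs1 : 1 < s) (r : Fin R) (pc e : ℕ)
    (hi : P[pc]? = some (.jzdec r e)) (n : ℕ) (l : List Bool) (hs : n < s) :
    (flatMachine toBool P R).Reach x s
      (setTape toBool c (ctl pc (some false)) r (tapeOf (List.replicate n true ++ l)) n)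
      (setTape toBool c (ctl e none) r (tapeOf (List.replicate n false ++ l)) 1) := by
  induction n generalizing l with
  | zero =>
    have := setTape_reach toBool c hin r (tapeOf l) 0 pc (some false) _ hi hc
      (ctl e none) (some none) .right (s := s) ?_ (by simpa [Move.apply] using hs1)
    · have h0 : Function.update (tapeOf l) 0 (some none) = tapeOf l := by
        rw [Function.update_eq_self_iff]; rfl
      rw [h0] at this
      exact this
    · intro b v hv
      have hv : look v r.val = some none := hv
      simp [instrStep, hv]
  | succ n ih =>
    have h0 : ∀ b : Bool, List.replicate (n + 1) b ++ l = List.replicate n b ++ b :: l := by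
      intro b; rw [List.replicate_succ', List.append_assoc]; rfl
    have h1 : (List.replicate n true).length + 1 = n + 1 := by simp
    have := setTape_reach toBool c hin r (tapeOf (List.replicate (n + 1) true ++ l))
      (n + 1) pc (some false) _ hi hc
      (ctl pc (some false)) (some (some false)) .left (s := s) ?_ (by simp [Move.apply]; omega)
    · rw [h0, ← h1, tapeOf_update, h1] at this
      rw [h0, h0]
      exact this.trans (ih _ (by omega))
    · intro b v hv
      rw [h0, ← h1, tapeOf_at] at hv
      simp [instrStep, hv]

/-- The tape `T` holds the counter value `v`, with not too many digits. -/
def TapeRep (B : ℕ) (T : ℕ → TSym) (v : ℕ) : Prop :=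
  ∃ l, T = tapeOf l ∧ bitsVal l = v ∧ 2 ^ l.length ≤ 2 * B + 1

variable (x) in
/-- The machine configuration `c` represents the flat program state `a`. -/
structure Rep (B : ℕ) (c : (flatMachine toBool P R).Cfg) (a : ℕ × Store β) : Prop where
  state : c.state = ctl a.1 none
  inPos_le : c.inPos ≤ x.length + 1
  inp : a.2.inp = (x.map toBool).drop c.inPos
  tape : ∀ i : Fin R, TapeRep B (c.tape i) (a.2.reg i)
  pos : ∀ i, c.pos i = 1
  out : c.out = a.2.out

variable {toBool} in
theorem Rep.eq_setTape {B : ℕ} {c : (flatMachine toBool P R).Cfg} {a : ℕ × Store β}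
    (h : Rep toBool x B c a) (r : Fin R) :
    c = setTape toBool c (ctl a.1 none) r (c.tape r) 1 := by
  rw [← h.pos r]
  refine (Machine.Cfg.mk.injEq ..).mpr ⟨h.state, rfl, ?_, ?_, rfl⟩
  · exact (Function.update_eq_self r c.tape).symm
  · exact (Function.update_eq_self r c.pos).symm

/-- The space needed for counters up to `B`. -/
def spaceFor (B : ℕ) : ℕ := Nat.log 2 (2 * B + 1) + 2

variable {toBool} in
theorem Rep.setTape {B : ℕ} {c : (flatMachine toBool P R).Cfg} {pc : ℕ} {s : Store β}
    (h : Rep toBool x B c (pc, s)) (r : Fin R) (l : List Bool) (pc' v : ℕ) (hv : bitsVal l = v)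
    (hl : 2 ^ l.length ≤ 2 * B + 1) :
    Rep toBool x B (setTape toBool c (ctl pc' none) r (tapeOf l) 1)
      (pc', { s with reg := Function.update s.reg r v }) where
  state := rfl
  inPos_le := h.inPos_le
  inp := h.inp
  tape := fun i => by
    by_cases hi : i = r
    · subst hi
      simp only [BPS.setTape, Function.update_self]
      exact ⟨l, rfl, hv, hl⟩
    · have : i.val ≠ r.val := fun e => hi (Fin.ext e)
      simp only [BPS.setTape, Function.update_of_ne hi, Function.update_of_ne this]
      exact h.tape i
  pos := fun i => by
    by_cases hi : i = r
    · subst hi; simp [BPS.setTape]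
    · simpa [BPS.setTape, hi] using h.pos i
  out := h.out

theorem next_of_instr {c : (flatMachine toBool P R).Cfg} {pc : ℕ} {ph : Option Bool}
    (hc : c.state = ctl pc ph) {i : Instr β} (hi : P[pc]? = some i) (m : Move)
    (q : CtlState P.length) (o : Option β)
    (h : ∀ v, instrStep toBool P.length R pc ph (Machine.inputCell x c.inPos) v i =
      (q, m, idle v, o)) :
    (flatMachine toBool P R).next x c =
      { c with state := q, inPos := min (m.apply c.inPos) (x.length + 1),
               out := c.out ++ o.toList } := by
  have hpc : pc < P.length := (List.getElem?_eq_some_iff.1 hi).1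
  have key : (flatMachine toBool P R).instr x c =
      some (q, m, idle (fun i => c.tape i (c.pos i)), o) := by
    have hst : c.state = some (⟨pc, by omega⟩, ph) := by
      rw [hc]; simp [ctl, min_eq_left hpc.le]
    simp only [Machine.instr]
    rw [hst]
    show Option.map _ (P[pc]?) = _
    rw [hi]
    simp only [Option.map_some, Option.some.injEq]
    rw [← h]
  unfold Machine.next
  rw [key]
  simp [idle, Move.apply]

theorem FStep.reach {B : ℕ} {a a' : ℕ × Store β} (h : FStep P B a a')
    (hR : ∀ i ∈ P, i.regs ≤ R) (c : (flatMachine toBool P R).Cfg) (hc : Rep toBool x B c a) :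
    ∃ c', (flatMachine toBool P R).Reach x (spaceFor B) c c' ∧ Rep toBool x B c' a' := by
  have hs1 : 1 < spaceFor B := by unfold spaceFor; omega
  have hcp : ∀ i, c.pos i < spaceFor B := fun i => by rw [hc.pos]; exact hs1
  have hlen : ∀ l : List Bool, 2 ^ l.length ≤ 2 * B + 1 → l.length + 1 < spaceFor B := by
    intro l hl
    have := Nat.le_log_of_pow_le (by norm_num) hl
    unfold spaceFor; omega
  cases h with
  | @inc pc r s hi hr =>
    have hrR : r < R := hR _ (List.mem_of_getElem? hi)
    obtain ⟨l, hl, hlv, hl2⟩ := hc.tape ⟨r, hrR⟩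
    obtain ⟨q, hq, h1⟩ := inc_scan_reach toBool c hc.inPos_le hcp ⟨r, hrR⟩ pc hi l []
      (by simpa using hlen l hl2)
    have h2 := return_reach toBool c hc.inPos_le hcp hs1 ⟨r, hrR⟩ (incBits l) pc _ hi (.inl rfl) q hq
    have h0 := hc.eq_setTape ⟨r, hrR⟩
    rw [hl] at h0
    refine ⟨_, ?_, hc.setTape ⟨r, hrR⟩ (incBits l) (pc + 1) _ ?_ ?_⟩
    · exact Eq.mpr (congrArg (fun z => Machine.Reach _ x _ z _) h0)
        (Relation.ReflTransGen.trans h1 h2)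
    · rw [bitsVal_incBits, hlv]
    · rcases incBits_length l with h | ⟨h, h'⟩
      · rwa [h]
      -- The carry case has `2 ^ l.length` equal to the new value, so the new length `l.length + 1`
      -- costs twice that value, at most `2 * B`.
      · rw [h, pow_succ, ← h', hlv]
        simp only at hr ⊢
        omega
  | @jz pc r e s hi he hr =>
    have hrR : r < R := hR _ (List.mem_of_getElem? hi)
    obtain ⟨l, hl, hlv, hl2⟩ := hc.tape ⟨r, hrR⟩
    -- A zero counter may still own digits, all of them zero; the borrow runs past them to the blank
    -- and is then undone.
    have hl0 := eq_replicate_of_bitsVal_eq_zero (hlv.trans hr)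
    have hll := hlen l hl2
    have h1 := dec_zeros_reach toBool c hc.inPos_le hcp ⟨r, hrR⟩ pc e hi l.length [] []
      (by simpa using hll)
    simp only [List.nil_append, List.append_nil, List.length_nil, Nat.zero_add] at h1
    rw [← hl0] at h1
    have h2 := setTape_reach (s := spaceFor B) toBool c hc.inPos_le ⟨r, hrR⟩
      (tapeOf (List.replicate l.length true)) (l.length + 1) pc none _ hi hcp
      (ctl pc (some false)) none .left ?_ (by simp only [Move.apply]; omega)
    · have h3 := dec_undo_reach toBool c hc.inPos_le hcp hs1 ⟨r, hrR⟩ pc e hi l.length []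
        (by omega)
      simp only [List.append_nil] at h3
      rw [← hl0] at h3
      have h4 : Function.update (tapeOf (List.replicate l.length true)) (l.length + 1) none =
          tapeOf (List.replicate l.length true) := by
        rw [Function.update_eq_self_iff]
        have := tapeOf_end (List.replicate l.length true)
        rw [List.length_replicate] at this
        exact this.symm
      rw [h4] at h2
      have h0 := hc.eq_setTape ⟨r, hrR⟩
      rw [hl] at h0
      have hrep := hc.setTape ⟨r, hrR⟩ l e _ hlv hl2
      rw [Function.update_eq_self] at hrep
      exact ⟨_, Eq.mpr (congrArg (fun z => Machine.Reach _ x _ z _) h0)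
        (Relation.ReflTransGen.trans h1 (Relation.ReflTransGen.trans h2 h3)), hrep⟩
    · intro b v hv
      have := tapeOf_end (List.replicate l.length true)
      rw [List.length_replicate] at this
      rw [this] at hv
      have hv : look v r = none := hv
      simp [instrStep, hv]
  | @dec pc r e s v hi hr =>
    have hrR : r < R := hR _ (List.mem_of_getElem? hi)
    obtain ⟨l, hl, hlv, hl2⟩ := hc.tape ⟨r, hrR⟩
    obtain ⟨n, l', rfl, hv'⟩ := exists_of_bitsVal_ne_zero (l := l) (by rw [hlv]; simp [hr])
    have hll := hlen _ hl2
    simp only [List.length_append, List.length_replicate, List.length_cons] at hll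
    have h1 := dec_zeros_reach toBool c hc.inPos_le hcp ⟨r, hrR⟩ pc e hi n (true :: l') []
      (by simp; omega)
    simp only [List.nil_append, List.length_nil, Nat.zero_add] at h1
    have h2 := setTape_reach (s := spaceFor B) toBool c hc.inPos_le ⟨r, hrR⟩
      (tapeOf (List.replicate n true ++ true :: l')) (n + 1) pc none _ hi hcp
      (ctl pc (some true)) (some (some false)) .left ?_ (by simp only [Move.apply]; omega)
    · have h5 := tapeOf_update (List.replicate n true) l' true false
      rw [List.length_replicate] at h5
      rw [h5] at h2
      have h3 := return_reach toBool c hc.inPos_le hcp hs1 ⟨r, hrR⟩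
        (List.replicate n true ++ false :: l') pc _ hi (.inr ⟨e, rfl⟩) n (by omega)
      have h0 := hc.eq_setTape ⟨r, hrR⟩
      rw [hl] at h0
      refine ⟨_, ?_, hc.setTape ⟨r, hrR⟩ (List.replicate n true ++ false :: l') (pc + 1) v ?_ ?_⟩
      · exact Eq.mpr (congrArg (fun z => Machine.Reach _ x _ z _) h0)
          (Relation.ReflTransGen.trans h1 (Relation.ReflTransGen.trans h2 h3))
      · rw [hlv] at hv'
        simp only [hr] at hv'
        omega
      · simpa using hl2
    · intro b v hv
      have := tapeOf_at (List.replicate n true) l' true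
      rw [List.length_replicate] at this
      rw [this] at hv
      have hv : look v r = some (some true) := hv
      simp [instrStep, hv]
  | @jmp pc e s hi he =>
    have := next_of_instr (x := x) toBool hc.state hi .stay (ctl e none) none (fun v => rfl)
    refine ⟨_, .single ⟨this, hcp⟩, rfl, ?_, ?_, hc.tape, hc.pos, ?_⟩
    · simp
    · simpa [Move.apply, min_eq_left hc.inPos_le] using hc.inp
    · simpa using hc.out
  | @out pc b s hi =>
    have := next_of_instr (x := x) toBool hc.state hi .stay (ctl (pc + 1) none) (some b)
      (fun v => rfl)
    refine ⟨_, .single ⟨this, hcp⟩, rfl, ?_, ?_, hc.tape, hc.pos, ?_⟩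
    · simp
    · simpa [Move.apply, min_eq_left hc.inPos_le] using hc.inp
    · simpa using hc.out
  | @readNil pc t f e s hi he hn =>
    have h1 := next_of_instr (x := x) toBool hc.state hi .right (ctl pc (some true)) none
      (fun v => rfl)
    have hx : x.length ≤ c.inPos := by simpa [hn] using hc.inp
    -- The input head rests on the last symbol read, so reading means moving first. At the end the
    -- move leads to the right marker, or is clamped there.
    have hin : min (Move.right.apply c.inPos) (x.length + 1) = x.length + 1 := by
      simp only [Move.apply]; omega
    have h2 := next_of_instr (x := x) toBool
      (c := { c with state := ctl pc (some true), inPos := x.length + 1, out := c.out })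
      rfl hi .stay (ctl e none) none (fun v => by
        simp [instrStep, Machine.inputCell])
    simp only [hin, Option.toList_none, List.append_nil] at h1
    refine ⟨_, Relation.ReflTransGen.trans (.single ⟨h1, hcp⟩) (.single ⟨h2, hcp⟩),
      rfl, ?_, ?_, hc.tape, hc.pos, ?_⟩
    · simp
    · simp [hn, Move.apply]
    · simpa using hc.out
  | @readCons pc t f e s b l hi ht hf hn =>
    have h1 := next_of_instr (x := x) toBool hc.state hi .right (ctl pc (some true)) none
      (fun v => rfl)
    have hd : (x.map toBool).drop c.inPos = b :: l := by rw [← hc.inp]; exact hn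
    have hx : c.inPos < x.length := by
      by_contra h
      rw [List.drop_of_length_le (by simp; omega)] at hd
      simp at hd
    have hb : toBool x[c.inPos] = b ∧ (x.map toBool).drop (c.inPos + 1) = l := by
      rw [List.drop_eq_getElem_cons (by simpa using hx)] at hd
      simpa using hd
    have hin : min (Move.right.apply c.inPos) (x.length + 1) = c.inPos + 1 := by
      simp only [Move.apply]; omega
    have h2 := next_of_instr (x := x) toBool
      (c := { c with state := ctl pc (some true), inPos := c.inPos + 1, out := c.out })
      rfl hi .stay (ctl (bif b then t else f) none) none (fun v => by
        simp [instrStep, Machine.inputCell, List.getElem?_eq_getElem hx, hb.1])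
    simp only [hin, Option.toList_none, List.append_nil] at h1
    refine ⟨_, Relation.ReflTransGen.trans (.single ⟨h1, hcp⟩) (.single ⟨h2, hcp⟩),
      rfl, ?_, ?_, hc.tape, hc.pos, ?_⟩
    · simp
    · have : min (c.inPos + 1) (x.length + 1) = c.inPos + 1 := by omega
      simp only [Move.apply, this, hb.2]
    · simpa using hc.out

end Flat

/-- Every counter program is executed by a Turing machine using space logarithmic in the largest
counter value. -/
theorem exists_machine_of_cmd (toBool : α → Bool) (cmd : Cmd β) :
    ∃ M : Machine α β, ∀ (x : List α) (B : ℕ) (s' : Store β),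
      Exec B cmd ⟨fun _ => 0, x.map toBool, []⟩ s' →
      M.Outputs x s'.out ∧ M.UsesSpace x (spaceFor B) := by
  set P := cmd.compile 0 with hP
  set R := (P.map Instr.regs).sum
  have hR : ∀ i ∈ P, i.regs ≤ R := fun i hi => List.le_sum_of_mem (List.mem_map_of_mem hi)
  refine ⟨flatMachine toBool P R, fun x B s' h => ?_⟩
  have hs1 : 1 < spaceFor B := by unfold spaceFor; omega
  have hflat := h.flat P 0 ⟨[], [], by simp [hP], rfl⟩
  have key : ∀ a, Relation.ReflTransGen (FStep P B) (0, ⟨fun _ => 0, x.map toBool, []⟩) a →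
      ∃ c, (flatMachine toBool P R).Reach x (spaceFor B) (flatMachine toBool P R).init c ∧
        Rep toBool x B c a := by
    intro a ha
    induction ha with
    | refl =>
      refine ⟨_, .single ⟨rfl, fun i => ?_⟩, ?_⟩
      · exact hs1
      · refine ⟨rfl, ?_, ?_, ?_, ?_, ?_⟩
        · simp [Machine.next, Machine.instr, Machine.init, flatMachine]
        · simp [Machine.next, Machine.instr, Machine.init, flatMachine, Move.apply]
        · intro i
          refine ⟨[], ?_, rfl, by simp⟩
          funext j
          rcases j with _ | j <;>
            simp [Machine.next, Machine.instr, Machine.init, flatMachine, tapeOf]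
        · intro i; rfl
        · rfl
    | tail _ h2 ih =>
      obtain ⟨c, hc1, hc2⟩ := ih
      obtain ⟨c', h1, h2⟩ := h2.reach toBool hR c hc2
      exact ⟨c', hc1.trans h1, h2⟩
  obtain ⟨c, hc1, hc2⟩ := key _ hflat
  have := hc1.halted (by omega) ?_
  · rwa [hc2.out] at this
  · have h0 := hc2.state
    simp only [Machine.Halted, Machine.instr]
    simp only [h0]
    show Option.map _ (P[min _ P.length]?) = none
    -- The address just past the code carries no instruction, and this is how the machine halts.
    rw [List.getElem?_eq_none (by simp [hP])]
    rfl

end BPS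

namespace BPS

variable {α β : Type}

/-! ### Functions computed by counter programs -/

/-- Assignments of values to variables (and to counters). -/
abbrev Env := ℕ → ℕ

/-- Execution of a program that uses neither the input nor the output. -/
def Runs (B : ℕ) (c : Cmd β) (s s' : Env) : Prop :=
  ∀ inp out, Exec B c ⟨s, inp, out⟩ ⟨s', inp, out⟩

theorem Runs.seq {B : ℕ} {c d : Cmd β} {s s' s'' : Env} (h : Runs B c s s') (h' : Runs B d s' s'') :
    Runs B (.seq c d) s s'' := fun i o => .seq (h i o) (h' i o)

theorem Runs.skip {B : ℕ} {s : Env} : Runs B (.skip : Cmd β) s s := fun _ _ => .skip _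

theorem Runs.inc {B : ℕ} {s : Env} {r : ℕ} (h : s r + 1 ≤ B) :
    Runs B (.inc r : Cmd β) s (Function.update s r (s r + 1)) := fun _ _ => .inc _ _ h

/-- Only `inc` raises a counter, and it is guarded by `B`. In `E2.polyBounded` this turns a bound on
resources into a bound on values. -/
theorem Exec.reg_le {B : ℕ} {c : Cmd β} {s s' : Store β} (h : Exec B c s s')
    (hs : ∀ r, s.reg r ≤ B) : ∀ r, s'.reg r ≤ B := by
  induction h with
  | skip => exact hs
  | inc s r h =>
    intro r'
    by_cases e : r' = r
    · subst e; simpa using h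
    · simpa [e] using hs r'
  | out => exact hs
  | seq _ _ ih1 ih2 => exact ih2 (ih1 hs)
  | loopZero => exact hs
  | @loopSucc r c s s' s'' v hr _ _ ih1 ih2 =>
    refine ih2 (ih1 fun r' => ?_)
    by_cases e : r' = r
    · subst e; have := hs r'; simp; omega
    · simpa [e] using hs r'
  | forInNil => exact hs
  | forInCons _ _ _ ih1 ih2 => exact ih2 (ih1 hs)

theorem Runs.le {B : ℕ} {c : Cmd β} {s s' : Env} (h : Runs B c s s')
    (hs : ∀ r, s r ≤ B) : ∀ r, s' r ≤ B := (h [] []).reg_le hs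

/-- The invariant is indexed by the number of rounds still to come and is tested before the
decrement. -/
theorem Runs.loop_inv {B r : ℕ} {c : Cmd β} (I : ℕ → Env → Prop)
    (h0 : ∀ s, I 0 s → s r = 0)
    (h1 : ∀ j s, I (j + 1) s → s r = j + 1 ∧ ∃ s', Runs B c (Function.update s r j) s' ∧ I j s')
    (n : ℕ) (s : Env) (hs : I n s) : ∃ s', Runs B (.loop r c) s s' ∧ I 0 s' := by
  induction n generalizing s with
  | zero => exact ⟨s, fun _ _ => .loopZero (h0 s hs), hs⟩
  | succ n ih =>
    obtain ⟨h2, s', h3, h4⟩ := h1 n s hs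
    obtain ⟨s'', h5, h6⟩ := ih s' h4
    exact ⟨s'', fun i o => .loopSucc h2 (h3 i o) (h5 i o), h6⟩

/-- Set counter `t` to zero. -/
def Cmd.clear (t : ℕ) : Cmd β := .loop t .skip

theorem Runs.clear (B t : ℕ) (s : Env) :
    Runs B (Cmd.clear t : Cmd β) s (Function.update s t 0) := by
  obtain ⟨s', h1, h2, h3⟩ := Runs.loop_inv (B := B) (r := t) (c := (.skip : Cmd β))
    (fun j s' => s' t = j ∧ ∀ r ≠ t, s' r = s r) (fun s h => h.1)
    (fun j s' h => ⟨h.1, _, Runs.skip, by simp, fun r hr => by simp [hr, h.2 r hr]⟩) (s t) s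
    ⟨rfl, fun _ _ => rfl⟩
  have : s' = Function.update s t 0 := by
    funext r
    by_cases e : r = t
    · subst e; simpa using h2
    · simpa [e] using h3 r e
  rwa [this] at h1

/-- Copy counter `a` to counter `t`, with the help of counter `u`. -/
def Cmd.copy (a t u : ℕ) : Cmd β :=
  .seq (.clear t) (.seq (.clear u) (.seq (.loop a (.seq (.inc t) (.inc u))) (.loop u (.inc a))))

/-- The source is emptied into `t` and `u` simultaneously and then refilled from `u`. -/
theorem Runs.copy {B a t u : ℕ} {s : Env} (hat : a ≠ t) (hau : a ≠ u) (htu : t ≠ u)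
    (hs : ∀ r, s r ≤ B) : ∃ s', Runs B (Cmd.copy a t u : Cmd β) s s' ∧ s' t = s a ∧
      ∀ r, r ≠ t → r ≠ u → s' r = s r := by
  obtain ⟨s1, h1, h2⟩ := Runs.loop_inv (B := B) (r := a) (c := (.seq (.inc t) (.inc u) : Cmd β))
    (fun j s' => s' a = j ∧ s' t + j = s a ∧ s' u + j = s a ∧
      ∀ r, r ≠ a → r ≠ t → r ≠ u → s' r = s r) (fun s h => h.1)
    (fun j s' h => ⟨h.1, _, (Runs.inc (by
        have := hs a
        rw [Function.update_of_ne hat.symm]; omega)).seq (Runs.inc (by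
        have := hs a
        rw [Function.update_of_ne htu.symm, Function.update_of_ne hau.symm]; omega)), by
      simp only [Function.update_of_ne hau, Function.update_of_ne hat, Function.update_self,
        Function.update_of_ne htu, Function.update_of_ne htu.symm, Function.update_of_ne hat.symm,
        Function.update_of_ne hau.symm, true_and]
      refine ⟨by omega, by omega, fun r h1 h2 h3 => ?_⟩
      simp [h1, h2, h3, h.2.2.2 r h1 h2 h3]⟩) (s a)
    (Function.update (Function.update s t 0) u 0)
    ⟨by simp [hat, hau], by simp [htu], by simp, fun r h1 h2 h3 => by simp [h2, h3]⟩
  obtain ⟨s2, h3, h4⟩ := Runs.loop_inv (B := B) (r := u) (c := (.inc a : Cmd β))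
    (fun j s' => s' u = j ∧ s' t = s a ∧ s' a + j = s a ∧
      ∀ r, r ≠ a → r ≠ t → r ≠ u → s' r = s r) (fun s h => h.1)
    (fun j s' h => ⟨h.1, _, Runs.inc (by
        have := hs a
        rw [Function.update_of_ne hau]; omega), by
      simp only [Function.update_of_ne hau, Function.update_self, Function.update_of_ne hau.symm,
        Function.update_of_ne hat.symm, Function.update_of_ne htu, true_and]
      refine ⟨h.2.1, by omega, fun r h1 h2 h3 => ?_⟩
      simp [h1, h3, h.2.2.2 r h1 h2 h3]⟩) (s a) s1
    ⟨by omega, by omega, by omega, h2.2.2.2⟩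
  refine ⟨s2, (Runs.clear B t s).seq ((Runs.clear B u _).seq (h1.seq h3)), h4.2.1,
    fun r hrt hru => ?_⟩
  by_cases e : r = a
  · subst e; omega
  · exact h4.2.2.2 r e hrt hru

/-- `f` is a function of the first `K` variables that is computed by a counter program whose
counters do not exceed `bd`. -/
def Impl (K : ℕ) (f bd : Env → ℕ) : Prop :=
  ∀ (β : Type) (ρ : ℕ → ℕ) (t m : ℕ), t < m → (∀ i < K, ρ i < m ∧ ρ i ≠ t) →
    ∃ c : Cmd β, ∀ (s : Env) (B : ℕ) (v : Env), (∀ i < K, v i = s (ρ i)) → bd v ≤ B →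
      (∀ r, s r ≤ B) → ∃ s', Runs B c s s' ∧ s' t = f v ∧ ∀ r < m, r ≠ t → s' r = s r

theorem Impl.mono {K K' : ℕ} {f bd bd' : Env → ℕ} (h : Impl K f bd) (hK : K ≤ K')
    (hb : ∀ v, bd v ≤ bd' v) : Impl K' f bd' := by
  intro β ρ t m ht hρ
  obtain ⟨c, hc⟩ := h β ρ t m ht fun i hi => hρ i (by omega)
  exact ⟨c, fun s B v hv hB => hc s B v (fun i hi => hv i (by omega)) ((hb v).trans hB)⟩

theorem Impl.zero (K : ℕ) : Impl K (fun _ => 0) (fun _ => 0) := by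
  intro β ρ t m ht hρ
  exact ⟨.clear t, fun s B v _ _ _ => ⟨_, Runs.clear B t s, by simp, fun r _ hr => by simp [hr]⟩⟩

theorem Impl.var (i : ℕ) : Impl (i + 1) (fun v => v i) (fun _ => 0) := by
  intro β ρ t m ht hρ
  obtain ⟨h1, h2⟩ := hρ i (by omega)
  refine ⟨.copy (ρ i) t m, fun s B v hv _ hs => ?_⟩
  obtain ⟨s', h3, h4, h5⟩ := Runs.copy (β := β) h2 (by omega) (by omega : t ≠ m) hs
  exact ⟨s', h3, h4.trans (hv i (by omega)).symm, fun r hr hrt => h5 r hrt (by omega)⟩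

theorem Impl.succ : Impl 1 (fun v => v 0 + 1) (fun v => v 0 + 1) := by
  intro β ρ t m ht hρ
  obtain ⟨h1, h2⟩ := hρ 0 (by omega)
  refine ⟨.seq (.copy (ρ 0) t m) (.inc t), fun s B v hv hB hs => ?_⟩
  obtain ⟨s', h3, h4, h5⟩ := Runs.copy (β := β) h2 (by omega) (by omega : t ≠ m) hs
  refine ⟨_, h3.seq (Runs.inc ?_), ?_, fun r hr hrt => ?_⟩
  · rw [h4, ← hv 0 (by omega)]; exact hB
  · simp [h4, hv 0]
  · simp [hrt, h5 r hrt (by omega)]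

/-- The intermediate values go to the fresh counters `m, …, m + Kf - 1`, from which the outer
program reads its arguments. -/
theorem Impl.comp {K Kf : ℕ} {f bf bd : Env → ℕ} {g bg : ℕ → Env → ℕ} (hf : Impl Kf f bf)
    (hg : ∀ i < Kf, Impl K (g i) (bg i)) (h1 : ∀ v, bf (fun i => g i v) ≤ bd v)
    (h2 : ∀ i < Kf, ∀ v, bg i v ≤ bd v) : Impl K (fun v => f (fun i => g i v)) bd := by
  intro β ρ t m ht hρ
  have key : ∀ j ≤ Kf, ∃ c : Cmd β, ∀ (s : Env) (B : ℕ) (v : Env), (∀ i < K, v i = s (ρ i)) →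
      bd v ≤ B → (∀ r, s r ≤ B) → ∃ s', Runs B c s s' ∧ (∀ i < j, s' (m + i) = g i v) ∧
        ∀ r < m, s' r = s r := by
    intro j
    induction j with
    | zero =>
      exact fun _ => ⟨.skip, fun s B v _ _ _ => ⟨s, Runs.skip, by simp, fun _ _ => rfl⟩⟩
    | succ j ih =>
      intro hj
      obtain ⟨c, hc⟩ := ih (by omega)
      obtain ⟨d, hd⟩ := hg j (by omega) β ρ (m + j) (m + Kf) (by omega)
        (fun i hi => by have := hρ i hi; omega)
      refine ⟨.seq c d, fun s B v hv hB hs => ?_⟩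
      obtain ⟨s1, h3, h4, h5⟩ := hc s B v hv hB hs
      obtain ⟨s2, h6, h7, h8⟩ := hd s1 B v
        (fun i hi => by rw [hv i hi, h5 _ (hρ i hi).1]) ((h2 j (by omega) v).trans hB)
        (h3.le hs)
      refine ⟨s2, h3.seq h6, fun i hi => ?_, fun r hr => ?_⟩
      · by_cases e : i = j
        · subst e; exact h7
        · rw [h8 _ (by omega) (by omega), h4 i (by omega)]
      · rw [h8 _ (by omega) (by omega), h5 r hr]
  obtain ⟨c, hc⟩ := key Kf le_rfl
  obtain ⟨d, hd⟩ := hf β (fun i => m + i) t (m + Kf) (by omega) (fun i hi => by omega)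
  refine ⟨.seq c d, fun s B v hv hB hs => ?_⟩
  obtain ⟨s1, h3, h4, h5⟩ := hc s B v hv hB hs
  obtain ⟨s2, h6, h7, h8⟩ := hd s1 B (fun i => g i v) (fun i hi => (h4 i hi).symm)
    ((h1 v).trans hB) (h3.le hs)
  exact ⟨s2, h3.seq h6, h7, fun r hr hrt => by rw [h8 r (by omega) hrt, h5 r hr]⟩

/-- Extend an assignment by a value for a new first variable. -/
def scons (a : ℕ) (v : Env) : Env
  | 0 => a
  | i + 1 => v i

@[simp] theorem scons_zero (a : ℕ) (v : Env) : scons a v 0 = a := rfl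

@[simp] theorem scons_succ (a : ℕ) (v : Env) (i : ℕ) : scons a v (i + 1) = v i := rfl

/-- The recursion with initial value `g v` and step `h (i, r, v)`. -/
def recFn (g h : Env → ℕ) (v : Env) (n : ℕ) : ℕ :=
  Nat.rec (g v) (fun i r => h (scons i (scons r v))) n

theorem recFn_succ (g h : Env → ℕ) (v : Env) (n : ℕ) :
    recFn g h v (n + 1) = h (scons n (scons (recFn g h v n) v)) := rfl

/-- Counter `m` holds the remaining rounds, `m + 1` the index, `m + 2` the current value, `m + 3`
the next one, and `m + 4` is scratch. The bound `h3` is asked only at values the recursion actually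
takes. -/
theorem Impl.rec {K : ℕ} {n g h bn bg bh bd : Env → ℕ} (hn : Impl K n bn) (hg : Impl K g bg)
    (hh : Impl (K + 2) h bh) (h1 : ∀ v, bn v ≤ bd v) (h2 : ∀ v, bg v ≤ bd v)
    (h3 : ∀ v, ∀ i < n v, bh (scons i (scons (recFn g h v i) v)) ≤ bd v) :
    Impl K (fun v => recFn g h v (n v)) bd := by
  intro β ρ t m ht hρ
  obtain ⟨cn, hcn⟩ := hn β ρ m (m + 4) (by omega) (fun i hi => by have := hρ i hi; omega)
  obtain ⟨cg, hcg⟩ := hg β ρ (m + 2) (m + 4) (by omega) (fun i hi => by have := hρ i hi; omega)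
  obtain ⟨ch, hch⟩ := hh β (scons (m + 1) (scons (m + 2) ρ)) (m + 3) (m + 4) (by omega) (by
    intro i hi
    rcases i with _ | _ | i
    · simp
    · simp
    · have := hρ i (by omega)
      simp; omega)
  refine ⟨.seq cn (.seq cg (.seq (.clear (m + 1)) (.seq
    (.loop m (.seq ch (.seq (.copy (m + 3) (m + 2) (m + 4)) (.inc (m + 1)))))
    (.copy (m + 2) t (m + 4))))), fun s B v hv hB hs => ?_⟩
  obtain ⟨s1, hr1, ht1, he1⟩ := hcn s B v hv ((h1 v).trans hB) hs
  obtain ⟨s2, hr2, ht2, he2⟩ := hcg s1 B v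
    (fun i hi => by have := hρ i hi; rw [hv i hi, he1 _ (by omega) (by omega)])
    ((h2 v).trans hB) (hr1.le hs)
  have hr3 := Runs.clear (β := β) B (m + 1) s2
  have hle3 := hr3.le (hr2.le (hr1.le hs))
  have hnB : n v ≤ B := by rw [← ht1]; exact hr1.le hs m
  obtain ⟨s4, hr4, h4⟩ := Runs.loop_inv (B := B) (r := m)
    (c := .seq ch (.seq (.copy (m + 3) (m + 2) (m + 4)) (.inc (m + 1))))
    (fun j s' => s' m = j ∧ j ≤ n v ∧ s' (m + 1) = n v - j ∧ s' (m + 2) = recFn g h v (n v - j) ∧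
      (∀ r < m, s' r = s r) ∧ ∀ r, s' r ≤ B) (fun s h => h.1)
    (fun j s' ⟨i1, i2, i3, i4, i5, i6⟩ => by
      refine ⟨i1, ?_⟩
      obtain ⟨s5, hr5, ht5, he5⟩ := hch (Function.update s' m j) B
        (scons (n v - (j + 1)) (scons (recFn g h v (n v - (j + 1))) v)) (by
          intro i hi
          rcases i with _ | _ | i
          · simp [i3]
          · simp [i4]
          · have := hρ i (by omega)
            simp only [scons_succ]
            rw [Function.update_of_ne (by omega), i5 _ this.1, hv i (by omega)])
        ((h3 v _ (by omega)).trans hB) (by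
          intro r
          by_cases e : r = m
          · subst e; have := i6 r; simp; omega
          · simpa [e] using i6 r)
      have hle5 : ∀ r, s5 r ≤ B := hr5.le (by
          intro r
          by_cases e : r = m
          · subst e; have := i6 r; simp; omega
          · simpa [e] using i6 r)
      obtain ⟨s6, hr6, ht6, he6⟩ := Runs.copy (β := β) (B := B) (s := s5)
        (by omega : m + 3 ≠ m + 2) (by omega : m + 3 ≠ m + 4) (by omega : m + 2 ≠ m + 4) hle5
      have e1 : s6 (m + 1) = n v - (j + 1) := by
        rw [he6 _ (by omega) (by omega), he5 _ (by omega) (by omega),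
          Function.update_of_ne (by omega), i3]
      have hr7 : Runs B (.inc (m + 1) : Cmd β) s6 _ := Runs.inc (by rw [e1]; omega)
      refine ⟨_, hr5.seq (hr6.seq hr7), ?_, by omega, ?_, ?_, ?_, hr7.le (hr6.le hle5)⟩
      · rw [Function.update_of_ne (by omega), he6 _ (by omega) (by omega),
          he5 _ (by omega) (by omega), Function.update_self]
      · rw [Function.update_self, e1]; omega
      · rw [Function.update_of_ne (by omega), ht6, ht5,
          show n v - j = n v - (j + 1) + 1 by omega, recFn_succ]
      · intro r hr
        rw [Function.update_of_ne (by omega), he6 _ (by omega) (by omega),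
          he5 _ (by omega) (by omega), Function.update_of_ne (by omega), i5 r hr])
    (n v) (Function.update s2 (m + 1) 0)
    ⟨by rw [Function.update_of_ne (by omega), he2 _ (by omega) (by omega), ht1], le_rfl,
      by simp, by
        rw [Function.update_of_ne (by omega), ht2, Nat.sub_self]; rfl,
      fun r hr => by
        rw [Function.update_of_ne (by omega), he2 _ (by omega) (by omega),
          he1 _ (by omega) (by omega)], hle3⟩
  obtain ⟨-, -, -, h7, h8, h9⟩ := h4
  obtain ⟨s8, hr8, ht8, he8⟩ := Runs.copy (β := β) (B := B) (s := s4)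
    (by omega : m + 2 ≠ t) (by omega : m + 2 ≠ m + 4) (by omega : t ≠ m + 4) h9
  refine ⟨s8, hr1.seq (hr2.seq (hr3.seq (hr4.seq hr8))), ?_, fun r hr hrt => ?_⟩
  · rw [ht8, h7, Nat.sub_zero]
  · rw [he8 r hrt (by omega), h8 r hr]

/-! ### Polynomially bounded computations -/

/-- The size of an assignment to the first `K` variables. -/
def sz (K : ℕ) (v : Env) : ℕ := ∑ i ∈ Finset.range K, v i + 2

theorem two_le_sz (K : ℕ) (v : Env) : 2 ≤ sz K v := by unfold sz; omega

theorem sz_mono {K K' : ℕ} (h : K ≤ K') (v : Env) : sz K v ≤ sz K' v := by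
  unfold sz
  have := Finset.sum_le_sum_of_subset (f := v) (Finset.range_subset_range.2 h)
  omega

theorem sz_pow_mono {K K' D D' : ℕ} (h : K ≤ K') (hD : D ≤ D') (v : Env) :
    sz K v ^ D ≤ sz K' v ^ D' :=
  (Nat.pow_le_pow_left (sz_mono h v) D).trans
    (Nat.pow_le_pow_right (by have := two_le_sz K' v; omega) hD)

theorem le_sz {K i : ℕ} (h : i < K) (v : Env) : v i ≤ sz K v := by
  unfold sz
  have := Finset.single_le_sum (f := v) (fun _ _ => Nat.zero_le _) (Finset.mem_range.2 h)
  omega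

/-- `f` is bounded by a polynomial in finitely many variables. -/
def PolyBounded (f : Env → ℕ) : Prop := ∃ K D, ∀ v, f v ≤ sz K v ^ D

theorem PolyBounded.const (n : ℕ) : PolyBounded (fun _ => n) :=
  ⟨0, n, fun v => by
    simpa [sz] using Nat.lt_two_pow_self.le⟩

theorem PolyBounded.var (i : ℕ) : PolyBounded (fun v => v i) :=
  ⟨i + 1, 1, fun v => by simpa using le_sz (Nat.lt_succ_self i) v⟩

theorem PolyBounded.mul {f g : Env → ℕ} (hf : PolyBounded f) (hg : PolyBounded g) :
    PolyBounded (fun v => f v * g v) := by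
  obtain ⟨K, D, hf⟩ := hf
  obtain ⟨K', D', hg⟩ := hg
  refine ⟨max K K', D + D', fun v => ?_⟩
  rw [pow_add]
  exact Nat.mul_le_mul ((hf v).trans (sz_pow_mono (le_max_left _ _) le_rfl v))
    ((hg v).trans (sz_pow_mono (le_max_right _ _) le_rfl v))

theorem PolyBounded.add {f g : Env → ℕ} (hf : PolyBounded f) (hg : PolyBounded g) :
    PolyBounded (fun v => f v + g v) := by
  obtain ⟨K, D, hf⟩ := hf
  obtain ⟨K', D', hg⟩ := hg
  refine ⟨max K K', max D D' + 1, fun v => ?_⟩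
  have h1 := (hf v).trans (sz_pow_mono (le_max_left K K') (le_max_left D D') v)
  have h2 := (hg v).trans (sz_pow_mono (le_max_right K K') (le_max_right D D') v)
  rw [pow_succ]
  nlinarith [two_le_sz (max K K') v]

theorem PolyBounded.scons {h F n : Env → ℕ} (hh : PolyBounded h) (hF : PolyBounded F)
    (hn : PolyBounded n) : ∃ K D, ∀ v, ∀ i ≤ n v, ∀ r ≤ F v, h (scons i (scons r v)) ≤ sz K v ^ D := by
  obtain ⟨K, D, hh⟩ := hh
  have hs : PolyBounded (fun v => n v + F v + sz K v) := by
    refine (hn.add hF).add ⟨K, 1, fun v => by simp⟩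
  obtain ⟨K', D', hs⟩ := hs
  refine ⟨K', D' * D, fun v i hi r hr => (hh _).trans ?_⟩
  rw [pow_mul]
  refine Nat.pow_le_pow_left (le_trans ?_ (hs v)) D
  refine (sz_mono (by omega : K ≤ K + 2) _).trans ?_
  unfold sz
  rw [Finset.sum_range_succ', Finset.sum_range_succ']
  simp only [scons_succ, scons_zero]
  omega

/-- Functions computed by counter programs with polynomially bounded counters. -/
def E2 (f : Env → ℕ) : Prop := ∃ K D, Impl K f (fun v => sz K v ^ D)

theorem E2.of_impl {K : ℕ} {f bd : Env → ℕ} (h : Impl K f bd) (hb : PolyBounded bd) : E2 f := by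
  obtain ⟨K', D, hb⟩ := hb
  exact ⟨max K K', D, h.mono (le_max_left _ _)
    fun v => (hb v).trans (sz_pow_mono (le_max_right _ _) le_rfl v)⟩

/-- The result is left in a counter, and no counter exceeds the bound of the run. -/
theorem E2.polyBounded {f : Env → ℕ} (hf : E2 f) : PolyBounded f := by
  obtain ⟨K, D, h⟩ := hf
  obtain ⟨c, hc⟩ := h Empty id K (K + 1) (by omega) (fun i hi => by simp; omega)
  -- The extra exponent makes the bound cover the arguments as well, even if `D = 0`.
  refine ⟨K, D + 1, fun v => ?_⟩
  have hle : ∀ r, (fun i => if i < K then v i else 0) r ≤ sz K v ^ (D + 1) := by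
    intro r
    have h0 : sz K v ≤ sz K v ^ (D + 1) := Nat.le_self_pow (by omega) _
    by_cases e : r < K
    · simpa [e] using (le_sz e v).trans h0
    · simp [e]
  obtain ⟨s', h1, h2, -⟩ := hc (fun i => if i < K then v i else 0) (sz K v ^ (D + 1)) v
    (fun i hi => by simp [hi]) (sz_pow_mono le_rfl (by omega) v) hle
  rw [← h2]
  exact h1.le hle K

theorem E2.zero : E2 (fun _ => 0) := .of_impl (Impl.zero 0) (.const 0)

theorem E2.var (i : ℕ) : E2 (fun v => v i) := .of_impl (Impl.var i) (.const 0)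

theorem E2.exists_impl {f : Env → ℕ} (h : E2 f) (K₀ : ℕ) :
    ∃ K D, K₀ ≤ K ∧ ∀ K' D', K ≤ K' → D ≤ D' → Impl K' f (fun v => sz K' v ^ D') := by
  obtain ⟨K, D, h⟩ := h
  exact ⟨max K₀ K, D, le_max_left _ _, fun K' D' hK hD =>
    h.mono ((le_max_right _ _).trans hK) (sz_pow_mono ((le_max_right _ _).trans hK) hD)⟩

/-- Only the first `Kf` of the functions `g i` are used, so a finite sum of their bounds suffices.
-/
theorem E2.comp {f : Env → ℕ} {g : ℕ → Env → ℕ} (hf : E2 f) (hg : ∀ i, E2 (g i)) :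
    E2 (fun v => f (fun i => g i v)) := by
  obtain ⟨Kf, Df, hf⟩ := hf
  choose K D hgi using hg
  let K' := (Finset.range Kf).sup K
  let bd : Env → ℕ := fun v => (∑ i ∈ Finset.range Kf, g i v + 2) ^ Df +
    ∑ i ∈ Finset.range Kf, sz (K i) v ^ D i
  have hsum : ∀ (F : ℕ → Env → ℕ), (∀ i, PolyBounded (F i)) → ∀ n,
      PolyBounded (fun v => ∑ i ∈ Finset.range n, F i v) := by
    intro F hF n
    induction n with
    | zero => simpa using PolyBounded.const 0
    | succ n ih => simpa only [Finset.sum_range_succ] using ih.add (hF n)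
  have hpow : ∀ (F : Env → ℕ), PolyBounded F → ∀ n, PolyBounded (fun v => F v ^ n) := by
    intro F hF n
    induction n with
    | zero => simpa using PolyBounded.const 1
    | succ n ih => simpa only [pow_succ] using ih.mul hF
  refine .of_impl (K := K') (bd := bd) (hf.comp
    (fun i hi => (hgi i).mono (Finset.le_sup (Finset.mem_range.2 hi)) fun v => le_rfl) ?_ ?_) ?_
  · exact fun v => Nat.le_add_right _ _
  · intro i hi v
    refine le_trans ?_ (Nat.le_add_left _ _)
    exact Finset.single_le_sum (f := fun i => sz (K i) v ^ D i) (fun _ _ => Nat.zero_le _)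
      (Finset.mem_range.2 hi)
  · refine PolyBounded.add (hpow _ ((hsum _ (fun i => E2.polyBounded ⟨_, _, hgi i⟩) _).add
      (.const 2)) _) (hsum _ (fun i => ⟨K i, D i, fun v => le_rfl⟩) _)

/-- Bounded recursion: the a priori bound `F` on the intermediate values keeps the cost of every
round polynomial in the parameters. -/
theorem E2.recFn {n g h F : Env → ℕ} (hn : E2 n) (hg : E2 g) (hh : E2 h) (hF : PolyBounded F)
    (hb : ∀ v, ∀ i ≤ n v, recFn g h v i ≤ F v) : E2 (fun v => recFn g h v (n v)) := by
  obtain ⟨K1, D1, -, h1⟩ := hn.exists_impl 0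
  obtain ⟨K2, D2, -, h2⟩ := hg.exists_impl 0
  obtain ⟨K3, D3, -, h3⟩ := hh.exists_impl 0
  let K := max K1 (max K2 K3)
  let D := max D1 (max D2 D3)
  have hbh : PolyBounded (fun v => sz (K + 2) v ^ D) := ⟨K + 2, D, fun v => le_rfl⟩
  obtain ⟨K', D', h4⟩ := hbh.scons hF hn.polyBounded
  refine .of_impl (K := K) (bd := fun v => sz K v ^ D + sz K' v ^ D') (Impl.rec
    (h1 K D (by omega) (by omega)) (h2 K D (by omega) (by omega))
    (h3 (K + 2) D (by omega) (by omega)) (fun v => Nat.le_add_right _ _)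
    (fun v => Nat.le_add_right _ _) ?_) ?_
  · exact fun v i hi => (h4 v i hi.le _ (hb v i hi.le)).trans (Nat.le_add_left _ _)
  · exact PolyBounded.add ⟨K, D, fun v => le_rfl⟩ ⟨K', D', fun v => le_rfl⟩

end BPS

namespace BPS

/-! ### A library of polynomially bounded computations -/

theorem E2.comp1 {F : ℕ → ℕ} {f : Env → ℕ} (h : E2 fun v => F (v 0)) (hf : E2 f) :
    E2 fun v => F (f v) :=
  h.comp (g := fun _ => f) fun _ => hf

/-- Variables are handled as de Bruijn indices: a binder takes `v 0`, and the outer variables move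
up by one. -/
theorem E2.shift {f : Env → ℕ} (hf : E2 f) : E2 fun v => f fun j => v (j + 1) :=
  hf.comp (g := fun j v => v (j + 1)) fun _ => .var _

theorem E2.shift2 {f : Env → ℕ} (hf : E2 f) : E2 fun v => f fun j => v (j + 2) :=
  hf.comp (g := fun j v => v (j + 2)) fun _ => .var _

theorem E2.natRec {n g : Env → ℕ} {h : Env → ℕ → ℕ → ℕ} (hn : E2 n) (hg : E2 g)
    (hh : E2 fun v => h (fun j => v (j + 2)) (v 0) (v 1)) {F : Env → ℕ} (hF : PolyBounded F)
    (hb : ∀ v, ∀ i ≤ n v, Nat.rec (g v) (h v) i ≤ F v) :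
    E2 fun v => Nat.rec (g v) (h v) (n v) :=
  E2.recFn (h := fun v => h (fun j => v (j + 2)) (v 0) (v 1)) hn hg hh hF hb

theorem E2.succ {f : Env → ℕ} (hf : E2 f) : E2 fun v => f v + 1 :=
  E2.comp1 (F := fun n => n + 1) (.of_impl Impl.succ ((PolyBounded.var 0).add (.const 1))) hf

theorem E2.const (n : ℕ) : E2 fun _ => n := by
  induction n with
  | zero => exact .zero
  | succ n ih => exact ih.succ

theorem E2.add {f g : Env → ℕ} (hf : E2 f) (hg : E2 g) : E2 fun v => f v + g v := by
  have key : ∀ a n : ℕ, Nat.rec (motive := fun _ => ℕ) a (fun _ r => r + 1) n = a + n := by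
    intro a n
    induction n with
    | zero => rfl
    | succ n ih => simp only [ih]; rfl
  have := E2.natRec (h := fun _ _ r => r + 1) hg hf (E2.var 1).succ
    (hf.polyBounded.add hg.polyBounded) (fun v i hi => by rw [key]; omega)
  simpa only [key] using this

theorem E2.pred {f : Env → ℕ} (hf : E2 f) : E2 fun v => f v - 1 := by
  have key : ∀ n : ℕ, Nat.rec (motive := fun _ => ℕ) 0 (fun i _ => i) n = n - 1 := by
    intro n; cases n <;> rfl
  have := E2.natRec (h := fun _ i _ => i) hf (.const 0) (E2.var 0)
    hf.polyBounded (fun v i hi => by rw [key]; omega)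
  simpa only [key] using this

theorem E2.sub {f g : Env → ℕ} (hf : E2 f) (hg : E2 g) : E2 fun v => f v - g v := by
  have key : ∀ a n : ℕ, Nat.rec (motive := fun _ => ℕ) a (fun _ r => r - 1) n = a - n := by
    intro a n
    induction n with
    | zero => rfl
    | succ n ih => simp only [ih]; rfl
  have := E2.natRec (h := fun _ _ r => r - 1) hg hf (E2.var 1).pred
    hf.polyBounded (fun v i hi => by rw [key]; omega)
  simpa only [key] using this

theorem E2.mul {f g : Env → ℕ} (hf : E2 f) (hg : E2 g) : E2 fun v => f v * g v := by
  have key : ∀ a n : ℕ, Nat.rec (motive := fun _ => ℕ) 0 (fun _ r => r + a) n = a * n := by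
    intro a n
    induction n with
    | zero => rfl
    | succ n ih => simp only [ih]; rfl
  have := E2.natRec (h := fun v _ r => r + f v) hg (.const 0) ((E2.var 1).add hf.shift2)
    (hf.polyBounded.mul hg.polyBounded) (fun v i hi => by
      rw [key]; exact Nat.mul_le_mul_left _ hi)
  simpa only [key] using this

/-- Decidable relations computed by counter programs with polynomially bounded counters. -/
def E2P (p : Env → Prop) : Prop := ∃ f, E2 f ∧ ∀ v, p v ↔ f v ≠ 0

theorem E2P.lt {f g : Env → ℕ} (hf : E2 f) (hg : E2 g) : E2P fun v => f v < g v :=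
  ⟨_, hg.sub hf, fun v => by omega⟩

theorem E2P.not {p : Env → Prop} (hp : E2P p) : E2P fun v => ¬ p v := by
  obtain ⟨f, hf, h⟩ := hp
  exact ⟨_, (E2.const 1).sub hf, fun v => by
    show ¬ p v ↔ _
    rw [h]; omega⟩

theorem E2P.and {p q : Env → Prop} (hp : E2P p) (hq : E2P q) : E2P fun v => p v ∧ q v := by
  obtain ⟨f, hf, h⟩ := hp
  obtain ⟨g, hg, h'⟩ := hq
  exact ⟨_, hf.mul hg, fun v => by
    show p v ∧ q v ↔ _
    rw [h, h', mul_ne_zero_iff]⟩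

theorem E2P.le {f g : Env → ℕ} (hf : E2 f) (hg : E2 g) : E2P fun v => f v ≤ g v :=
  ⟨_, hg.succ.sub hf, fun v => by omega⟩

theorem E2P.eq {f g : Env → ℕ} (hf : E2 f) (hg : E2 g) : E2P fun v => f v = g v := by
  have := (E2P.le hf hg).and (E2P.le hg hf)
  simpa only [← le_antisymm_iff] using this

/-- A recursion on the characteristic value whose step ignores the previous result. -/
theorem E2.ite {p : Env → Prop} {f g : Env → ℕ} [∀ v, Decidable (p v)] (hp : E2P p) (hf : E2 f)
    (hg : E2 g) : E2 fun v => if p v then f v else g v := by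
  obtain ⟨χ, hχ, h⟩ := hp
  have key : ∀ a b n : ℕ, Nat.rec (motive := fun _ => ℕ) a (fun _ _ => b) n =
      if n ≠ 0 then b else a := by
    intro a b n; cases n <;> rfl
  have := E2.natRec (h := fun v _ _ => f v) hχ hg hf.shift2
    (hf.polyBounded.add hg.polyBounded) (fun v i hi => by rw [key]; split_ifs <;> omega)
  simpa only [key, ← h] using this

theorem PolyBounded.scons_one {h n : Env → ℕ} (hh : PolyBounded h) (hn : PolyBounded n) :
    ∃ G, PolyBounded G ∧ ∀ v, ∀ i ≤ n v, h (BPS.scons i v) ≤ G v := by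
  obtain ⟨K, D, hh⟩ := hh
  have hs : PolyBounded (fun v => n v + sz K v) := hn.add ⟨K, 1, fun v => by simp⟩
  obtain ⟨K', D', hs⟩ := hs
  refine ⟨fun v => sz K' v ^ (D' * D), ⟨_, _, fun v => le_rfl⟩, fun v i hi => (hh _).trans ?_⟩
  simp only
  rw [pow_mul]
  refine Nat.pow_le_pow_left (le_trans ?_ (hs v)) D
  refine (sz_mono (by omega : K ≤ K + 1) _).trans ?_
  unfold sz
  rw [Finset.sum_range_succ']
  simp only [scons_succ, scons_zero]
  omega

theorem E2.sum {n : Env → ℕ} {F : Env → ℕ → ℕ} (hn : E2 n)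
    (hF : E2 fun v => F (fun j => v (j + 1)) (v 0)) :
    E2 fun v => ∑ i ∈ Finset.range (n v), F v i := by
  have key : ∀ (G : ℕ → ℕ) (n : ℕ), Nat.rec (motive := fun _ => ℕ) 0 (fun i r => r + G i) n =
      ∑ i ∈ Finset.range n, G i := by
    intro G n
    induction n with
    | zero => rfl
    | succ n ih => rw [Finset.sum_range_succ, ← ih]
  obtain ⟨G, hG, hle⟩ := hF.polyBounded.scons_one hn.polyBounded
  have hF' : E2 fun v => F (fun j => v (j + 2)) (v 0) :=
    hF.comp (g := fun j v => match j with | 0 => v 0 | j + 1 => v (j + 2)) fun j => by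
      rcases j with _ | j <;> exact .var _
  have := E2.natRec (h := fun v i r => r + F v i) hn (.const 0) ((E2.var 1).add hF')
    (hn.polyBounded.mul hG) (fun v i hi => by
      rw [key]
      calc ∑ j ∈ Finset.range i, F v j ≤ ∑ j ∈ Finset.range i, G v :=
            Finset.sum_le_sum fun j hj => hle v j (by have := Finset.mem_range.1 hj; omega)
        _ = i * G v := by simp
        _ ≤ _ := Nat.mul_le_mul_right _ hi)
  simpa only [key] using this

/-- The indicator of failure is summed; the sum vanishes exactly when there is no failure. -/
theorem E2P.forall_lt {n : Env → ℕ} {p : Env → ℕ → Prop} (hn : E2 n)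
    (hp : E2P fun v => p (fun j => v (j + 1)) (v 0)) : E2P fun v => ∀ i < n v, p v i := by
  obtain ⟨f, hf, h⟩ := hp.not
  have e : (fun v : Env => f (scons (v 0) fun j => v (j + 1))) = f := by
    funext v
    congr 1
    funext j
    cases j <;> rfl
  have h2 := E2.sum (F := fun v i => f (scons i v)) hn (by rw [e]; exact hf)
  refine (E2P.eq h2 (.const 0)).imp fun g hg => ⟨hg.1, fun v => ?_⟩
  show (∀ i < n v, p v i) ↔ _
  rw [← hg.2]
  show _ ↔ ∑ i ∈ Finset.range (n v), f (scons i v) = 0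
  rw [Finset.sum_eq_zero_iff]
  simp only [Finset.mem_range]
  refine forall₂_congr fun i hi => ?_
  have := h (scons i v)
  simp only [scons_zero, scons_succ] at this
  tauto

open Classical in
/-- The least `i < n` with `p i`, or `n` if there is none. -/
noncomputable def mu (p : ℕ → Prop) (n : ℕ) : ℕ :=
  Nat.rec 0 (fun _ r => if p r then r else r + 1) n

open Classical in
theorem mu_spec (p : ℕ → Prop) (n : ℕ) :
    (∀ i < mu p n, ¬ p i) ∧ (mu p n = n ∨ mu p n < n ∧ p (mu p n)) := by
  induction n with
  | zero => simp [mu]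
  | succ n ih =>
    have h : mu p (n + 1) = if p (mu p n) then mu p n else mu p n + 1 := rfl
    obtain ⟨h1, h2⟩ := ih
    split_ifs at h with hp
    · rw [h]
      refine ⟨h1, .inr ⟨?_, hp⟩⟩
      omega
    · have : mu p n = n := by tauto
      rw [h]
      refine ⟨fun i hi => ?_, .inl (by omega)⟩
      rcases Nat.lt_succ_iff_lt_or_eq.1 hi with hi | rfl
      · exact h1 i hi
      · exact hp

theorem mu_le (p : ℕ → Prop) (n : ℕ) : mu p n ≤ n := by
  have := (mu_spec p n).2
  omega

theorem mu_eq {p : ℕ → Prop} {n i : ℕ} (hi : i < n) (hp : p i) (h : ∀ j < i, ¬ p j) :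
    mu p n = i := by
  obtain ⟨h1, h2⟩ := mu_spec p n
  rcases lt_trichotomy (mu p n) i with h3 | h3 | h3
  · rcases h2 with h2 | ⟨-, h2⟩
    · omega
    · exact absurd h2 (h _ h3)
  · exact h3
  · exact absurd hp (h1 i h3)

/-- The candidate is the accumulated value, not the recursion index: it stops moving once the
predicate holds. -/
theorem E2.mu {n : Env → ℕ} {p : Env → ℕ → Prop} (hn : E2 n)
    (hp : E2P fun v => p (fun j => v (j + 1)) (v 0)) : E2 fun v => mu (p v) (n v) := by
  obtain ⟨f, hf, h⟩ := hp
  have hp' : E2P fun v => p (fun j => v (j + 2)) (v 1) :=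
    ⟨_, hf.comp (g := fun j v => v (j + 1)) (fun j => .var _), fun v => h fun j => v (j + 1)⟩
  classical
  exact E2.natRec (h := fun v _ r => if p v r then r else r + 1) hn (.const 0)
    (E2.ite hp' (.var 1) (E2.var 1).succ) hn.polyBounded
    (fun v i hi => (mu_le (p v) i).trans hi)

/-- Some `i < n` for which `f i` is largest. -/
def argmax (f : ℕ → ℕ) (n : ℕ) : ℕ :=
  Nat.rec 0 (fun i r => if f r < f i then i else r) n

theorem argmax_succ (f : ℕ → ℕ) (n : ℕ) :
    argmax f (n + 1) = if f (argmax f n) < f n then n else argmax f n := rfl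

theorem argmax_le (f : ℕ → ℕ) (n : ℕ) : argmax f n ≤ n - 1 := by
  induction n with
  | zero => rfl
  | succ n ih => rw [argmax_succ]; split_ifs <;> omega

theorem le_argmax (f : ℕ → ℕ) {n i : ℕ} (hi : i < n) : f i ≤ f (argmax f n) := by
  induction n with
  | zero => omega
  | succ n ih =>
    rw [argmax_succ]
    rcases Nat.lt_succ_iff_lt_or_eq.1 hi with h | rfl
    · have := ih h
      split_ifs <;> omega
    · split_ifs <;> omega

theorem E2.argmax {n : Env → ℕ} {f : Env → ℕ → ℕ} (hn : E2 n)
    (hf : E2 fun v => f (fun j => v (j + 1)) (v 0)) : E2 fun v => argmax (f v) (n v) := by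
  have h1 : E2 fun v => f (fun j => v (j + 2)) (v 1) :=
    hf.comp (g := fun j v => v (j + 1)) fun j => .var _
  have h0 : E2 fun v => f (fun j => v (j + 2)) (v 0) :=
    hf.comp (g := fun j v => match j with | 0 => v 0 | j + 1 => v (j + 2)) fun j => by
      rcases j with _ | j <;> exact .var _
  exact E2.natRec (h := fun v i r => if f v r < f v i then i else r) hn (.const 0)
    (E2.ite (E2P.lt h1 h0) (.var 0) (.var 1)) hn.polyBounded
    (fun v i hi => (argmax_le (f v) i).trans (by omega))

/-- A bound on `f` uniform in its argument bounds all iterates after the zeroth, without knowledge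
of the orbit. -/
theorem E2.iterate {n x F : Env → ℕ} {f : Env → ℕ → ℕ} (hn : E2 n) (hx : E2 x)
    (hf : E2 fun v => f (fun j => v (j + 1)) (v 0)) (hF : E2 F) (hb : ∀ v a, f v a ≤ F v) :
    E2 fun v => (f v)^[n v] (x v) := by
  have key : ∀ (G : ℕ → ℕ) (a n : ℕ), Nat.rec (motive := fun _ => ℕ) a (fun _ r => G r) n =
      G^[n] a := by
    intro G a n
    induction n with
    | zero => rfl
    | succ n ih => simp only [ih, Function.iterate_succ_apply']
  have h1 : E2 fun v => f (fun j => v (j + 2)) (v 1) :=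
    hf.comp (g := fun j v => v (j + 1)) fun j => .var _
  have := E2.natRec (h := fun v _ r => f v r) hn hx h1
    (hx.polyBounded.add hF.polyBounded) (fun v i hi => by
      rcases i with _ | i
      · exact Nat.le_add_right _ _
      · exact (hb v _).trans (Nat.le_add_left _ _))
  simpa only [key] using this

/-! ### Division, square roots and capped powers. -/

theorem E2.min {f g : Env → ℕ} (hf : E2 f) (hg : E2 g) : E2 fun v => min (f v) (g v) := by
  simp only [min_def]
  exact E2.ite (.le hf hg) hf hg

theorem E2.div {f g : Env → ℕ} (hf : E2 f) (hg : E2 g) : E2 fun v => f v / g v := by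
  have key : ∀ a b : ℕ, a / b = if b = 0 then 0 else BPS.mu (fun q => a < (q + 1) * b) a := by
    intro a b
    split_ifs with h
    · simp [h]
    · have hb : 0 < b := Nat.pos_of_ne_zero h
      have h1 : ∀ j < a / b, ¬ a < (j + 1) * b := fun j hj => by
        have := Nat.div_mul_le_self a b
        have := Nat.mul_le_mul_right b (Nat.succ_le_of_lt hj)
        simp only [Nat.succ_eq_add_one] at this
        omega
      have h2 : a < (a / b + 1) * b := Nat.lt_mul_of_div_lt (Nat.lt_succ_self _) hb
      rcases (Nat.div_le_self a b).lt_or_eq with h3 | h3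
      · exact (mu_eq h3 h2 h1).symm
      -- If the quotient equals `a`, no smaller candidate succeeds, and the default value of the
      -- search is the right one.
      · obtain ⟨-, h4⟩ := mu_spec (fun q => a < (q + 1) * b) a
        rcases h4 with h4 | ⟨h4, h5⟩
        · rw [h4, h3]
        · exact absurd h5 (h1 _ (by omega))
  simp only [key]
  exact E2.ite (.eq hg (.const 0)) (.const 0)
    (E2.mu (p := fun v q => f v < (q + 1) * g v) hf
      (.lt hf.shift (((E2.var 0).succ).mul hg.shift)))

theorem E2.mod {f g : Env → ℕ} (hf : E2 f) (hg : E2 g) : E2 fun v => f v % g v := by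
  simp only [Nat.mod_eq_sub]
  exact hf.sub (hg.mul (hf.div hg))

theorem E2.sqrt {f : Env → ℕ} (hf : E2 f) : E2 fun v => Nat.sqrt (f v) := by
  have key : ∀ a : ℕ, Nat.sqrt a = BPS.mu (fun q => a < (q + 1) * (q + 1)) (a + 1) := by
    intro a
    refine (mu_eq (Nat.lt_succ_of_le (Nat.sqrt_le_self a)) (Nat.lt_succ_sqrt a) ?_).symm
    intro j hj h
    exact absurd (Nat.sqrt_lt.2 h) (by omega)
  simp only [key]
  exact E2.mu (p := fun v q => f v < (q + 1) * (q + 1)) hf.succ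
    (.lt hf.shift (((E2.var 0).succ).mul ((E2.var 0).succ)))

/-- The power `b ^ p`, capped at `z`. -/
def pw (z b p : ℕ) : ℕ := Nat.rec (min 1 z) (fun _ r => min (r * b) z) p

theorem pw_le (z b p : ℕ) : pw z b p ≤ z := by
  cases p <;> exact min_le_right _ _

/-- A product with `b ≥ 1` cannot fall below a cap once reached, so capping each step equals capping
the result. True powers outgrow every polynomial bound; capped ones do not. -/
theorem pw_eq (z b p : ℕ) (hb : b ≠ 0) : pw z b p = min (b ^ p) z := by
  induction p with
  | zero => rfl
  | succ p ih =>
    show min (pw z b p * b) z = _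
    rw [ih, pow_succ]
    rcases le_total (b ^ p) z with h | h
    · rw [min_eq_left h]
    · rw [min_eq_right h, min_eq_right (Nat.le_mul_of_pos_right z (by omega)),
        min_eq_right (h.trans (Nat.le_mul_of_pos_right _ (by omega)))]

theorem E2.pw {z b p : Env → ℕ} (hz : E2 z) (hb : E2 b) (hp : E2 p) :
    E2 fun v => pw (z v) (b v) (p v) :=
  E2.natRec (h := fun v _ r => Min.min (r * b v) (z v)) hp ((E2.const 1).min hz)
    (((E2.var 1).mul hb.shift2).min hz.shift2) hz.polyBounded
    (fun v i _ => pw_le (z v) (b v) i)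

end BPS

namespace BPS

/-! ### A universal simulator

A cellular automaton with several local rules is coded by a number `W`, whose digits in base `b`
are the entries of a table. A row of `N` cells is coded by the number having the cells as digits;
the digit `0` stands for a missing neighbour, and as the result of a rule for failure. In each
step the first rule that fails nowhere is applied to all cells. All powers are capped at `z`. -/

/-- Digit `p` of `c` in base `b`. -/
def dig (z b c p : ℕ) : ℕ := c / pw z b p % b

/-- An entry of the table coded by `W`: for `op = 0` the initial cells, for `op = 1` the accepting
cells, for `op = 2` the local rules. -/
def tab (z b W op d l c r : ℕ) : ℕ := dig z b W ((((op * b + d) * b + l) * b + c) * b + r)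

/-- The value of rule `d` at position `p` of the row `c`. -/
def ruleVal (z b W c d p : ℕ) : ℕ :=
  tab z b W 2 d (if p = 0 then 0 else dig z b c (p - 1)) (dig z b c p) (dig z b c (p + 1))

/-- The first rule that fails nowhere. -/
noncomputable def goodRule (z b W N c : ℕ) : ℕ := mu (fun d => ∀ p < N, ruleVal z b W c d p ≠ 0) b

/-- One step of the automaton. -/
noncomputable def stepNum (z b W N c : ℕ) : ℕ :=
  ∑ p ∈ Finset.range N, ruleVal z b W c (goodRule z b W N c) p * pw z b p

/-- The kind of cell `p` of the input tape holding `1ⁿ`, a separator and the first `j` bits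
of `y`. -/
def kind (z n y j p : ℕ) : ℕ :=
  if p = 0 then 0 else if p ≤ n then 1 else if p = n + 1 then 2 else
    if p < n + 2 + j then (if dig z 2 y (p - (n + 2)) = 1 then 1 else 3) else 4

/-- The initial row. -/
def initNum (z b W N n y j : ℕ) : ℕ :=
  ∑ p ∈ Finset.range N, tab z b W 0 0 0 0 (kind z n y j p) * pw z b p

/-- The simulation accepts `1ⁿ` and the first `j` bits of `y`. -/
def Hit (z b W N n y j : ℕ) : Prop :=
  tab z b W 1 0 0 0 (dig z b ((stepNum z b W N)^[z] (initNum z b W N n y j)) 0) = 1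

theorem E2.dig {z b c p : Env → ℕ} (hz : E2 z) (hb : E2 b) (hc : E2 c) (hp : E2 p) :
    E2 fun v => dig (z v) (b v) (c v) (p v) :=
  (hc.div (hz.pw hb hp)).mod hb

theorem E2.tab {z b W op d l c r : Env → ℕ} (hz : E2 z) (hb : E2 b) (hW : E2 W) (ho : E2 op)
    (hd : E2 d) (hl : E2 l) (hc : E2 c) (hr : E2 r) :
    E2 fun v => tab (z v) (b v) (W v) (op v) (d v) (l v) (c v) (r v) :=
  hz.dig hb hW (((((((ho.mul hb).add hd).mul hb).add hl).mul hb).add hc).mul hb |>.add hr)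

theorem E2.ruleVal {z b W c d p : Env → ℕ} (hz : E2 z) (hb : E2 b) (hW : E2 W) (hc : E2 c)
    (hd : E2 d) (hp : E2 p) : E2 fun v => ruleVal (z v) (b v) (W v) (c v) (d v) (p v) :=
  hz.tab hb hW (.const 2) hd (.ite (.eq hp (.const 0)) (.const 0) (hz.dig hb hc hp.pred))
    (hz.dig hb hc hp) (hz.dig hb hc hp.succ)

theorem E2.goodRule {z b W N c : Env → ℕ} (hz : E2 z) (hb : E2 b) (hW : E2 W) (hN : E2 N)
    (hc : E2 c) : E2 fun v => goodRule (z v) (b v) (W v) (N v) (c v) :=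
  E2.mu (p := fun v d => ∀ p < N v, BPS.ruleVal (z v) (b v) (W v) (c v) d p ≠ 0) hb
    (E2P.forall_lt (p := fun v p => BPS.ruleVal (z fun j => v (j + 1)) (b fun j => v (j + 1))
      (W fun j => v (j + 1)) (c fun j => v (j + 1)) (v 0) p ≠ 0) hN.shift
      (E2P.not (E2P.eq (hz.shift.shift.ruleVal hb.shift.shift hW.shift.shift hc.shift.shift
        (.var 1) (.var 0)) (.const 0))))

theorem E2.stepNum {z b W N c : Env → ℕ} (hz : E2 z) (hb : E2 b) (hW : E2 W) (hN : E2 N)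
    (hc : E2 c) : E2 fun v => stepNum (z v) (b v) (W v) (N v) (c v) :=
  E2.sum (F := fun v p => BPS.ruleVal (z v) (b v) (W v) (c v)
      (BPS.goodRule (z v) (b v) (W v) (N v) (c v)) p * BPS.pw (z v) (b v) p) hN
    ((hz.shift.ruleVal hb.shift hW.shift hc.shift (hz.goodRule hb hW hN hc).shift (.var 0)).mul
      (hz.shift.pw hb.shift (.var 0)))

theorem E2.kind {z n y j p : Env → ℕ} (hz : E2 z) (hn : E2 n) (hy : E2 y) (hj : E2 j)
    (hp : E2 p) : E2 fun v => kind (z v) (n v) (y v) (j v) (p v) :=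
  .ite (.eq hp (.const 0)) (.const 0) (.ite (.le hp hn) (.const 1)
    (.ite (.eq hp hn.succ) (.const 2) (.ite (.lt hp (hn.succ.succ.add hj))
      (.ite (.eq (hz.dig (.const 2) hy (hp.sub hn.succ.succ)) (.const 1)) (.const 1) (.const 3))
      (.const 4))))

theorem E2.initNum {z b W N n y j : Env → ℕ} (hz : E2 z) (hb : E2 b) (hW : E2 W) (hN : E2 N)
    (hn : E2 n) (hy : E2 y) (hj : E2 j) :
    E2 fun v => initNum (z v) (b v) (W v) (N v) (n v) (y v) (j v) :=
  E2.sum (F := fun v p => BPS.tab (z v) (b v) (W v) 0 0 0 0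
      (BPS.kind (z v) (n v) (y v) (j v) p) * BPS.pw (z v) (b v) p) hN
    ((hz.shift.tab hb.shift hW.shift (.const 0) (.const 0) (.const 0) (.const 0)
      (hz.shift.kind hn.shift hy.shift hj.shift (.var 0))).mul
      (hz.shift.pw hb.shift (.var 0)))

theorem dig_le (z b c p : ℕ) : dig z b c p ≤ c :=
  (Nat.mod_le _ _).trans (Nat.div_le_self _ _)

/-- This holds for every `c`, also when the numbers code nothing sensible, as `E2.iterate` requires.
-/
theorem stepNum_le (z b W N c : ℕ) : stepNum z b W N c ≤ N * (W * z) := by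
  calc stepNum z b W N c ≤ ∑ p ∈ Finset.range N, W * z :=
        Finset.sum_le_sum fun p _ => Nat.mul_le_mul (dig_le _ _ _ _) (pw_le _ _ _)
    _ = _ := by simp

theorem E2P.hit {z b W N n y j : Env → ℕ} (hz : E2 z) (hb : E2 b) (hW : E2 W) (hN : E2 N)
    (hn : E2 n) (hy : E2 y) (hj : E2 j) :
    E2P fun v => Hit (z v) (b v) (W v) (N v) (n v) (y v) (j v) :=
  .eq (hz.tab hb hW (.const 1) (.const 0) (.const 0) (.const 0) (hz.dig hb
    (E2.iterate (f := fun v c => BPS.stepNum (z v) (b v) (W v) (N v) c) hz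
      (hz.initNum hb hW hN hn hy hj)
      (hz.shift.stepNum hb.shift hW.shift hN.shift (.var 0))
      (hN.mul (hW.mul hz)) (fun _ _ => stepNum_le _ _ _ _ _)) (.const 0))) (.const 1)

/-! ### Digits -/

theorem sum_digits_lt {b : ℕ} {a : ℕ → ℕ} {N : ℕ} (ha : ∀ i < N, a i < b) :
    ∑ i ∈ Finset.range N, a i * b ^ i < b ^ N := by
  induction N with
  | zero => simp
  | succ N ih =>
    rw [Finset.sum_range_succ, pow_succ]
    have h1 := ih fun i hi => ha i (by omega)
    have h2 := Nat.mul_le_mul_right (b ^ N) (Nat.succ_le_of_lt (ha N (by omega)))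
    rw [Nat.succ_mul] at h2
    linarith [mul_comm b (b ^ N)]

theorem sum_digits_div_mod {b : ℕ} {a : ℕ → ℕ} {N : ℕ} (hb : 0 < b) (ha : ∀ i < N, a i < b)
    (q : ℕ) :
    (∑ i ∈ Finset.range N, a i * b ^ i) / b ^ q % b = if q < N then a q else 0 := by
  induction N with
  | zero => simp
  | succ N ih =>
    have hlt := sum_digits_lt fun i (hi : i < N) => ha i (by omega)
    have hN := ha N (by omega)
    rcases lt_trichotomy q N with h | h | h
    · rw [Finset.sum_range_succ, if_pos (by omega)]
      have h1 := ih fun i hi => ha i (by omega)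
      rw [if_pos h] at h1
      obtain ⟨e, rfl⟩ : ∃ e, N = q + (e + 1) := ⟨N - q - 1, by omega⟩
      rw [show a (q + (e + 1)) * b ^ (q + (e + 1)) = b ^ q * (a (q + (e + 1)) * b ^ e * b) by ring,
        Nat.add_mul_div_left _ _ (by positivity), Nat.add_mul_mod_self_right, h1]
    · subst h
      rw [Finset.sum_range_succ, if_pos (by omega), Nat.add_mul_div_right _ _ (by positivity),
        Nat.div_eq_of_lt hlt, Nat.zero_add, Nat.mod_eq_of_lt hN]
    · rw [if_neg (by omega), Nat.div_eq_of_lt, Nat.zero_mod]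
      exact (sum_digits_lt ha).trans_le (Nat.pow_le_pow_right hb (by omega))

/-- Where the power is capped, `c < z` makes both quotients zero, so the capped digit is still
exact. -/
theorem dig_eq {z b c : ℕ} (hb : 0 < b) (hc : c < z) (p : ℕ) : dig z b c p = c / b ^ p % b := by
  rw [dig, pw_eq _ _ _ (by omega)]
  rcases le_total (b ^ p) z with h | h
  · rw [min_eq_left h]
  · rw [min_eq_right h, Nat.div_eq_of_lt hc, Nat.div_eq_of_lt (hc.trans_le h)]

theorem dig_sum {z b N : ℕ} {a : ℕ → ℕ} (hb : 0 < b) (ha : ∀ i < N, a i < b) (hz : b ^ N ≤ z)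
    (p : ℕ) : dig z b (∑ i ∈ Finset.range N, a i * b ^ i) p = if p < N then a p else 0 := by
  rw [dig_eq hb ((sum_digits_lt ha).trans_le hz), sum_digits_div_mod hb ha]

theorem sum_pw {z b N : ℕ} {a : ℕ → ℕ} (hb : 0 < b) (hz : b ^ N ≤ z) :
    ∑ i ∈ Finset.range N, a i * pw z b i = ∑ i ∈ Finset.range N, a i * b ^ i := by
  refine Finset.sum_congr rfl fun i hi => ?_
  rw [pw_eq _ _ _ (by omega), min_eq_left]
  exact (Nat.pow_le_pow_right hb (Finset.mem_range.1 hi).le).trans hz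

/-- The table occupies the lowest `3 * b ^ 4` digits. Ones placed above it are never consulted by
these lookups and make `W` as large as desired: this is the padding that gives a machine arbitrarily
large codes. -/
theorem exists_table (b : ℕ) (hb : 2 ≤ b) (g : ℕ → ℕ → ℕ → ℕ → ℕ → ℕ)
    (hg : ∀ op d l c r, g op d l c r < b) (K : ℕ) :
    ∃ W ≥ K, ∀ z > W, ∀ op ≤ 2, ∀ d < b, ∀ l < b, ∀ c < b, ∀ r < b,
      tab z b W op d l c r = g op d l c r := by
  have hb0 : 0 < b := by omega
  let J := 3 * b ^ 4
  let a : ℕ → ℕ := fun i => if i < J then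
    g (i / b / b / b / b) (i / b / b / b % b) (i / b / b % b) (i / b % b) (i % b) else 1
  have ha : ∀ i < J + K + 1, a i < b := by
    intro i _
    simp only [a]
    split_ifs
    · exact hg _ _ _ _ _
    · omega
  refine ⟨∑ i ∈ Finset.range (J + K + 1), a i * b ^ i, ?_, fun z hz op hop d hd l hl c hc r hr => ?_⟩
  · rw [Finset.sum_range_succ]
    have h1 : a (J + K) = 1 := by simp [a]
    have h2 : K < b ^ K := Nat.lt_pow_self (by omega)
    have h3 : b ^ K ≤ b ^ (J + K) := Nat.pow_le_pow_right hb0 (by omega)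
    rw [h1]
    omega
  · have hidx : (((op * b + d) * b + l) * b + c) * b + r < J := by
      have e1 : op * b + d + 1 ≤ 3 * b := by nlinarith
      have e2 : (op * b + d) * b + l + 1 ≤ 3 * b * b := by nlinarith
      have e3 : ((op * b + d) * b + l) * b + c + 1 ≤ 3 * b * b * b := by nlinarith
      have e4 : (((op * b + d) * b + l) * b + c) * b + r + 1 ≤ 3 * b * b * b * b := by nlinarith
      simp only [J]
      have : 3 * b ^ 4 = 3 * b * b * b * b := by ring
      omega
    have hdm : ∀ x y : ℕ, y < b → (x * b + y) / b = x ∧ (x * b + y) % b = y := by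
      intro x y hy
      rw [mul_comm]
      exact ⟨by rw [Nat.mul_add_div hb0, Nat.div_eq_of_lt hy, add_zero],
        by rw [Nat.mul_add_mod, Nat.mod_eq_of_lt hy]⟩
    rw [tab, dig_eq hb0 hz, sum_digits_div_mod hb0 ha, if_pos (by omega)]
    simp only [a, if_pos hidx, (hdm _ _ hr).1, (hdm _ _ hr).2, (hdm _ _ hc).1, (hdm _ _ hc).2,
      (hdm _ _ hl).1, (hdm _ _ hl).2, (hdm _ _ hd).1, (hdm _ _ hd).2]

/-! ### Cellular automata with a finite set of cells -/

/-- The left neighbour of position `p`. -/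
def leftOf {A : Type} (u : ℕ → A) (p : ℕ) : Option A := if p = 0 then none else some (u (p - 1))

/-- The right neighbour of position `p` in a row of `N` cells. -/
def rightOf {A : Type} (N : ℕ) (u : ℕ → A) (p : ℕ) : Option A :=
  if p + 1 < N then some (u (p + 1)) else none

theorem exists_code (A : Type) [Finite A] :
    ∃ (m : ℕ) (code : A → ℕ), Function.Injective code ∧ ∀ a, 0 < code a ∧ code a ≤ m := by
  obtain ⟨n, ⟨e⟩⟩ := Finite.exists_equiv_fin A
  refine ⟨n, fun a => (e a).val + 1, fun a a' h => ?_, fun a => ⟨by simp, (e a).isLt⟩⟩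
  exact e.injective (Fin.ext (by simpa using h))

/-- The coding of a cell or a missing cell. -/
def ocode {A : Type} (code : A → ℕ) (a : Option A) : ℕ := a.elim 0 code

-- A failing local rule yields the digit `0`. If exactly one `d` fails nowhere, the search for the
-- first such rule finds it, so information scattered over the row is recovered by local checks
-- alone.
open Classical in
theorem exists_automaton {A D : Type} [Finite A] [Finite D]
    (rule : D → Option A → A → Option A → Option A) (ι : ℕ → A) (acc : A → Prop) :
    ∃ (b : ℕ) (code : A → ℕ), 5 ≤ b ∧ (∀ a, 0 < code a ∧ code a < b) ∧
      ∀ K, ∃ W ≥ K, ∀ z > W, (∀ k < 5, tab z b W 0 0 0 0 k = code (ι k)) ∧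
        (∀ a, tab z b W 1 0 0 0 (code a) = 1 ↔ acc a) ∧
        ∀ (N : ℕ) (u u' : ℕ → A) (d : D), 0 < N → b ^ N ≤ z →
          (∀ p < N, rule d (leftOf u p) (u p) (rightOf N u p) = some (u' p)) →
          (∀ d' ≠ d, ∃ p < N, rule d' (leftOf u p) (u p) (rightOf N u p) = none) →
          stepNum z b W N (∑ p ∈ Finset.range N, code (u p) * b ^ p) =
            ∑ p ∈ Finset.range N, code (u' p) * b ^ p := by
  obtain ⟨m, code, hinj, hcode⟩ := exists_code A
  obtain ⟨m', dcode, hdinj, hdcode⟩ := exists_code D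
  -- Room for the codes of cells and rules and for the five kinds of input cells, with `0` reserved
  -- for missing neighbours and failure.
  let b := m + m' + 5
  have hb0 : 0 < b := by simp only [b]; omega
  have hcb : ∀ a, code a < b := fun a => by have := hcode a; simp only [b]; omega
  have hdb : ∀ d, dcode d < b := fun a => by have := hdcode a; simp only [b]; omega
  have hob : ∀ o, ocode code o < b := by
    intro o
    cases o
    · exact hb0
    · exact hcb _
  have hoinj : Function.Injective (ocode code) := by
    intro o o' h
    cases o with
    | none => cases o' with
      | none => rfl
      | some a' => have := hcode a'; simp [ocode] at h; omega
    | some a => cases o' with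
      | none => have := hcode a; simp [ocode] at h; omega
      | some a' => simp only [ocode, Option.elim] at h; rw [hinj h]
  let g : ℕ → ℕ → ℕ → ℕ → ℕ → ℕ := fun op d l c r =>
    if op = 0 then code (ι r) else if op = 1 then
      (if ∃ a, code a = r ∧ acc a then 1 else 0) else
      if h : ∃ x : D × Option A × A × Option A,
        dcode x.1 = d ∧ ocode code x.2.1 = l ∧ code x.2.2.1 = c ∧ ocode code x.2.2.2 = r then
        ocode code (rule h.choose.1 h.choose.2.1 h.choose.2.2.1 h.choose.2.2.2) else 0
  have hg : ∀ op d l c r, g op d l c r < b := by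
    intro op d l c r
    simp only [g]
    split_ifs
    · exact hcb _
    · simp only [b]; omega
    · exact hb0
    · exact hob _
    · exact hb0
  have hgr : ∀ d l c r, g 2 (dcode d) (ocode code l) (code c) (ocode code r) =
      ocode code (rule d l c r) := by
    intro d l c r
    have h : ∃ x : D × Option A × A × Option A, dcode x.1 = dcode d ∧
      ocode code x.2.1 = ocode code l ∧ code x.2.2.1 = code c ∧
        ocode code x.2.2.2 = ocode code r := ⟨(d, l, c, r), rfl, rfl, rfl, rfl⟩
    have e : g 2 (dcode d) (ocode code l) (code c) (ocode code r) =
      ocode code (rule h.choose.1 h.choose.2.1 h.choose.2.2.1 h.choose.2.2.2) := by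
      simp only [g]
      rw [if_neg (by norm_num), if_neg (by norm_num), dif_pos h]
    obtain ⟨h1, h2, h3, h4⟩ := h.choose_spec
    rw [e, hdinj h1, hoinj h2, hinj h3, hoinj h4]
  have hgd : ∀ d', (∀ d, dcode d ≠ d') → ∀ l c r, g 2 d' l c r = 0 := by
    intro d' hd' l c r
    simp only [g]
    rw [if_neg (by norm_num), if_neg (by norm_num), dif_neg]
    rintro ⟨x, h, -⟩
    exact hd' _ h
  refine ⟨b, code, by simp only [b]; omega, fun a => ⟨(hcode a).1, hcb a⟩, fun K => ?_⟩
  obtain ⟨W, hWK, hW⟩ := exists_table b (by simp only [b]; omega) g hg K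
  refine ⟨W, hWK, fun z hz => ⟨fun k hk => ?_, fun a => ?_, fun N u u' d hN0 hN hd hd' => ?_⟩⟩
  · rw [hW z hz 0 (by norm_num) _ hb0 _ hb0 _ hb0 _ (by simp only [b]; omega)]
    simp [g]
  · rw [hW z hz 1 (by norm_num) _ hb0 _ hb0 _ hb0 _ (hcb a)]
    simp only [g, one_ne_zero, if_false, if_true]
    constructor
    · intro h
      by_contra hn
      rw [if_neg] at h
      · exact absurd h (by norm_num)
      · rintro ⟨a', h1, h2⟩
        rw [hinj h1] at h2
        exact hn h2
    · intro h
      rw [if_pos ⟨a, rfl, h⟩]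
  · have hdig := dig_sum (z := z) (a := fun p => code (u p)) (N := N) hb0 (fun i _ => hcb _) hN
    set C := ∑ p ∈ Finset.range N, code (u p) * b ^ p with hC
    have hl : ∀ p < N, (if p = 0 then 0 else dig z b C (p - 1)) = ocode code (leftOf u p) := by
      intro p hp
      simp only [leftOf]
      split_ifs with h
      · rfl
      · rw [hdig, if_pos (by omega)]; rfl
    have hr : ∀ p < N, dig z b C (p + 1) = ocode code (rightOf N u p) := by
      intro p hp
      rw [hdig]
      simp only [rightOf]
      split_ifs with h <;> rfl
    have hval : ∀ d', d' < b → ∀ p < N,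
        ruleVal z b W C d' p = g 2 d' (ocode code (leftOf u p)) (code (u p))
          (ocode code (rightOf N u p)) := by
      intro d' hd' p hp
      rw [ruleVal, hl p hp, hr p hp, hdig, if_pos hp,
        hW z hz 2 (by norm_num) _ hd' _ (hob _) _ (hcb _) _ (hob _)]
    have hgood : goodRule z b W N C = dcode d := by
      refine mu_eq (hdb d) (fun p hp => ?_) fun j hj hall => ?_
      · rw [hval _ (hdb d) p hp, hgr, hd p hp]
        exact (hcode _).1.ne'
      · have hjb : j < b := hj.trans (hdb d)
        by_cases hex : ∃ d', dcode d' = j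
        · obtain ⟨d', rfl⟩ := hex
          obtain ⟨p, hp, hnone⟩ := hd' d' (by rintro rfl; omega)
          refine hall p hp ?_
          rw [hval _ hjb p hp, hgr, hnone]
          rfl
        -- A digit coding no rule has only zero entries, so it already fails at cell `0`.
        · refine hall 0 hN0 ?_
          rw [hval _ hjb 0 hN0, hgd _ (fun d' h => hex ⟨d', h⟩)]
    rw [stepNum, hgood, sum_pw hb0 hN]
    refine Finset.sum_congr rfl fun p hp => ?_
    have hp := Finset.mem_range.1 hp
    rw [hval _ (hdb d) p hp, hgr, hd p hp]
    rfl

/-- Among the times `0, …, m` two give the same value. From there the orbit is periodic, yet it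
reaches a fixed point, so the repeated value is that point. No bound on the halting time `T` itself
is needed. -/
theorem iterate_eq_of_fixed {f : ℕ → ℕ} {x m T : ℕ} (hlt : ∀ t, f^[t] x < m)
    (hfix : f (f^[T] x) = f^[T] x) (t : ℕ) (ht : m ≤ t) : f^[t] x = f^[T] x := by
  have hconst : ∀ s ≥ T, f^[s] x = f^[T] x := by
    intro s hs
    obtain ⟨k, rfl⟩ := Nat.exists_eq_add_of_le' hs
    rw [Function.iterate_add_apply, Function.iterate_fixed hfix]
  obtain ⟨i, hi, j, hj, hij, he⟩ := Finset.exists_ne_map_eq_of_card_lt_of_maps_to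
    (s := Finset.range (m + 1)) (t := Finset.range m) (f := fun t => f^[t] x) (by simp)
    (fun t _ => by simpa using hlt t)
  wlog hlt' : i < j generalizing i j
  · exact this j hj i hi hij.symm he.symm (by omega)
  obtain ⟨e, rfl⟩ := Nat.exists_eq_add_of_lt hlt'
  have hper : ∀ k, f^[i + k * (e + 1)] x = f^[i] x := by
    intro k
    induction k with
    | zero => simp
    | succ k ih =>
      rw [show i + (k + 1) * (e + 1) = k * (e + 1) + (i + e + 1) by ring,
        Function.iterate_add_apply, ← he, ← Function.iterate_add_apply, add_comm, ih]
  have hi' : f^[i] x = f^[T] x := by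
    rw [← hper T]
    exact hconst _ (by nlinarith)
  have him : i ≤ t := by
    have := Finset.mem_range.1 hj
    omega
  obtain ⟨k, rfl⟩ := Nat.exists_eq_add_of_le' him
  rw [Function.iterate_add_apply, hi', Function.iterate_fixed hfix]

end BPS

namespace BPS

/-! ### Turing machines as cellular automata -/

attribute [instance] Machine.finiteState Machine.finiteSym

instance {α : Type} [Finite α] : Finite (InSym α) :=
  Finite.of_surjective
    (fun o : Option (Option α) => match o with
      | none => .leftEnd
      | some none => .rightEnd
      | some (some a) => .sym a)
    (fun s => match s with
      | .leftEnd => ⟨none, rfl⟩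
      | .rightEnd => ⟨some none, rfl⟩
      | .sym a => ⟨some (some a), rfl⟩)

/-- A cell holds the state and the last output symbol, and the contents of the cells of all tapes
together with the information which heads scan them. -/
@[ext] structure Cell {α β : Type} (M : Machine α β) where
  state : M.State
  last : Option β
  inSym : InSym α
  inHead : Bool
  sym : Fin M.tapes → M.Sym
  head : Fin M.tapes → Bool

variable {α β : Type}

instance [Finite α] [Finite β] (M : Machine α β) : Finite (Cell M) :=
  Finite.of_injective
    (fun c => (c.state, c.last, c.inSym, c.inHead, c.sym, c.head) :
      Cell M → M.State × Option β × InSym α × Bool × (Fin M.tapes → M.Sym) × (Fin M.tapes → Bool))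
    (fun c c' h => by
      simp only [Prod.mk.injEq] at h
      exact Cell.ext h.1 h.2.1 h.2.2.1 h.2.2.2.1 h.2.2.2.2.1 h.2.2.2.2.2)

/-- What a machine sees: its state and the scanned symbols. -/
abbrev View (M : Machine α β) := M.State × InSym α × (Fin M.tapes → M.Sym)

/-- Whether a head is on a cell after a move, given whether it was there or on a neighbour. -/
def shiftHead (m : Move) (l : Option Bool) (c : Bool) (r : Option Bool) : Bool :=
  match m with
  | .stay => c
  | .right => l.getD false
  | .left => r.getD false || (c && l.isNone)

/-- The move of the input head, taking into account that it stays on the right end marker. -/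
def clampMove (m : Move) (a : InSym α) : Move :=
  match m, a with
  | .right, .rightEnd => .stay
  | m, _ => m

open Classical in
/-- The local rule for a given view. -/
noncomputable def cellRule (M : Machine α β) (d : View M) (l : Option (Cell M)) (c : Cell M)
    (r : Option (Cell M)) : Option (Cell M) :=
  if c.state = d.1 ∧ (c.inHead = true → c.inSym = d.2.1) ∧
      ∀ i, c.head i = true → c.sym i = d.2.2 i then
    some (match M.δ d.1 d.2.1 d.2.2 with
      | none => c
      | some (q, m, w, o) =>
        { state := q
          last := o.or c.last
          inSym := c.inSym
          inHead := shiftHead (clampMove m d.2.1) (l.map Cell.inHead) c.inHead (r.map Cell.inHead)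
          sym := fun i => if c.head i then (w i).1 else c.sym i
          head := fun i => shiftHead (w i).2 (l.map fun a => a.head i) (c.head i)
            (r.map fun a => a.head i) })
  else none

/-- The cell at position `p` of a configuration. -/
def cellOf (M : Machine α β) (x : List α) (c : M.Cfg) (p : ℕ) : Cell M where
  state := c.state
  last := c.out.getLast?
  inSym := Machine.inputCell x p
  inHead := decide (c.inPos = p)
  sym := fun i => c.tape i p
  head := fun i => decide (c.pos i = p)

/-- The view of a configuration. -/
def viewOf (M : Machine α β) (x : List α) (c : M.Cfg) : View M :=
  (c.state, Machine.inputCell x c.inPos, fun i => c.tape i (c.pos i))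

/-- A missing left neighbour marks the wall at which a head moving left stays put. -/
theorem shiftHead_eq (m : Move) {N P p : ℕ} (hP : P < N) :
    shiftHead m (if p = 0 then none else some (decide (P = p - 1))) (decide (P = p))
      (if p + 1 < N then some (decide (P = p + 1)) else none) = decide (m.apply P = p) := by
  cases m with
  | left =>
    simp only [shiftHead, Move.apply]
    by_cases h0 : p = 0 <;> by_cases h1 : p + 1 < N <;> simp [h0, h1] <;> grind
  | stay => rfl
  | right =>
    simp only [shiftHead, Move.apply]
    by_cases h0 : p = 0
    · simp [h0]
    · rw [if_neg h0]
      exact decide_eq_decide.2 (by omega)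

theorem inputCell_eq_rightEnd {x : List α} {p : ℕ} (hp : p ≤ x.length + 1) :
    Machine.inputCell x p = .rightEnd ↔ p = x.length + 1 := by
  rcases p with _ | p
  · simp [Machine.inputCell]
  · simp only [Machine.inputCell]
    by_cases h : p < x.length
    · simp [List.getElem?_eq_getElem h]; omega
    · have : x[p]? = none := List.getElem?_eq_none (by omega)
      simp [this]; omega

/-- The clamp at `x.length + 1` refers to the length of the input; it becomes local because the head
sees the right marker there. -/
theorem clampMove_apply {x : List α} {p : ℕ} (hp : p ≤ x.length + 1) (m : Move) :
    (clampMove m (Machine.inputCell x p)).apply p = min (m.apply p) (x.length + 1) := by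
  have h := inputCell_eq_rightEnd hp
  cases m
  · simp only [clampMove, Move.apply]; omega
  · simp only [clampMove, Move.apply]; omega
  · by_cases e : Machine.inputCell x p = .rightEnd
    · rw [e]
      have := h.1 e
      simp only [clampMove, Move.apply]; omega
    · have h1 : clampMove .right (Machine.inputCell x p) = .right := by
        revert e
        cases Machine.inputCell x p <;> simp [clampMove]
      rw [h1]
      have : p ≠ x.length + 1 := fun h' => e (h.2 h')
      simp only [Move.apply]; omega

theorem cellRule_viewOf (M : Machine α β) (x : List α) (c : M.Cfg) {N : ℕ}
    (hin : c.inPos ≤ x.length + 1) (hN : x.length + 1 < N) (hpos : ∀ i, c.pos i < N) (p : ℕ) :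
    cellRule M (viewOf M x c) (leftOf (cellOf M x c) p) (cellOf M x c p)
      (rightOf N (cellOf M x c) p) = some (cellOf M x (M.next x c) p) := by
  have hmap : ∀ f : Cell M → Bool, (leftOf (cellOf M x c) p).map f =
      (if p = 0 then none else some (f (cellOf M x c (p - 1)))) := by
    intro f; unfold leftOf; split_ifs <;> rfl
  have hmap' : ∀ f : Cell M → Bool, (rightOf N (cellOf M x c) p).map f =
      (if p + 1 < N then some (f (cellOf M x c (p + 1))) else none) := by
    intro f; unfold rightOf; split_ifs <;> rfl
  unfold cellRule
  rw [if_pos]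
  · congr 1
    have hi : M.instr x c = M.δ (viewOf M x c).1 (viewOf M x c).2.1 (viewOf M x c).2.2 := rfl
    unfold Machine.next
    rw [hi]
    rcases M.δ (viewOf M x c).1 (viewOf M x c).2.1 (viewOf M x c).2.2 with _ | ⟨q, m, w, o⟩
    · rfl
    · simp only [hmap, hmap']
      refine Cell.ext rfl ?_ rfl ?_ ?_ ?_
      · simp only [cellOf]
        cases o <;> simp
      · simp only [cellOf]
        rw [shiftHead_eq _ (by omega), ← clampMove_apply hin]
        rfl
      · funext i
        simp only [cellOf, Function.update_apply, decide_eq_true_eq]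
        by_cases h : c.pos i = p
        · simp [h]
        · simp [h, Ne.symm h]
      · funext i
        simp only [cellOf]
        rw [shiftHead_eq _ (hpos i)]
  · refine ⟨rfl, fun h => ?_, fun i h => ?_⟩
    · simp only [cellOf, decide_eq_true_eq] at h
      simp [cellOf, viewOf, h]
    · simp only [cellOf, decide_eq_true_eq] at h
      simp [cellOf, viewOf, h]

/-- A view accepted by all cells agrees with the configuration under every head, and all heads lie
below `N`; this determines the view. -/
theorem cellRule_eq_none (M : Machine α β) (x : List α) (c : M.Cfg) {N : ℕ}
    (hin : c.inPos ≤ x.length + 1) (hN : x.length + 1 < N) (hpos : ∀ i, c.pos i < N) (d : View M)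
    (hd : d ≠ viewOf M x c) : ∃ p < N, cellRule M d (leftOf (cellOf M x c) p) (cellOf M x c p)
      (rightOf N (cellOf M x c) p) = none := by
  by_contra! hcon
  refine hd ?_
  have key : ∀ p < N, c.state = d.1 ∧ (c.inPos = p → Machine.inputCell x p = d.2.1) ∧
      ∀ i, c.pos i = p → c.tape i p = d.2.2 i := by
    intro p hp
    have := hcon p hp
    unfold cellRule at this
    by_contra h
    rw [if_neg] at this
    · exact this rfl
    · simpa [cellOf] using h
  refine Prod.ext (key 0 (by omega)).1.symm (Prod.ext ?_ ?_)
  · exact ((key c.inPos (by omega)).2.1 rfl).symm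
  · funext i
    exact ((key (c.pos i) (hpos i)).2.2 i rfl).symm

theorem Machine.inPos_run_le (M : Machine α β) (x : List α) (t : ℕ) :
    (M.run x t).inPos ≤ x.length + 1 := by
  induction t with
  | zero => simp [Machine.run, Machine.init]
  | succ t ih =>
    rw [Machine.run, Function.iterate_succ_apply', ← Machine.run]
    unfold Machine.next
    split
    · exact ih
    · simp

/-! ### The input tape of the simulated machine. -/

theorem kind_eq_zero (z n y j p : ℕ) : kind z n y j p = 0 ↔ p = 0 := by
  unfold kind; split_ifs <;> simp_all

theorem kind_lt (z n y j p : ℕ) : kind z n y j p < 5 := by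
  unfold kind; split_ifs <;> norm_num

theorem inputCell_unaryPair (n : ℕ) (τ : List Bool) (z y : ℕ)
    (hy : ∀ i (h : i < τ.length), dig z 2 y i = 1 ↔ τ[i] = true) (p : ℕ) :
    Machine.inputCell (unaryPair (n, τ)) p = match kind z n y τ.length p with
      | 0 => .leftEnd
      | 1 => .sym (some true)
      | 2 => .sym none
      | 3 => .sym (some false)
      | _ => .rightEnd := by
  rcases p with _ | p
  · simp [Machine.inputCell, kind]
  · simp only [Machine.inputCell, unaryPair, kind]
    rw [if_neg (by omega)]
    by_cases h1 : p < n
    · rw [List.getElem?_append_left (by simpa using h1), if_pos (by omega)]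
      simp [h1]
    · rw [List.getElem?_append_right (by simpa using h1), if_neg (by omega)]
      simp only [List.length_replicate]
      by_cases h2 : p = n
      · subst h2; simp
      · rw [if_neg (by omega)]
        obtain ⟨e, rfl⟩ : ∃ e, p = n + 1 + e := ⟨p - n - 1, by omega⟩
        rw [show n + 1 + e - n = e + 1 by omega, List.getElem?_cons_succ, List.getElem?_map,
          show n + 1 + e + 1 - (n + 2) = e by omega]
        by_cases h3 : e < τ.length
        · rw [if_pos (by omega), List.getElem?_eq_getElem h3]
          have := hy e h3
          cases h4 : τ[e] <;> simp_all
        · rw [if_neg (by omega), List.getElem?_eq_none (by omega)]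
          rfl

/-- The base `b` depends on the machine only, while `W` may be taken beyond any `K`. Acceptance is
read from the last output symbol, which every cell carries, so cell `0` is enough. -/
theorem exists_program (M : Machine (Option Bool) Bool) :
    ∃ b, 5 ≤ b ∧ ∀ K, ∃ W ≥ K, ∀ (z N n y : ℕ) (τ : List Bool) (a : Bool), W < z → b ^ N ≤ z →
      n + τ.length + 3 ≤ N → M.UsesSpace (unaryPair (n, τ)) N → M.Outputs (unaryPair (n, τ)) [a] →
      (∀ i (h : i < τ.length), dig z 2 y i = 1 ↔ τ[i] = true) →
      (Hit z b W N n y τ.length ↔ a = true) := by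
  let ι : ℕ → Cell M := fun k =>
    { state := M.start
      last := none
      inSym := match k with
        | 0 => .leftEnd
        | 1 => .sym (some true)
        | 2 => .sym none
        | 3 => .sym (some false)
        | _ => .rightEnd
      inHead := decide (k = 0)
      sym := fun _ => M.blank
      head := fun _ => decide (k = 0) }
  obtain ⟨b, code, hb, hcode, hK⟩ := exists_automaton (cellRule M) ι
    (fun c => c.last = some true)
  refine ⟨b, hb, fun K => ?_⟩
  obtain ⟨W, hWK, hW⟩ := hK K
  refine ⟨W, hWK, fun z N n y τ a hz hN hlen hsp ⟨T, hT, hTo⟩ hy => ?_⟩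
  obtain ⟨hinit, hacc, hstep⟩ := hW z hz
  set x := unaryPair (n, τ) with hx
  have hxl : x.length + 1 < N := by
    simp [hx, unaryPair]; omega
  have hb0 : 0 < b := by omega
  let C : ℕ → ℕ := fun t => ∑ p ∈ Finset.range N, code (cellOf M x (M.run x t) p) * b ^ p
  have hC : ∀ t, stepNum z b W N (C t) = C (t + 1) := by
    intro t
    refine hstep N _ _ (viewOf M x (M.run x t)) (by omega) hN (fun p _ => ?_) fun d hd => ?_
    · rw [cellRule_viewOf M x _ (M.inPos_run_le x t) hxl (hsp t)]
      simp only [Machine.run, Function.iterate_succ_apply']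
    · exact cellRule_eq_none M x _ (M.inPos_run_le x t) hxl (hsp t) d hd
  have hinit' : initNum z b W N n y τ.length = C 0 := by
    rw [initNum, sum_pw hb0 hN]
    refine Finset.sum_congr rfl fun p hp => ?_
    congr 1
    have hk0 := kind_eq_zero z n y τ.length p
    rw [hinit _ (kind_lt z n y τ.length p)]
    congr 1
    refine Cell.ext rfl rfl ?_ ?_ rfl ?_
    · exact (inputCell_unaryPair n τ z y hy p).symm
    · show decide (kind z n y τ.length p = 0) = decide (0 = p)
      rw [decide_eq_decide, hk0, eq_comm]
    · funext i
      show decide (kind z n y τ.length p = 0) = decide (0 = p)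
      rw [decide_eq_decide, hk0, eq_comm]
  have hiter : ∀ t, (stepNum z b W N)^[t] (C 0) = C t := by
    intro t
    induction t with
    | zero => rfl
    | succ t ih => rw [Function.iterate_succ_apply', ih, hC]
  have hCT : C (T + 1) = C T := by
    simp only [C]
    rw [show M.run x (T + 1) = M.run x T by
      rw [Machine.run, Function.iterate_succ_apply', ← Machine.run, Machine.next_of_halted hT]]
  -- There are fewer rows than `b ^ N ≤ z`, so `z` steps reach the halting row.
  have hfinal := iterate_eq_of_fixed (f := stepNum z b W N) (x := C 0) (m := b ^ N) (T := T)
    (fun t => by rw [hiter]; exact sum_digits_lt fun _ _ => (hcode _).2)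
    (by rw [hiter, hC, hCT]) z hN
  rw [Hit, hinit', hfinal, hiter, dig_sum hb0 (fun _ _ => (hcode _).2) hN, if_pos (by omega), hacc]
  simp [cellOf, hTo]

end BPS

namespace BPS

/-! ### The sequence -/

/-- The lengths at which the stages of the construction start. -/
def ell : ℕ → ℕ
  | 0 => 4
  | k + 1 => ell k ^ (k + 2)

/-- The number of bits of stage `k` that are chosen to avoid a test. -/
def seg (k : ℕ) : ℕ := ell k ^ (k + 1)

theorem four_le_ell (k : ℕ) : 4 ≤ ell k := by
  induction k with
  | zero => rfl
  | succ k ih => exact ih.trans (Nat.le_self_pow (by omega) _)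

theorem two_le_ell (k : ℕ) : 2 ≤ ell k := (by norm_num : 2 ≤ 4).trans (four_le_ell k)

theorem ell_succ (k : ℕ) : ell (k + 1) = ell k * seg k := by
  rw [ell, seg, pow_succ' _ (k + 1)]

theorem ell_le_seg (k : ℕ) : ell k ≤ seg k := Nat.le_self_pow (by omega) _

theorem ell_add_seg_lt (k : ℕ) : ell k + seg k < ell (k + 1) := by
  rw [ell_succ]
  nlinarith [four_le_ell k, ell_le_seg k]

theorem ell_add_seg_le (k : ℕ) : ell k + seg k ≤ ell (k + 1) := (ell_add_seg_lt k).le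

theorem ell_strictMono : StrictMono ell := strictMono_nat_of_lt_succ fun k => by
  have := ell_add_seg_le k
  have := two_le_ell k
  have := ell_le_seg k
  omega

theorem add_two_le_ell (k : ℕ) : k + 2 ≤ ell k := by
  induction k with
  | zero => exact two_le_ell 0
  | succ k ih =>
    have := ell_strictMono (Nat.lt_succ_self k)
    simp only [Nat.succ_eq_add_one] at this
    omega

/-- The cap used for all numbers in stage `k`. -/
def cap (k : ℕ) : ℕ := 2 ^ ell (k + 1) ^ 2

/-- The first `j < m` such that the `j`-bit prefix of the extension `y` is rejected. -/
noncomputable def firstHit (z k l l' m x y : ℕ) : ℕ :=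
  mu (fun j => Hit z (k - Nat.sqrt k * Nat.sqrt k) (Nat.sqrt k - (k - Nat.sqrt k * Nat.sqrt k)) l'
    (l + 1) (x + y * pw z 2 l) j) m

/-- The extension chosen in stage `k`. -/
noncomputable def bestExt (z k l l' m x : ℕ) : ℕ := argmax (firstHit z k l l' m x) (pw z 2 m)

/-- Stage `k` of the construction: the number coding the first `l'` bits of the sequence, from
the number `x` coding the first `l` bits. -/
noncomputable def stageNum (z k l l' m x : ℕ) : ℕ :=
  x + bestExt z k l l' m x * pw z 2 l + if k % 2 = 1 then pw z 2 l' - pw z 2 (l + m) else 0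

theorem E2.firstHit {z k l l' m x y : Env → ℕ} (hz : E2 z) (hk : E2 k) (hl : E2 l) (hl' : E2 l')
    (hm : E2 m) (hx : E2 x) (hy : E2 y) :
    E2 fun v => firstHit (z v) (k v) (l v) (l' v) (m v) (x v) (y v) :=
  E2.mu (p := fun v j => Hit (z v) (k v - Nat.sqrt (k v) * Nat.sqrt (k v))
    (Nat.sqrt (k v) - (k v - Nat.sqrt (k v) * Nat.sqrt (k v))) (l' v) (l v + 1)
    (x v + y v * BPS.pw (z v) 2 (l v)) j) hm
    (E2P.hit hz.shift (hk.shift.sub (hk.shift.sqrt.mul hk.shift.sqrt))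
      (hk.shift.sqrt.sub (hk.shift.sub (hk.shift.sqrt.mul hk.shift.sqrt))) hl'.shift hl.shift.succ
      (hx.shift.add (hy.shift.mul (hz.shift.pw (.const 2) hl.shift))) (.var 0))

theorem E2.stageNum {z k l l' m x : Env → ℕ} (hz : E2 z) (hk : E2 k) (hl : E2 l) (hl' : E2 l')
    (hm : E2 m) (hx : E2 x) :
    E2 fun v => stageNum (z v) (k v) (l v) (l' v) (m v) (x v) := by
  refine E2.add (E2.add hx (E2.mul ?_ (hz.pw (.const 2) hl)))
    (.ite (.eq (hk.mod (.const 2)) (.const 1))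
      ((hz.pw (.const 2) hl').sub (hz.pw (.const 2) (hl.add hm))) (.const 0))
  exact E2.argmax (f := fun v => BPS.firstHit (z v) (k v) (l v) (l' v) (m v) (x v))
    (hz.pw (.const 2) hm) (E2.firstHit hz.shift hk.shift hl.shift hl'.shift hm.shift hx.shift
      (.var 0))

/-- The number coding the first `ell k` bits of the sequence. -/
noncomputable def prefixNum : ℕ → ℕ
  | 0 => 0
  | k + 1 => stageNum (cap k) k (ell k) (ell (k + 1)) (seg k) (prefixNum k)

/-- The index of the stage in which bit `i` is determined. -/
noncomputable def stageOf (i : ℕ) : ℕ := mu (fun k => i < ell (k + 1)) i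

/-- The BPS random sequence. -/
noncomputable def randomSeq (i : ℕ) : Bool := (prefixNum (stageOf i + 1)).testBit i

/-- If the search below `i` fails, its default `i` still works, since `ell (i + 1)` exceeds `i`. -/
theorem lt_ell_stageOf (i : ℕ) : i < ell (stageOf i + 1) := by
  rcases (mu_spec (fun k => i < ell (k + 1)) i).2 with h | h
  · rw [stageOf, h]
    have := add_two_le_ell (i + 1)
    omega
  · exact h.2

theorem lt_stageOf_iff {k i : ℕ} : k < stageOf i ↔ ell (k + 1) ≤ i := by
  constructor
  · intro h
    have := (mu_spec (fun k => i < ell (k + 1)) i).1 k h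
    omega
  · intro h
    by_contra hk
    have h1 := lt_ell_stageOf i
    have h2 := ell_strictMono.monotone (show stageOf i + 1 ≤ k + 1 by omega)
    omega

/-- The chosen extension in stage `k`. -/
noncomputable def ext (k : ℕ) : ℕ :=
  bestExt (cap k) k (ell k) (ell (k + 1)) (seg k) (prefixNum k)

/-! ### The binary digits of the prefixes. -/

theorem pw_cap {k p : ℕ} (hp : p ≤ ell (k + 1)) : pw (cap k) 2 p = 2 ^ p := by
  rw [pw_eq _ _ _ (by norm_num), min_eq_left]
  exact Nat.pow_le_pow_right (by norm_num) (hp.trans (Nat.le_self_pow (by norm_num) _))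

/-- Three blocks of binary digits, lowest first: the old prefix, the chosen extension, the constant
run. No cap is active, since all exponents are at most `ell (k + 1)`. -/
theorem prefixNum_succ (k : ℕ) : prefixNum (k + 1) =
    2 ^ (ell k + seg k) * (if k % 2 = 1 then 2 ^ (ell (k + 1) - (ell k + seg k)) - 1 else 0) +
      (2 ^ ell k * ext k + prefixNum k) := by
  have h1 := ell_add_seg_le k
  rw [prefixNum, stageNum, ← ext, pw_cap (by omega), pw_cap le_rfl, pw_cap h1]
  split_ifs
  · rw [Nat.mul_sub, ← pow_add, Nat.add_sub_cancel' h1, mul_one]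
    ring
  · ring

theorem ext_lt (k : ℕ) : ext k < 2 ^ seg k := by
  have h1 := ell_add_seg_le k
  have := argmax_le (firstHit (cap k) k (ell k) (ell (k + 1)) (seg k) (prefixNum k)) (2 ^ seg k)
  rw [ext, bestExt, pw_cap (by omega)]
  have : 0 < 2 ^ seg k := by positivity
  omega

theorem two_pow_mul_add_lt {a b l m : ℕ} (ha : a < 2 ^ m) (hb : b < 2 ^ l) :
    2 ^ l * a + b < 2 ^ (l + m) := by
  rw [pow_add]
  nlinarith

theorem prefixNum_lt (k : ℕ) : prefixNum k < 2 ^ ell k := by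
  induction k with
  | zero => simp [prefixNum]
  | succ k ih =>
    have h1 := ell_add_seg_le k
    rw [prefixNum_succ]
    have h2 := two_pow_mul_add_lt (ext_lt k) ih
    have h3 : (if k % 2 = 1 then 2 ^ (ell (k + 1) - (ell k + seg k)) - 1 else 0) <
        2 ^ (ell (k + 1) - (ell k + seg k)) := by
      have : 0 < 2 ^ (ell (k + 1) - (ell k + seg k)) := by positivity
      split_ifs <;> omega
    have := two_pow_mul_add_lt h3 h2
    rwa [Nat.add_sub_cancel' h1] at this

theorem testBit_prefixNum_succ (k i : ℕ) : (prefixNum (k + 1)).testBit i =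
    if i < ell k + seg k then (2 ^ ell k * ext k + prefixNum k).testBit i
    else decide (k % 2 = 1 ∧ i < ell (k + 1)) := by
  rw [prefixNum_succ, Nat.testBit_two_pow_mul_add _
    (two_pow_mul_add_lt (ext_lt k) (prefixNum_lt k))]
  split_ifs with h1 h2
  · rfl
  · rw [Nat.testBit_two_pow_sub_one]
    exact decide_eq_decide.2 (by omega)
  · simp [h2]

theorem testBit_prefixNum_succ_of_lt {k i : ℕ} (h : i < ell k) :
    (prefixNum (k + 1)).testBit i = (prefixNum k).testBit i := by
  rw [testBit_prefixNum_succ, if_pos (by omega), Nat.testBit_two_pow_mul_add _ (prefixNum_lt k),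
    if_pos h]

theorem testBit_prefixNum_of_le {k k' i : ℕ} (hk : k ≤ k') (h : i < ell k) :
    (prefixNum k').testBit i = (prefixNum k).testBit i := by
  induction k', hk using Nat.le_induction with
  | base => rfl
  | succ k' hk ih =>
    rw [testBit_prefixNum_succ_of_lt (h.trans_le (ell_strictMono.monotone hk)), ih]

theorem randomSeq_eq {k i : ℕ} (h : i < ell k) : randomSeq i = (prefixNum k).testBit i := by
  rcases le_total (stageOf i + 1) k with h1 | h1
  · exact (testBit_prefixNum_of_le h1 (lt_ell_stageOf i)).symm
  · exact testBit_prefixNum_of_le h1 h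

theorem randomSeq_of_const {k i : ℕ} (h : ell k + seg k ≤ i) (h' : i < ell (k + 1)) :
    randomSeq i = decide (k % 2 = 1) := by
  rw [randomSeq_eq h', testBit_prefixNum_succ, if_neg (by omega)]
  exact decide_eq_decide.2 (by omega)

/-! ### Randomness -/

theorem res_length (X : ℕ → Bool) (n : ℕ) : (res X n).length = n := by simp [res]

/-- The measure of a cylinder set. -/
theorem cantorMeasure_cylinder (X : ℕ → Bool) (l : ℕ) :
    cantorMeasure {Z | ∀ i < l, Z i = X i} = 2⁻¹ ^ l := by
  have h : {Z : ℕ → Bool | ∀ i < l, Z i = X i} =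
      (Finset.range l : Set ℕ).pi (fun i => {X i}) := by
    ext Z; simp [Set.mem_pi]
  rw [h, cantorMeasure, Measure.infinitePi_pi _ (fun i _ => measurableSet_singleton _)]
  simp

/-- A cylinder of measure `2 ^ (-l)` does not fit into a set of smaller measure. -/
theorem exists_notMem_of_measure_le {U : Set (ℕ → Bool)} {l n : ℕ} (X : ℕ → Bool) (hln : l < n)
    (hU : cantorMeasure U ≤ 2⁻¹ ^ n) : ∃ Z, (∀ i < l, Z i = X i) ∧ Z ∉ U := by
  by_contra! h
  have h1 : cantorMeasure {Z | ∀ i < l, Z i = X i} ≤ cantorMeasure U := measure_mono h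
  rw [cantorMeasure_cylinder] at h1
  have h2 := h1.trans hU
  have h3 : (2⁻¹ : ENNReal) ^ n < 2⁻¹ ^ l := by
    rw [← ENNReal.inv_pow, ← ENNReal.inv_pow, ENNReal.inv_lt_inv]
    exact_mod_cast Nat.pow_lt_pow_right (by norm_num) hln
  exact absurd h2 (not_le.2 h3)

/-! ### Polynomial bounds on the resources of a test. -/

theorem eval_le_pow (P : Polynomial ℕ) : ∃ c, ∀ x ≥ 2, P.eval x ≤ x ^ c := by
  induction P using Polynomial.induction_on' with
  | add p q hp hq =>
    obtain ⟨c, hc⟩ := hp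
    obtain ⟨c', hc'⟩ := hq
    refine ⟨max c c' + 1, fun x hx => ?_⟩
    rw [Polynomial.eval_add, pow_succ]
    have h1 := (hc x hx).trans (Nat.pow_le_pow_right (by omega) (le_max_left c c'))
    have h2 := (hc' x hx).trans (Nat.pow_le_pow_right (by omega) (le_max_right c c'))
    nlinarith
  | monomial n a =>
    refine ⟨a + n, fun x hx => ?_⟩
    rw [Polynomial.eval_monomial, pow_add]
    exact Nat.mul_le_mul_right _ (Nat.lt_two_pow_self.le.trans (Nat.pow_le_pow_left hx a))

theorem eval_mono (P : Polynomial ℕ) : Monotone fun x => P.eval x := by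
  induction P using Polynomial.induction_on' with
  | add p q hp hq =>
    intro x y h
    simp only [Polynomial.eval_add]
    exact add_le_add (hp h) (hq h)
  | monomial n a =>
    intro x y h
    simp only [Polynomial.eval_monomial]
    gcongr

theorem Machine.length_out_run_le {α β : Type} (M : Machine α β) (x : List α) (t : ℕ) :
    (M.run x t).out.length ≤ t := by
  induction t with
  | zero => simp [Machine.run, Machine.init]
  | succ t ih =>
    rw [Machine.run, Function.iterate_succ_apply', ← Machine.run]
    unfold Machine.next
    split
    · omega
    · rename_i o _
      cases o <;> simp <;> omega

/-- A machine writes at most one symbol per step, so its running time bounds the length of its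
output. -/
theorem PTIME.exists_bound {f : ℕ → ℕ} (h : PTIME unary fun n => unary (f n)) :
    ∃ q : Polynomial ℕ, ∀ n, f n ≤ q.eval n := by
  obtain ⟨M, q, hq⟩ := h
  refine ⟨q, fun n => ?_⟩
  have h1 := M.length_out_run_le (unary n) (q.eval (unary n).length)
  rw [(hq n).2] at h1
  simpa [unary] using h1

theorem dig_cap {k y i : ℕ} (hy : y < 2 ^ ell (k + 1)) :
    dig (cap k) 2 y i = 1 ↔ y.testBit i = true := by
  have : y < cap k := hy.trans_le (Nat.pow_le_pow_right (by norm_num)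
    (Nat.le_self_pow (by norm_num) _))
  rw [dig_eq (by norm_num) this, Nat.testBit_eq_decide_div_mod_eq, decide_eq_true_eq]

theorem randomSeq_isBPSRandom : IsBPSRandom randomSeq := by
  intro T
  obtain ⟨M, p, hp⟩ := T.G_mem
  obtain ⟨q, hq⟩ := T.f_mem.exists_bound
  obtain ⟨b, hb, hK⟩ := exists_program M
  -- The summands cover `T.f n` for `n = ell k + 1`, the space used on inputs of length at most `n +
  -- 1 + T.f n`, and the slack for row length `n + T.f n + 3`.
  obtain ⟨c, hc⟩ := eval_le_pow (q.comp (.X + 1) + p.comp (.X + 2 + q.comp (.X + 1)) + .X + 4)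
  obtain ⟨W, hWK, hW⟩ := hK c
  -- As `b ≤ 2 * (b + W)`, the square root of `k` is `b + W`, which decodes the pair. Moreover `c ≤
  -- W ≤ k` puts `ell k ^ c` below `seg k`.
  set k := (b + W) * (b + W) + b with hk
  have hsqrt : Nat.sqrt k = b + W := Nat.sqrt_add_eq _ (by omega)
  have hkb : k - Nat.sqrt k * Nat.sqrt k = b := by rw [hsqrt]; omega
  have hkW : Nat.sqrt k - (k - Nat.sqrt k * Nat.sqrt k) = W := by rw [hkb, hsqrt]; omega
  have hWk : W ≤ k := by nlinarith
  set n := ell k + 1 with hn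
  have hfN : T.f n < seg k ∧ p.eval (n + 1 + T.f n) ≤ ell (k + 1) ∧
      n + T.f n + 3 ≤ ell (k + 1) := by
    have h1 := hc (ell k) (two_le_ell k)
    have h2 : ell k ^ c ≤ seg k := Nat.pow_le_pow_right (by have := two_le_ell k; omega) (by omega)
    have h3 := ell_add_seg_le k
    have h4 := hq n
    have h5 := eval_mono p (show n + 1 + T.f n ≤ ell k + 2 + q.eval n by omega)
    simp only [Polynomial.eval_add, Polynomial.eval_comp, Polynomial.eval_X, Polynomial.eval_one,
      Polynomial.eval_ofNat] at h1
    simp only at h5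
    rw [← hn] at h1
    omega
  have hbk : b ^ ell (k + 1) ≤ cap k := by
    have h1 : b ≤ 2 ^ k := (by omega : b ≤ k).trans Nat.lt_two_pow_self.le
    have h2 := add_two_le_ell (k + 1)
    calc b ^ ell (k + 1) ≤ (2 ^ k) ^ ell (k + 1) := Nat.pow_le_pow_left h1 _
      _ = 2 ^ (k * ell (k + 1)) := (pow_mul _ _ _).symm
      _ ≤ cap k := Nat.pow_le_pow_right (by norm_num) (by rw [sq]; nlinarith)
  have hWz : W < cap k := by
    have h2 := add_two_le_ell (k + 1)
    calc W ≤ k := hWk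
      _ < 2 ^ k := Nat.lt_two_pow_self
      _ ≤ cap k := Nat.pow_le_pow_right (by norm_num) (by nlinarith)
  have hl1 := ell_add_seg_le k
  -- the simulation is correct on all strings that matter
  have hHit : ∀ (Y : ℕ) (Z : ℕ → Bool), Y < 2 ^ (ell k + seg k) →
      (∀ i < ell k + seg k, Y.testBit i = Z i) → ∀ j ≤ T.f n,
      (Hit (cap k) (k - Nat.sqrt k * Nat.sqrt k) (Nat.sqrt k - (k - Nat.sqrt k * Nat.sqrt k))
        (ell (k + 1)) n Y j ↔ T.G n (res Z j) = true) := by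
    intro Y Z hY hYZ j hj
    rw [hkW, hkb]
    have hp' := hp (n, res Z j)
    have hlen : (unaryPair (n, res Z j)).length = n + 1 + j := by
      simp [unaryPair, res_length]; omega
    rw [hlen] at hp'
    have := hW (cap k) (ell (k + 1)) n Y (res Z j) (T.G n (res Z j)) hWz hbk
      (by rw [res_length]; omega)
      (fun t i => (hp'.2.1 t i).trans_le
        ((eval_mono p (show n + 1 + j ≤ n + 1 + T.f n by omega)).trans hfN.2.1))
      hp'.1 (fun i hi => by
        rw [res_length] at hi
        rw [dig_cap (hY.trans_le (Nat.pow_le_pow_right (by norm_num) hl1)),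
          hYZ i (by omega)]
        simp [res])
    rwa [res_length] at this
  -- an extension avoiding the test
  obtain ⟨Z, hZX, hZU⟩ := exists_notMem_of_measure_le randomSeq (show ell k < n by omega)
    (T.measure_le n)
  set Y := Nat.ofBits (fun i : Fin (ell k + seg k) => Z i) with hYdef
  have hYlt : Y < 2 ^ (ell k + seg k) := Nat.ofBits_lt_two_pow _
  have hYZ : ∀ i < ell k + seg k, Y.testBit i = Z i := fun i hi => Nat.testBit_ofBits_lt _ i hi
  set y := Y / 2 ^ ell k with hy
  have hYy : Y = prefixNum k + y * 2 ^ ell k := by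
    have h1 : Y % 2 ^ ell k = prefixNum k := by
      refine Nat.eq_of_testBit_eq fun i => ?_
      rw [Nat.testBit_mod_two_pow]
      by_cases h : i < ell k
      · rw [hYZ i (by omega), hZX i h, randomSeq_eq h]; simp [h]
      · rw [Nat.testBit_lt_two_pow ((prefixNum_lt k).trans_le
          (Nat.pow_le_pow_right (by norm_num) (by omega)))]
        simp [h]
    rw [← h1, hy, mul_comm, Nat.mod_add_div]
  have hylt : y < 2 ^ seg k := by
    rw [hy, Nat.div_lt_iff_lt_mul (by positivity), ← pow_add, add_comm (seg k)]
    exact hYlt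
  set F := firstHit (cap k) k (ell k) (ell (k + 1)) (seg k) (prefixNum k) with hF
  have hpwl : pw (cap k) 2 (ell k) = 2 ^ ell k := pw_cap (by omega)
  have hFy : T.f n < F y := by
    have hmu := (mu_spec (fun j => Hit (cap k) (k - Nat.sqrt k * Nat.sqrt k)
      (Nat.sqrt k - (k - Nat.sqrt k * Nat.sqrt k)) (ell (k + 1)) n
      (prefixNum k + y * pw (cap k) 2 (ell k)) j) (seg k)).2
    have hFe : F y = mu (fun j => Hit (cap k) (k - Nat.sqrt k * Nat.sqrt k)
      (Nat.sqrt k - (k - Nat.sqrt k * Nat.sqrt k)) (ell (k + 1)) n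
      (prefixNum k + y * pw (cap k) 2 (ell k)) j) (seg k) := rfl
    rw [← hFe] at hmu
    rcases hmu with h | ⟨-, h⟩
    · omega
    -- A rejection at length at most `T.f n` would be a correct one and would put `Z` into the test
    -- set.
    · by_contra hle
      rw [hpwl, ← hYy, hHit Y Z hYlt hYZ _ (by omega)] at h
      exact hZU ⟨res Z (F y), ⟨by rw [res_length]; omega, h⟩, by rw [res_length]⟩
  have hFe : T.f n < F (ext k) := by
    -- The chosen extension is first rejected no earlier than `y`. Beyond `T.f n` the simulation may
    -- be wrong, but this does no harm.
    refine hFy.trans_le ?_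
    rw [ext, bestExt, pw_cap (by omega)]
    exact le_argmax F hylt
  -- the sequence passes the test
  refine ⟨n, ?_⟩
  rintro ⟨τ, ⟨hτl, hτG⟩, hτ⟩
  set j := τ.length
  have hno := (mu_spec (fun j => Hit (cap k) (k - Nat.sqrt k * Nat.sqrt k)
      (Nat.sqrt k - (k - Nat.sqrt k * Nat.sqrt k)) (ell (k + 1)) n
      (prefixNum k + ext k * pw (cap k) 2 (ell k)) j) (seg k)).1 j (lt_of_le_of_lt hτl hFe)
  rw [hpwl] at hno
  have hlt : prefixNum k + ext k * 2 ^ ell k < 2 ^ (ell k + seg k) := by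
    have := two_pow_mul_add_lt (ext_lt k) (prefixNum_lt k)
    rwa [add_comm, mul_comm] at this
  rw [hHit _ randomSeq hlt (fun i hi => ?_) j hτl, hτ] at hno
  · exact hno hτG
  · rw [randomSeq_eq (show i < ell (k + 1) by omega), testBit_prefixNum_succ, if_pos hi,
      add_comm, mul_comm]

end BPS

namespace BPS

/-! ### The density of ones -/

/-- Here `ell k + seg k ≤ 2 * seg k`, while `ell (k + 1) = ell k * seg k`. -/
theorem two_mul_div_ell (k : ℕ) : ((ell k + seg k : ℕ) : ℝ) / ell (k + 1) ≤ 2 / ell k := by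
  have h1 : (0 : ℝ) < ell k := by have := two_le_ell k; positivity
  have h2 : (0 : ℝ) < seg k := by
    have := two_le_ell k; have := ell_le_seg k
    exact_mod_cast (by omega : 0 < seg k)
  have h3 : (ell k : ℝ) ≤ seg k := by exact_mod_cast ell_le_seg k
  rw [ell_succ, div_le_div_iff₀ (by push_cast; positivity) h1]
  push_cast
  nlinarith

theorem density_le {k : ℕ} (hk : k % 2 = 0) : density randomSeq (ell (k + 1)) ≤ 2 / ell k := by
  refine le_trans ?_ (two_mul_div_ell k)
  unfold density
  gcongr
  have : (Finset.range (ell (k + 1))).filter (fun i => randomSeq i = true) ⊆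
      Finset.range (ell k + seg k) := by
    intro i hi
    simp only [Finset.mem_filter, Finset.mem_range] at hi ⊢
    by_contra h
    have := randomSeq_of_const (not_lt.1 h) hi.1
    simp_all
  simpa using Finset.card_le_card this

theorem le_density {k : ℕ} (hk : k % 2 = 1) : 1 - 2 / ell k ≤ density randomSeq (ell (k + 1)) := by
  have h0 : (0 : ℝ) < ell (k + 1) := by have := two_le_ell (k + 1); positivity
  have h1 := two_mul_div_ell k
  have h2 : 1 - ((ell k + seg k : ℕ) : ℝ) / ell (k + 1) ≤ density randomSeq (ell (k + 1)) := by
    unfold density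
    rw [one_sub_div h0.ne']
    gcongr
    have : Finset.Ico (ell k + seg k) (ell (k + 1)) ⊆
        (Finset.range (ell (k + 1))).filter (fun i => randomSeq i = true) := by
      intro i hi
      simp only [Finset.mem_filter, Finset.mem_range, Finset.mem_Ico] at hi ⊢
      refine ⟨hi.2, ?_⟩
      rw [randomSeq_of_const hi.1 hi.2]
      simpa using hk
    have h3 := Finset.card_le_card this
    rw [Nat.card_Ico, Nat.sub_le_iff_le_add] at h3
    rw [sub_le_iff_le_add]
    exact_mod_cast h3
  linarith

/-- Along the ends of even stages a limit would have to be at most 0, along those of odd stages at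
least 1. -/
theorem density_not_tendsto : ¬ ∃ L : ℝ, Tendsto (density randomSeq) atTop (𝓝 L) := by
  rintro ⟨L, hL⟩
  have hell : Tendsto (fun k => (2 : ℝ) / ell k) atTop (𝓝 0) :=
    tendsto_const_nhds.div_atTop (tendsto_natCast_atTop_atTop.comp ell_strictMono.tendsto_atTop)
  have hsub : Tendsto (fun k => density randomSeq (ell (k + 1))) atTop (𝓝 L) :=
    hL.comp (ell_strictMono.tendsto_atTop.comp (tendsto_add_atTop_nat 1))
  have heven : Tendsto (fun j : ℕ => 2 * j) atTop atTop :=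
    tendsto_id.const_mul_atTop' (by norm_num)
  have hodd : Tendsto (fun j : ℕ => 2 * j + 1) atTop atTop :=
    (tendsto_add_atTop_nat 1).comp heven
  have h0 : L ≤ 0 := le_of_tendsto_of_tendsto' (hsub.comp heven) (hell.comp heven)
    fun j => density_le (Nat.mul_mod_right 2 j)
  have h1 : 1 - 0 ≤ L := le_of_tendsto_of_tendsto' ((tendsto_const_nhds.sub hell).comp hodd)
    (hsub.comp hodd) fun j => le_density (Nat.mul_add_mod 2 j 1)
  linarith

/-! ### A martingale that succeeds -/

/-- The string `σ` has the bits of the sequence at the last positions of all stages. -/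
def GoodBits (σ : List Bool) : Prop :=
  ∀ k, ell (k + 1) ≤ σ.length → σ[ell (k + 1) - 1]? = some (decide (k % 2 = 1))

open Classical in
/-- The martingale that bets everything on the last bit of every stage. -/
noncomputable def mart (σ : List Bool) : ℚ := if GoodBits σ then 2 ^ stageOf σ.length else 0

/-! ### Stage boundaries and the capital of the martingale. -/

theorem stageOf_succ {n k : ℕ} (h : n + 1 = ell (k + 1)) :
    stageOf n = k ∧ stageOf (n + 1) = k + 1 := by
  have h1 : ∀ j, j < stageOf n ↔ j < k := fun j => by
    rw [lt_stageOf_iff]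
    have := ell_strictMono.lt_iff_lt (a := j + 1) (b := k + 1)
    omega
  have h2 : ∀ j, j < stageOf (n + 1) ↔ j < k + 1 := fun j => by
    rw [lt_stageOf_iff, h, ell_strictMono.le_iff_le]
    omega
  have a1 := h1 k
  have a2 := h1 (stageOf n)
  have a3 := h2 (k + 1)
  have a4 := h2 (stageOf (n + 1))
  omega

theorem stageOf_succ_of_ne {n : ℕ} (h : ∀ k, n + 1 ≠ ell (k + 1)) :
    stageOf (n + 1) = stageOf n := by
  have h1 : ∀ j, j < stageOf (n + 1) ↔ j < stageOf n := fun j => by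
    rw [lt_stageOf_iff, lt_stageOf_iff]
    have := h j
    omega
  have a1 := h1 (stageOf n)
  have a2 := h1 (stageOf (n + 1))
  omega

theorem goodBits_append_of_ne {σ : List Bool} (h : ∀ k, σ.length + 1 ≠ ell (k + 1)) (b : Bool) :
    GoodBits (σ ++ [b]) ↔ GoodBits σ := by
  refine forall_congr' fun k => ?_
  have h1 := h k
  have h2 := two_le_ell (k + 1)
  rw [List.length_append, List.length_singleton]
  by_cases h3 : ell (k + 1) ≤ σ.length
  · rw [List.getElem?_append_left (by omega)]
    exact ⟨fun h _ => h (by omega), fun h _ => h h3⟩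
  · exact ⟨fun _ h => absurd h h3, fun _ h => by omega⟩

theorem goodBits_append {σ : List Bool} {k : ℕ} (h : σ.length + 1 = ell (k + 1)) (b : Bool) :
    GoodBits (σ ++ [b]) ↔ GoodBits σ ∧ b = decide (k % 2 = 1) := by
  unfold GoodBits
  rw [List.length_append, List.length_singleton]
  constructor
  · intro hg
    refine ⟨fun j hj => ?_, ?_⟩
    · have := hg j (by omega)
      have h2 := two_le_ell (j + 1)
      rwa [List.getElem?_append_left (by omega)] at this
    · have := hg k (by omega)
      rw [← h] at this
      simpa using this
  · rintro ⟨hg, rfl⟩ j hj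
    by_cases hjk : j = k
    · subst hjk
      rw [← h]
      simp
    · have h2 := two_le_ell (j + 1)
      have h3 : ell (j + 1) ≠ ell (k + 1) := fun e => hjk (by
        have := ell_strictMono.injective e
        omega)
      rw [List.getElem?_append_left (by omega)]
      exact hg j (by omega)

/-- At the last bit of a stage the capital doubles or is lost; at all other bits it does not change.
-/
theorem mart_isMartingale : IsMartingale mart where
  nonneg σ := by
    unfold mart
    split_ifs <;> positivity
  init := by
    have h0 : stageOf 0 = 0 := by
      have := @lt_stageOf_iff 0 0
      have := two_le_ell (0 + 1)
      omega
    have : GoodBits [] := fun k hk => by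
      have := two_le_ell (k + 1)
      simp at hk
      omega
    simp [mart, this, h0]
  fair σ := by
    by_cases h : ∃ k, σ.length + 1 = ell (k + 1)
    · obtain ⟨k, hk⟩ := h
      obtain ⟨h1, h2⟩ := stageOf_succ hk
      have e := goodBits_append hk
      by_cases hg : GoodBits σ
      · by_cases ho : k % 2 = 1
        · rw [mart, mart, mart, if_pos hg, if_neg (by rw [e]; simp [ho]),
            if_pos (by rw [e]; simp [ho, hg])]
          simp [h1, h2, pow_succ]
        · rw [mart, mart, mart, if_pos hg, if_pos (by rw [e]; simp [ho, hg]),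
            if_neg (by rw [e]; simp [ho])]
          simp [h1, h2, pow_succ]
      · rw [mart, mart, mart, if_neg hg, if_neg (by rw [e]; simp [hg]),
          if_neg (by rw [e]; simp [hg])]
        simp
    · push Not at h
      have e := goodBits_append_of_ne h
      by_cases hg : GoodBits σ
      · rw [mart, mart, mart, if_pos hg, if_pos ((e _).2 hg), if_pos ((e _).2 hg)]
        simp [stageOf_succ_of_ne h]
      · rw [mart, mart, mart, if_neg hg, if_neg (mt (e _).1 hg), if_neg (mt (e _).1 hg)]
        simp

/-- The inequality `ell k + seg k < ell (k + 1)` is strict, so the last position of a stage always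
lies in its constant run. -/
theorem goodBits_res (m : ℕ) : GoodBits (res randomSeq m) := by
  intro k hk
  rw [res_length] at hk
  have h := ell_add_seg_lt k
  have h2 := two_le_ell (k + 1)
  have := randomSeq_of_const (k := k) (i := ell (k + 1) - 1) (by omega) (by omega)
  rw [← this, List.getElem?_eq_getElem (by rw [res_length]; omega)]
  simp [res]

theorem mart_succeeds : Succeeds mart randomSeq := by
  intro n
  refine ⟨ell n, ?_⟩
  rw [mart, if_pos (goodBits_res _), res_length]
  refine pow_le_pow_right₀ (by norm_num) ?_
  rcases n with _ | n
  · exact Nat.zero_le _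
  · have := (lt_stageOf_iff (k := n)).2 le_rfl
    omega

end BPS

namespace BPS

/-! ### The programs -/

variable {β : Type}

/-- Assignment of `f`, evaluated on the current counter values, to counter `t`. -/
theorem E2.exists_assign {f : Env → ℕ} (hf : E2 f) :
    ∃ K D, ∀ K' ≥ K, ∀ D' ≥ D, ∀ t < K', ∃ c : Cmd β, ∀ (s : Env) (B : ℕ), sz K' s ^ D' ≤ B →
      (∀ r, s r ≤ B) → ∃ s', Runs B c s s' ∧ s' t = f s ∧ ∀ r < K', r ≠ t → s' r = s r := by
  obtain ⟨K, D, h⟩ := hf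
  refine ⟨K, D, fun K' hK D' hD t ht => ?_⟩
  obtain ⟨c, hc⟩ := h β id K' (K' + 1) (by omega) (fun i hi => by simp; omega)
  -- The target `t` may be one of the arguments of `f`, so the value is formed in the fresh counter
  -- `K'` and copied afterwards.
  refine ⟨.seq c (.copy K' t (K' + 1)), fun s B hB hs => ?_⟩
  obtain ⟨s1, h1, h2, h3⟩ := hc s B s (fun _ _ => rfl) ((sz_pow_mono hK hD s).trans hB) hs
  obtain ⟨s2, h4, h5, h6⟩ := Runs.copy (β := β) (by omega : K' ≠ t) (by omega : K' ≠ K' + 1)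
    (by omega : t ≠ K' + 1) (h1.le hs)
  exact ⟨s2, h1.seq h4, by rw [h5, h2], fun r hr hrt => by
    rw [h6 r hrt (by omega), h3 r (by omega) (by omega)]⟩

/-- In the programs below only four counters carry data between assignments, so the size does not
depend on how large `K` must be. -/
theorem sz_eq_of_four {K : ℕ} (hK : 4 ≤ K) {s : Env} (h : ∀ r < K, 4 ≤ r → s r = 0) :
    sz K s = s 0 + s 1 + s 2 + s 3 + 2 := by
  have : ∑ i ∈ Finset.range 4, s i = ∑ i ∈ Finset.range K, s i :=
    Finset.sum_subset (Finset.range_subset_range.2 hK) fun i hi hi' => by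
      simp only [Finset.mem_range, not_lt] at hi hi'
      exact h i hi hi'
  rw [sz, ← this]
  simp [Finset.sum_range_succ]

theorem Exec.loop_out {B r : ℕ} (b : β) (n : ℕ) (s : Env) (inp : List Bool) (o : List β)
    (h : s r = n) : Exec B (.loop r (.out b)) ⟨s, inp, o⟩
      ⟨Function.update s r 0, inp, o ++ List.replicate n b⟩ := by
  induction n generalizing s o with
  | zero =>
    rw [List.replicate_zero, List.append_nil, Function.update_eq_self_iff.2 h.symm]
    exact .loopZero h
  | succ n ih =>
    refine .loopSucc (v := n) h (.out _ b) ?_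
    have := ih (Function.update s r n) (o ++ [b]) (by simp)
    rwa [Function.update_idem, List.append_assoc, List.singleton_append,
      ← List.replicate_succ] at this

/-! ### Stage lengths and stage indices with bounded values. -/

/-- The lengths `ell k`, capped at `z`. -/
def ellCap (z k : ℕ) : ℕ := Nat.rec (min 4 z) (fun i r => pw z r (i + 2)) k

theorem ellCap_le (z k : ℕ) : ellCap z k ≤ z := by
  cases k with
  | zero => exact min_le_right _ _
  | succ k => exact pw_le z (ellCap z k) (k + 2)

theorem ellCap_eq (z k : ℕ) : ellCap z k = min (ell k) z := by
  -- For `z = 0` the capped base is zero, which `pw_eq` excludes.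
  rcases Nat.eq_zero_or_pos z with rfl | hz
  · have := ellCap_le 0 k
    omega
  induction k with
  | zero => rfl
  | succ k ih =>
    show pw z (ellCap z k) (k + 2) = min (ell k ^ (k + 2)) z
    have h4 := four_le_ell k
    rw [pw_eq _ _ _ (by rw [ih]; omega), ih]
    rcases le_total (ell k) z with h | h
    · rw [min_eq_left h]
    · rw [min_eq_right h, min_eq_right (Nat.le_self_pow (by omega) _),
        min_eq_right (h.trans (Nat.le_self_pow (by omega) _))]

theorem E2.ellCap {z k : Env → ℕ} (hz : E2 z) (hk : E2 k) : E2 fun v => ellCap (z v) (k v) :=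
  E2.natRec (h := fun v i r => BPS.pw (z v) r (i + 2)) hk ((E2.const 4).min hz)
    (hz.shift2.pw (.var 1) (E2.var 0).succ.succ) hz.polyBounded
    (fun v i _ => ellCap_le (z v) i)

/-- The index of a stage, computed from capped lengths. -/
noncomputable def stageCap (z i : ℕ) : ℕ := mu (fun k => i < ellCap z (k + 1)) i

theorem stageCap_eq {z i : ℕ} (h : i < z) : stageCap z i = stageOf i := by
  unfold stageCap stageOf
  congr 1
  funext k
  rw [ellCap_eq]
  exact propext (by omega)

theorem E2.stageCap {z i : Env → ℕ} (hz : E2 z) (hi : E2 i) : E2 fun v => stageCap (z v) (i v) :=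
  E2.mu (p := fun v k => i v < BPS.ellCap (z v) (k + 1)) hi
    (.lt hi.shift (hz.shift.ellCap (E2.var 0).succ))

/-! ### The martingale is computable in polynomial space -/

theorem binVal_append_singleton (σ : List Bool) (b : Bool) :
    binVal (σ ++ [b]) = 2 * binVal σ + b.toNat := by
  simp [binVal]

theorem binVal_lt (σ : List Bool) : binVal σ < 2 ^ σ.length := by
  induction σ using List.reverseRecOn with
  | nil => simp [binVal]
  | append_singleton σ b ih =>
    rw [binVal_append_singleton, List.length_append, List.length_singleton, pow_succ]
    have := b.toNat_lt
    omega

/-- `binVal` puts the first bit of the string at the top, whereas `prefixNum` puts the first bit of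
the sequence at the bottom; hence the reversal of positions. -/
theorem testBit_binVal (σ : List Bool) (i : ℕ) (hi : i < σ.length) :
    (binVal σ).testBit (σ.length - 1 - i) = σ[i] := by
  induction σ using List.reverseRecOn with
  | nil => simp at hi
  | append_singleton σ b ih =>
    rw [binVal_append_singleton]
    simp only [List.length_append, List.length_singleton] at hi ⊢
    by_cases h : i = σ.length
    · subst h
      have : σ.length + 1 - 1 - σ.length = 0 := by omega
      rw [this, Nat.testBit_zero]
      cases b <;> simp
    · have h1 : i < σ.length := by omega
      have : σ.length + 1 - 1 - i = (σ.length - 1 - i) + 1 := by omega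
      rw [this, Nat.testBit_succ, List.getElem_append_left h1, ← ih h1]
      congr 1
      have := b.toNat_lt
      omega

theorem binVal_true_replicate (n : ℕ) : binVal (true :: List.replicate n false) = 2 ^ n := by
  induction n with
  | zero => simp [binVal]
  | succ n ih =>
    rw [List.replicate_succ', ← List.cons_append, binVal_append_singleton, ih, pow_succ]
    simp [mul_comm]

/-- The code of the values of the martingale. -/
noncomputable def martCode (f s : ℕ) : List (Option Bool) :=
  List.replicate f (some true) ++ List.replicate (f * s) (some false) ++ [none]

open Classical in
/-- `1` if the string with value `x` and length `n` has the right bits, and `0` otherwise. -/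
noncomputable def martFlag (x n : ℕ) : ℕ :=
  if ∀ k < stageCap (n + 1) n, dig (x + 1) 2 x (n - ellCap (n + 1) (k + 1)) = k % 2 then 1 else 0

theorem martFlag_eq (σ : List Bool) [Decidable (GoodBits σ)] :
    martFlag (binVal σ) σ.length = if GoodBits σ then 1 else 0 := by
  have : (∀ k < stageCap (σ.length + 1) σ.length, dig (binVal σ + 1) 2 (binVal σ)
      (σ.length - ellCap (σ.length + 1) (k + 1)) = k % 2) ↔ GoodBits σ := by
    refine forall_congr' fun k => ?_
    rw [stageCap_eq (Nat.lt_succ_self _), lt_stageOf_iff, ellCap_eq]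
    refine forall_congr' fun hk => ?_
    have h2 := two_le_ell (k + 1)
    -- The caps are harmless: `ell (k + 1)` is at most the length of the string, and a number lies
    -- below its successor.
    rw [min_eq_left (by omega), dig_eq (by norm_num) (Nat.lt_succ_self _)]
    have h3 := testBit_binVal σ (ell (k + 1) - 1) (by omega)
    rw [show σ.length - 1 - (ell (k + 1) - 1) = σ.length - ell (k + 1) by omega,
      Nat.testBit_eq_decide_div_mod_eq] at h3
    rw [List.getElem?_eq_getElem (by omega), ← h3, Option.some_inj, decide_eq_decide]
    omega
  unfold martFlag
  simp only [this]

theorem codes_mart (σ : List Bool) :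
    Codes (martCode (martFlag (binVal σ) σ.length) (stageOf σ.length)) (mart σ) := by
  classical
  rw [martFlag_eq]
  by_cases h : GoodBits σ
  · refine ⟨true :: List.replicate (stageOf σ.length) false, [], ?_, ?_⟩
    · simp [martCode, h]
    · simp [mart, h, binVal_true_replicate]
  · refine ⟨[], [], ?_, ?_⟩
    · simp [martCode, h]
    · simp [mart, h, binVal]

theorem E2.martFlag {x n : Env → ℕ} (hx : E2 x) (hn : E2 n) :
    E2 fun v => martFlag (x v) (n v) := by
  classical
  exact E2.ite (E2P.forall_lt (p := fun v k => BPS.dig (x v + 1) 2 (x v)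
    (n v - BPS.ellCap (n v + 1) (k + 1)) = k % 2) (hn.succ.stageCap hn)
    (.eq (hx.shift.succ.dig (.const 2) hx.shift (hn.shift.sub
      (hn.shift.succ.ellCap (E2.var 0).succ))) ((E2.var 0).mod (.const 2)))) (.const 1) (.const 0)

theorem stageOf_le (n : ℕ) : stageOf n ≤ n := mu_le _ _

/-- Counters `0` and `1` receive value and length of the input, `2` the flag and `3` the stage. All
are below `2 ^ (n + 1)`, so their binary length is linear in `n`. -/
theorem mart_fpspace :
    FPSPACE (id : List Bool → List Bool)
      (fun σ => martCode (martFlag (binVal σ) σ.length) (stageOf σ.length)) := by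
  obtain ⟨K1, D1, h1⟩ := E2.exists_assign (β := Option Bool)
    (((E2.const 2).mul (.var 0)).add (.const 1))
  obtain ⟨K0, D0, h0⟩ := E2.exists_assign (β := Option Bool)
    (((E2.const 2).mul (.var 0)).add (.const 0))
  obtain ⟨K2, D2, h2⟩ := E2.exists_assign (β := Option Bool) (E2.martFlag (.var 0) (.var 1))
  obtain ⟨K3, D3, h3⟩ := E2.exists_assign (β := Option Bool)
    (E2.stageCap (E2.var 1).succ (.var 1))
  let K := K0 + K1 + K2 + K3 + 4
  let D := D0 + D1 + D2 + D3 + 1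
  obtain ⟨c1, hc1⟩ := h1 K (by omega) D (by omega) 0 (by omega)
  obtain ⟨c0, hc0⟩ := h0 K (by omega) D (by omega) 0 (by omega)
  obtain ⟨c2, hc2⟩ := h2 K (by omega) D (by omega) 2 (by omega)
  obtain ⟨c3, hc3⟩ := h3 K (by omega) D (by omega) 3 (by omega)
  obtain ⟨M, hM⟩ := exists_machine_of_cmd (id : Bool → Bool) (β := Option Bool)
    (.seq (.forIn (.seq c1 (.inc 1)) (.seq c0 (.inc 1))) (.seq c2 (.seq c3
      (.seq (.loop 2 (.seq (.out (some true)) (.loop 3 (.out (some false))))) (.out none)))))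
  refine ⟨M, .C D * (.X + 3) + 4, fun σ => ?_⟩
  set n := σ.length with hn
  set B := (2 ^ (n + 3)) ^ D with hB
  have hn2 : n < 2 ^ n := Nat.lt_two_pow_self
  have hBsz : ∀ s : Env, (∀ r < K, 4 ≤ r → s r = 0) → s 0 < 2 ^ n → s 1 ≤ n → s 2 ≤ 1 →
      s 3 ≤ n → sz K s ^ D ≤ B := by
    intro s hs e0 e1 e2 e3
    refine Nat.pow_le_pow_left ?_ D
    rw [sz_eq_of_four (by omega) hs, pow_add]
    omega
  have hnB : n < B := by
    have : 2 ^ (n + 3) ≤ B := Nat.le_self_pow (by omega) _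
    rw [pow_add] at this
    omega
  -- reading the input
  have hread : ∀ (τ pre : List Bool) (s : Env), pre ++ τ = σ → s 0 = binVal pre →
      s 1 = pre.length → (∀ r < K, 2 ≤ r → s r = 0) → (∀ r, s r ≤ B) →
      ∃ s', Exec B (.forIn (.seq c1 (.inc 1)) (.seq c0 (.inc 1))) ⟨s, τ, []⟩ ⟨s', [], []⟩ ∧
        s' 0 = binVal σ ∧ s' 1 = n ∧ (∀ r < K, 2 ≤ r → s' r = 0) ∧ ∀ r, s' r ≤ B := by
    intro τ
    induction τ with
    | nil =>
      intro pre s hpre e0 e1 e2 e3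
      rw [List.append_nil] at hpre
      subst hpre
      exact ⟨s, .forInNil rfl, e0, e1, e2, e3⟩
    | cons b τ ih =>
      intro pre s hpre e0 e1 e2 e3
      have hlen : pre.length + τ.length + 1 = n := by rw [hn, ← hpre]; simp; omega
      have hpn : 2 ^ pre.length ≤ 2 ^ n := Nat.pow_le_pow_right (by norm_num) (by omega)
      have hsz := hBsz s (fun r hr h4 => e2 r hr (by omega))
        (by rw [e0]; exact (binVal_lt pre).trans_le hpn) (by omega)
        (by rw [e2 2 (by omega) le_rfl]; omega) (by rw [e2 3 (by omega) (by omega)]; omega)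
      have hbody : ∃ s1, Runs B (bif b then .seq c1 (.inc 1) else .seq c0 (.inc 1)) s s1 ∧
          s1 0 = binVal (pre ++ [b]) ∧ s1 1 = (pre ++ [b]).length ∧
          (∀ r < K, 2 ≤ r → s1 r = 0) := by
        cases b
        · obtain ⟨s1, g1, g2, g3⟩ := hc0 s B hsz e3
          refine ⟨_, g1.seq (.inc ?_), ?_, ?_, fun r hr hr2 => ?_⟩
          · rw [g3 1 (by omega) (by omega)]; omega
          · rw [Function.update_of_ne (by omega), g2, binVal_append_singleton, e0]; rfl
          · simp [g3 1 (by omega : 1 < K) (by omega), e1]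
          · rw [Function.update_of_ne (by omega), g3 r hr (by omega), e2 r hr hr2]
        · obtain ⟨s1, g1, g2, g3⟩ := hc1 s B hsz e3
          refine ⟨_, g1.seq (.inc ?_), ?_, ?_, fun r hr hr2 => ?_⟩
          · rw [g3 1 (by omega) (by omega)]; omega
          · rw [Function.update_of_ne (by omega), g2, binVal_append_singleton, e0]; rfl
          · simp [g3 1 (by omega : 1 < K) (by omega), e1]
          · rw [Function.update_of_ne (by omega), g3 r hr (by omega), e2 r hr hr2]
      obtain ⟨s1, g1, g2, g3, g4⟩ := hbody
      obtain ⟨s', h5, h6⟩ := ih (pre ++ [b]) s1 (by rw [← hpre]; simp) g2 g3 g4 (g1.le e3)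
      exact ⟨s', .forInCons (b := b) rfl (g1 _ _) h5, h6⟩
  obtain ⟨s1, r1, a0, a1, a2, a3⟩ := hread σ [] (fun _ => 0) rfl rfl rfl (fun _ _ _ => rfl)
    (fun _ => Nat.zero_le _)
  have hflag : martFlag (binVal σ) n ≤ 1 := by unfold martFlag; split_ifs <;> omega
  obtain ⟨s2, r2, b1, b2⟩ := hc2 s1 B (hBsz s1 (fun r hr h4 => a2 r hr (by omega))
    (by rw [a0]; exact binVal_lt σ) (by omega) (by rw [a2 2 (by omega) le_rfl]; omega)
    (by rw [a2 3 (by omega) (by omega)]; omega)) a3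
  rw [a0, a1] at b1
  obtain ⟨s3, r3, d1, d2⟩ := hc3 s2 B (hBsz s2
    (fun r hr h4 => by rw [b2 r hr (by omega), a2 r hr (by omega)])
    (by rw [b2 0 (by omega) (by omega), a0]; exact binVal_lt σ)
    (by rw [b2 1 (by omega) (by omega)]; omega) (by omega)
    (by rw [b2 3 (by omega) (by omega), a2 3 (by omega) (by omega)]; omega)) (r2.le a3)
  rw [b2 1 (by omega) (by omega), a1, stageCap_eq (Nat.lt_succ_self _)] at d1
  have d3 : s3 2 = martFlag (binVal σ) n := by rw [d2 2 (by omega) (by omega), b1]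
  have hout : ∃ s4, Exec B (.loop 2 (.seq (.out (some true)) (.loop 3 (.out (some false)))))
      ⟨s3, [], []⟩ ⟨s4, [], List.replicate (martFlag (binVal σ) n) (some true) ++
        List.replicate (martFlag (binVal σ) n * stageOf n) (some false)⟩ := by
    -- With flag `0` the outer loop is skipped and only the separator is written, which codes the
    -- value zero.
    rcases Nat.le_one_iff_eq_zero_or_eq_one.1 hflag with h | h
    · rw [h] at d3 ⊢
      simp only [List.replicate_zero, Nat.zero_mul, List.append_nil]
      exact ⟨s3, .loopZero d3⟩
    · rw [h] at d3 ⊢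
      rw [Nat.one_mul]
      refine ⟨_, .loopSucc (v := 0) d3 (.seq (.out _ _) (Exec.loop_out (some false) (stageOf n) _ _
        _ ?_)) (.loopZero ?_)⟩
      · simp [d1]
      · simp
  obtain ⟨s4, r4⟩ := hout
  have hfin := hM σ B _ (.seq (by rw [List.map_id]; exact r1) (.seq (r2 _ _) (.seq (r3 _ _)
    (.seq r4 (.out _ none)))))
  refine ⟨hfin.1, ?_, ?_⟩
  · intro t i
    refine (hfin.2 t i).trans_le ?_
    have hlog : Nat.log 2 (2 * B + 1) ≤ D * (n + 3) + 1 := by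
      rw [← Nat.lt_succ_iff]
      refine Nat.log_lt_of_lt_pow (by omega) ?_
      have : 2 ^ (D * (n + 3) + 1 + 1) = 4 * B := by rw [hB, ← pow_mul, mul_comm D]; ring
      simp only [Nat.succ_eq_add_one]
      omega
    simp only [Polynomial.eval_add, Polynomial.eval_mul, Polynomial.eval_C, Polynomial.eval_X,
      Polynomial.eval_ofNat, id]
    rw [show σ.length = n from rfl]
    unfold spaceFor
    omega
  · have hs := stageOf_le n
    have : (martCode (martFlag (binVal σ) n) (stageOf n)).length ≤ n + 2 := by
      simp only [martCode, List.length_append, List.length_replicate, List.length_singleton]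
      nlinarith
    refine this.trans ?_
    simp only [Polynomial.eval_add, Polynomial.eval_mul, Polynomial.eval_C, Polynomial.eval_X,
      Polynomial.eval_ofNat, id]
    have hD : 1 ≤ D := by omega
    nlinarith

theorem randomSeq_not_isLutzPSPACERandom : ¬ IsLutzPSPACERandom randomSeq := fun h =>
  h mart ⟨mart_isMartingale, _, mart_fpspace, codes_mart⟩ mart_succeeds

end BPS

namespace BPS

/-! ### The sequence is computable in small space -/

/-- The caps `cap k`, capped at `z`. -/
def capCap (z k : ℕ) : ℕ := pw z 2 (ellCap z (k + 1) * ellCap z (k + 1))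

theorem E2.capCap {z k : Env → ℕ} (hz : E2 z) (hk : E2 k) : E2 fun v => capCap (z v) (k v) :=
  hz.pw (.const 2) ((hz.ellCap hk.succ).mul (hz.ellCap hk.succ))

/-- If the length is itself capped to `z`, the power `2 ^ (z * z)` still reaches `z`. -/
theorem capCap_eq (z k : ℕ) : capCap z k = min (cap k) z := by
  rw [capCap, pw_eq _ _ _ (by norm_num), ellCap_eq, cap, sq]
  rcases le_total (ell (k + 1)) z with h | h
  · rw [min_eq_left h]
  · have h1 : z ≤ 2 ^ (z * z) :=
      Nat.lt_two_pow_self.le.trans (Nat.pow_le_pow_right (by norm_num) (Nat.le_mul_self z))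
    rw [min_eq_right h, min_eq_right h1, min_eq_right]
    exact h1.trans (Nat.pow_le_pow_right (by norm_num) (Nat.mul_le_mul h h))

theorem ell_lt_cap (k : ℕ) : ell (k + 1) < cap k :=
  Nat.lt_two_pow_self.trans_le
    (Nat.pow_le_pow_right (by norm_num) (Nat.le_self_pow (by norm_num) _))

theorem stageNum_le (z k l l' m x : ℕ) : stageNum z k l l' m x ≤ x + (z * z + z) := by
  have h1 : bestExt z k l l' m x ≤ z :=
    (argmax_le _ _).trans ((Nat.sub_le _ _).trans (pw_le z 2 m))
  have h2 := Nat.mul_le_mul h1 (pw_le z 2 l)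
  have h3 := pw_le z 2 l'
  unfold stageNum
  split_ifs <;> omega

/-- The prefixes `prefixNum k`, computed from capped numbers. -/
noncomputable def prefixCap (z k : ℕ) : ℕ :=
  Nat.rec 0 (fun i r => stageNum (capCap z i) i (ellCap z i) (ellCap z (i + 1))
    (pw z (ellCap z i) (i + 1)) r) k

theorem prefixCap_succ (z k : ℕ) : prefixCap z (k + 1) =
    stageNum (capCap z k) k (ellCap z k) (ellCap z (k + 1)) (pw z (ellCap z k) (k + 1))
      (prefixCap z k) := rfl

/-- Bounded recursion needs a bound for every `z`, including those too small for the computed prefix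
to mean anything. -/
theorem prefixCap_le (z k : ℕ) : prefixCap z k ≤ k * (z * z + z) := by
  induction k with
  | zero => exact Nat.zero_le _
  | succ k ih =>
    have h1 := pw_le z 2 (ellCap z (k + 1) * ellCap z (k + 1))
    have h2 := stageNum_le (capCap z k) k (ellCap z k) (ellCap z (k + 1))
      (pw z (ellCap z k) (k + 1)) (prefixCap z k)
    rw [← capCap] at h1
    rw [prefixCap_succ, Nat.succ_mul]
    have := Nat.mul_le_mul h1 h1
    omega

theorem E2.prefixCap {z k : Env → ℕ} (hz : E2 z) (hk : E2 k) :
    E2 fun v => prefixCap (z v) (k v) :=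
  E2.natRec (h := fun v i r => BPS.stageNum (BPS.capCap (z v) i) i (BPS.ellCap (z v) i)
      (BPS.ellCap (z v) (i + 1)) (BPS.pw (z v) (BPS.ellCap (z v) i) (i + 1)) r) hk (.const 0)
    (E2.stageNum (hz.shift2.capCap (.var 0)) (.var 0) (hz.shift2.ellCap (.var 0))
      (hz.shift2.ellCap (E2.var 0).succ)
      (hz.shift2.pw (hz.shift2.ellCap (.var 0)) (E2.var 0).succ) (.var 1))
    (hk.mul ((hz.mul hz).add hz)).polyBounded
    fun v i hi => (prefixCap_le (z v) i).trans (Nat.mul_le_mul_right _ hi)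

/-- All lengths, segments and caps up to stage `K` lie below `z`, so no capping takes effect. -/
theorem prefixCap_eq {z K : ℕ} (h : cap K < z) {k : ℕ} (hk : k ≤ K + 1) :
    prefixCap z k = prefixNum k := by
  induction k with
  | zero => rfl
  | succ k ih =>
    have h1 : cap k ≤ cap K := Nat.pow_le_pow_right (by norm_num)
      (Nat.pow_le_pow_left (ell_strictMono.monotone (by omega)) 2)
    have h2 := ell_lt_cap k
    have h3 := ell_add_seg_lt k
    have h4 := four_le_ell k
    rw [prefixCap_succ, ih (by omega), capCap_eq, ellCap_eq, ellCap_eq, min_eq_left (by omega),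
      min_eq_left (by omega), min_eq_left (by omega), pw_eq _ _ _ (by omega), ← seg,
      min_eq_left (by omega), prefixNum]

open Classical in
/-- `0` if the cap `z` is large enough to compute bit `i`, and `1` otherwise. -/
noncomputable def capTest (i z : ℕ) : ℕ := if i < z ∧ capCap z (stageCap z i) < z then 0 else 1

theorem E2.capTest {i z : Env → ℕ} (hi : E2 i) (hz : E2 z) : E2 fun v => capTest (i v) (z v) := by
  classical
  exact E2.ite ((E2P.lt hi hz).and (.lt (hz.capCap (hz.stageCap hi)) hz)) (.const 0) (.const 1)

theorem lt_cap_stageOf (i : ℕ) : i < cap (stageOf i) :=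
  (lt_ell_stageOf i).trans (ell_lt_cap _)

/-- The comparison `i < z` validates the capped stage index; after that `min (cap _) z < z` means
that the true cap is below `z`. -/
theorem capTest_eq (i z : ℕ) : capTest i z = if cap (stageOf i) < z then 0 else 1 := by
  have h := lt_cap_stageOf i
  unfold capTest
  congr 1
  rw [eq_iff_iff]
  constructor
  · rintro ⟨h1, h2⟩
    rw [stageCap_eq h1, capCap_eq] at h2
    omega
  · intro h1
    refine ⟨h.trans h1, ?_⟩
    rw [stageCap_eq (h.trans h1), capCap_eq]
    omega

/-- Bit `i` of the sequence, computed with the cap `z`. -/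
noncomputable def bitCap (i z : ℕ) : ℕ := dig z 2 (prefixCap z (stageCap z i + 1)) i

theorem E2.bitCap {i z : Env → ℕ} (hi : E2 i) (hz : E2 z) : E2 fun v => bitCap (i v) (z v) :=
  hz.dig (.const 2) (hz.prefixCap (hz.stageCap hi).succ) hi

theorem bitCap_eq {i z : ℕ} (h : cap (stageOf i) < z) : bitCap i z = (randomSeq i).toNat := by
  rw [bitCap, stageCap_eq ((lt_cap_stageOf i).trans h), prefixCap_eq h le_rfl,
    dig_eq (by norm_num), randomSeq, Nat.toNat_testBit]
  exact (prefixNum_lt _).trans_le ((Nat.pow_le_pow_right (by norm_num)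
    (Nat.le_self_pow (by norm_num) _)).trans h.le)

/-- A sufficient cap is exponential in a stage length, so it is found by search: counter `1` is
raised until `capTest` gives `0`, which happens first at `cap (stageOf i) + 1`. Counter `0` holds
`i`, `2` the test result and `3` the bit. -/
theorem exists_machine_randomSeq : ∃ (M : Machine Unit Bool) (D : ℕ), ∀ i,
    M.Outputs (unary i) [randomSeq i] ∧
      M.UsesSpace (unary i) (D * (ell (stageOf i + 1) ^ 2 + 3) + 4) := by
  obtain ⟨K1, D1, h1⟩ := E2.exists_assign (β := Bool) (E2.capTest (.var 0) (.var 1))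
  obtain ⟨K2, D2, h2⟩ := E2.exists_assign (β := Bool) (E2.bitCap (.var 0) (.var 1))
  let K := K1 + K2 + 4
  let D := D1 + D2 + 1
  obtain ⟨c1, hc1⟩ := h1 K (by omega) D (by omega) 2 (by omega)
  obtain ⟨c2, hc2⟩ := h2 K (by omega) D (by omega) 3 (by omega)
  obtain ⟨M, hM⟩ := exists_machine_of_cmd (fun _ : Unit => true) (β := Bool)
    (.seq (.forIn (.inc 0) (.inc 0)) (.seq (.inc 2) (.seq (.loop 2 (.seq (.inc 1) c1))
      -- A case distinction on counter `3`: counter `2` is set to one, and the branch writing `true`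
      -- clears it, so that exactly one symbol is written.
      (.seq c2 (.seq (.inc 2) (.seq (.loop 3 (.seq (.loop 2 .skip) (.out true)))
        (.loop 2 (.out false))))))))
  refine ⟨M, D, fun i => ?_⟩
  set Z := cap (stageOf i) with hZ
  -- The four counters and the constant of `sz` add up to at most `8 * Z`; the exponent `3` supplies
  -- the factor `8`.
  set B := (2 ^ (ell (stageOf i + 1) ^ 2 + 3)) ^ D with hB
  have hi := lt_cap_stageOf i
  have h8 : 8 * Z ≤ B := by
    refine le_trans ?_ (Nat.le_self_pow (by omega) _)
    rw [pow_add, ← cap]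
    omega
  have hBsz : ∀ s : Env, (∀ r < K, 4 ≤ r → s r = 0) → s 0 = i → s 1 ≤ Z + 1 → s 2 ≤ 1 →
      s 3 ≤ 1 → sz K s ^ D ≤ B := by
    intro s hs e0 e1 e2 e3
    refine Nat.pow_le_pow_left ?_ D
    rw [sz_eq_of_four (by omega) hs, pow_add, ← cap]
    omega
  have hread : ∀ (n : ℕ) (s : Env), s 0 + n = i → (∀ r, r ≠ 0 → s r = 0) →
      ∃ s', Exec B (.forIn (.inc 0) (.inc 0)) ⟨s, List.replicate n true, ([] : List Bool)⟩
        ⟨s', [], []⟩ ∧ s' 0 = i ∧ ∀ r, r ≠ 0 → s' r = 0 := by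
    intro n
    induction n with
    | zero => exact fun s e0 e1 => ⟨s, .forInNil rfl, e0, e1⟩
    | succ n ih =>
      intro s e0 e1
      obtain ⟨s', g1, g2⟩ := ih (Function.update s 0 (s 0 + 1)) (by simp; omega)
        (fun r hr => by rw [Function.update_of_ne hr, e1 r hr])
      exact ⟨s', .forInCons (b := true) rfl (.inc _ _ (show s 0 + 1 ≤ B by omega)) g1, g2⟩
  have hstep : ∀ s : Env, s 1 ≤ Z → s 0 = i → s 2 = 1 → (∀ r < K, 3 ≤ r → s r = 0) →
      (∀ r, s r ≤ B) → ∃ s', Runs B (.seq (.inc 1) c1) (Function.update s 2 0) s' ∧ s' 0 = i ∧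
        s' 1 = s 1 + 1 ∧ s' 2 = (if Z < s 1 + 1 then 0 else 1) ∧ (∀ r < K, 3 ≤ r → s' r = 0) ∧
        ∀ r, s' r ≤ B := by
    intro s e1 e0 e2 e3 e4
    have h5 : ∀ r, Function.update s 2 0 r ≤ B := fun r => by
      by_cases hr : r = 2
      · simp [hr]
      · rw [Function.update_of_ne hr]; exact e4 r
    have g := Runs.inc (β := Bool) (s := Function.update s 2 0) (r := 1) (B := B)
      (by rw [Function.update_of_ne (by omega)]; omega)
    have h3 : ∀ r < K, 3 ≤ r → Function.update (Function.update s 2 0) 1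
        (Function.update s 2 0 1 + 1) r = 0 := fun r hr h3 => by
      rw [Function.update_of_ne (by omega), Function.update_of_ne (by omega), e3 r hr h3]
    obtain ⟨s', g1, g2, g3⟩ := hc1 _ B (hBsz _ (fun r hr h4 => h3 r hr (by omega)) (by simp [e0])
      (by simp; omega) (by simp) (by rw [h3 3 (by omega) le_rfl]; omega)) (g.le h5)
    refine ⟨s', g.seq g1, ?_, ?_, ?_, fun r hr h4 => ?_, (g.seq g1).le h5⟩
    · rw [g3 0 (by omega) (by omega)]; simp [e0]
    · rw [g3 1 (by omega) (by omega)]; simp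
    · rw [g2, capTest_eq]; simp [e0, hZ]
    · rw [g3 r hr (by omega), h3 r hr h4]
  have hsearch : ∀ (j : ℕ) (s : Env), s 1 + j = Z → s 0 = i → s 2 = 1 →
      (∀ r < K, 3 ≤ r → s r = 0) → (∀ r, s r ≤ B) →
      ∃ s', Runs B (.loop 2 (.seq (.inc 1) c1)) s s' ∧ s' 0 = i ∧ s' 1 = Z + 1 ∧ s' 2 = 0 ∧
        ∀ r < K, 3 ≤ r → s' r = 0 := by
    intro j
    induction j with
    | zero =>
      intro s e1 e0 e2 e3 e4
      obtain ⟨s', g1, f0, f1, f2, f3, f4⟩ := hstep s (by omega) e0 e2 e3 e4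
      rw [if_pos (by omega)] at f2
      exact ⟨s', fun _ _ => .loopSucc (v := 0) e2 (g1 _ _) (.loopZero f2), f0, by omega, f2, f3⟩
    | succ j ih =>
      intro s e1 e0 e2 e3 e4
      obtain ⟨s', g1, f0, f1, f2, f3, f4⟩ := hstep s (by omega) e0 e2 e3 e4
      rw [if_neg (by omega)] at f2
      obtain ⟨s'', g2, h⟩ := ih s' (by omega) f0 f2 f3 f4
      exact ⟨s'', fun _ _ => .loopSucc (v := 0) e2 (g1 _ _) (g2 _ _), h⟩
  obtain ⟨s1, r1, a0, a1⟩ := hread i (fun _ => 0) (Nat.zero_add i) (fun _ _ => rfl)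
  have a2 : ∀ r, s1 r ≤ B := fun r => by
    by_cases hr : r = 0
    · rw [hr, a0]; omega
    · rw [a1 r hr]; omega
  have r2 := Runs.inc (β := Bool) (s := s1) (r := 2) (B := B) (by rw [a1 2 (by omega)]; omega)
  obtain ⟨s2, r3, b0, b1, b2, b3⟩ := hsearch Z (Function.update s1 2 (s1 2 + 1))
    (by simp [a1]) (by simp [a0]) (by simp [a1])
    (fun r hr h3 => by rw [Function.update_of_ne (by omega), a1 r (by omega)]) (r2.le a2)
  have b4 := r3.le (r2.le a2)
  obtain ⟨s3, r4, d0, d1⟩ := hc2 s2 B (hBsz s2 (fun r hr h4 => b3 r hr (by omega)) b0 b1.le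
    (by omega) (by rw [b3 3 (by omega) le_rfl]; omega)) b4
  rw [b0, b1, bitCap_eq (Nat.lt_succ_self _)] at d0
  have d2 : s3 2 = 0 := by rw [d1 2 (by omega) (by omega), b2]
  have r5 := Runs.inc (β := Bool) (s := s3) (r := 2) (B := B) (by omega)
  rw [d2, Nat.zero_add] at r5
  have hout : ∃ s4, Exec B
      (.seq (.loop 3 (.seq (.loop 2 .skip) (.out true))) (.loop 2 (.out false)))
      ⟨Function.update s3 2 1, [], []⟩ ⟨s4, [], [randomSeq i]⟩ := by
    cases hX : randomSeq i
    · rw [hX] at d0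
      exact ⟨_, .seq (.loopZero (by simpa using d0)) (.loopSucc (v := 0) (by simp) (.out _ _)
        (.loopZero (by simp)))⟩
    · rw [hX] at d0
      exact ⟨_, .seq (.loopSucc (v := 0) (by simpa using d0) (.seq (.loopSucc (v := 0) (by simp)
        (.skip _) (.loopZero (by simp))) (.out _ _)) (.loopZero (by simp))) (.loopZero (by simp))⟩
  obtain ⟨s4, r6⟩ := hout
  have hin : (unary i).map (fun _ => true) = List.replicate i true := by simp [unary]
  have hfin := hM (unary i) B _ (.seq (by rw [hin]; exact r1) (.seq (r2 _ _) (.seq (r3 _ _)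
    (.seq (r4 _ _) (.seq (r5 _ _) r6)))))
  refine ⟨hfin.1, fun t j => (hfin.2 t j).trans_le ?_⟩
  have hlog : Nat.log 2 (2 * B + 1) ≤ D * (ell (stageOf i + 1) ^ 2 + 3) + 1 := by
    rw [← Nat.lt_succ_iff]
    refine Nat.log_lt_of_lt_pow (by omega) ?_
    have : 2 ^ (D * (ell (stageOf i + 1) ^ 2 + 3) + 1 + 1) = 4 * B := by
      rw [hB, ← pow_mul, mul_comm D]; ring
    simp only [Nat.succ_eq_add_one]
    omega
  unfold spaceFor
  omega

/-! ### Growth of the stage lengths against the space bound. -/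

theorem ell_eq (k : ℕ) : ell k = 2 ^ (2 * (k + 1).factorial) := by
  induction k with
  | zero => rfl
  | succ k ih =>
    rw [ell, ih, ← pow_mul, Nat.factorial_succ (k + 1)]
    ring_nf

/-- With `F = (K + 1)!` the binary logarithm of the left side is `4 * (K + 2) * F`, and the exponent
on the right is at least `4 * ε * F ^ 2`. It remains that `K + 2 ≤ ε * F`, which follows from `F ≥
(K + 1) * K` and `ε * K ≥ 2`. -/
theorem two_rpow_le_of_ell_le {ε : ℝ} {K i : ℕ} (hK : 2 ≤ ε * K) (hi : ell K ≤ i) :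
    ((ell (K + 1) ^ 2 : ℕ) : ℝ) ≤ 2 ^ (ε * Real.logb 2 i ^ 2) := by
  set F := (K + 1).factorial with hF
  have hK0 : (0 : ℝ) ≤ K := Nat.cast_nonneg K
  have hε : 0 < ε := by
    by_contra h
    nlinarith
  have h1 : (2 * F : ℝ) ≤ Real.logb 2 i := by
    have h4 := four_le_ell K
    rw [Real.le_logb_iff_rpow_le (by norm_num) (by exact_mod_cast (by omega : 0 < i))]
    rw [ell_eq, ← hF] at hi
    exact_mod_cast hi
  have h2 : ((K + 1) * K : ℝ) ≤ F := by
    rw [hF, Nat.factorial_succ]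
    exact_mod_cast Nat.mul_le_mul_left _ (Nat.self_le_factorial K)
  have h3 : (K + 2 : ℝ) ≤ ε * F := by nlinarith
  have h4 : (0 : ℝ) ≤ F := Nat.cast_nonneg F
  have h5 : ((ell (K + 1) ^ 2 : ℕ) : ℝ) = 2 ^ (4 * ((K + 2) * F) : ℝ) := by
    rw [ell_eq, Nat.factorial_succ (K + 1), ← hF, ← pow_mul,
      show 2 * ((K + 1 + 1) * F) * 2 = 4 * ((K + 2) * F) by ring]
    norm_cast
  rw [h5]
  refine Real.rpow_le_rpow_of_exponent_le (by norm_num) ?_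
  have h6 : (2 * F : ℝ) ^ 2 ≤ Real.logb 2 i ^ 2 := pow_le_pow_left₀ (by positivity) h1 2
  have h7 := mul_le_mul_of_nonneg_left h6 hε.le
  nlinarith

theorem randomSeq_isDSPACEReal {ε : ℝ} (hε : 0 < ε) :
    IsDSPACEReal (fun n => (2 : ℝ) ^ (ε * Real.logb 2 n ^ 2)) randomSeq := by
  obtain ⟨M, D, hM⟩ := exists_machine_randomSeq
  obtain ⟨K, hK⟩ := exists_nat_ge (2 / ε)
  rw [div_le_iff₀' hε] at hK
  refine ⟨M, fun i => D * (ell (stageOf i + 1) ^ 2 + 3) + 4,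
    D * (ell (K + 1) ^ 2 + 1 + 3) + 4, fun i => ⟨(hM i).1, (hM i).2, ?_⟩⟩
  have h1 : (1 : ℝ) ≤ 2 ^ (ε * Real.logb 2 i ^ 2) :=
    Real.one_le_rpow (by norm_num) (by positivity)
  have h2 : ((ell (stageOf i + 1) ^ 2 : ℕ) : ℝ) ≤
      (ell (K + 1) ^ 2 + 1) * 2 ^ (ε * Real.logb 2 i ^ 2) := by
    -- The finitely many stages up to `K`, where the asymptotic estimate is not available, are
    -- absorbed into the constant.
    rcases le_or_gt (stageOf i) K with h | h
    · have h3 : ell (stageOf i + 1) ^ 2 ≤ ell (K + 1) ^ 2 :=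
        Nat.pow_le_pow_left (ell_strictMono.monotone (by omega)) 2
      have h4 : ((ell (stageOf i + 1) ^ 2 : ℕ) : ℝ) ≤ (ell (K + 1) : ℝ) ^ 2 := by
        exact_mod_cast h3
      nlinarith [sq_nonneg (ell (K + 1) : ℝ)]
    · have h3 : ell (stageOf i) ≤ i := by
        have := lt_stageOf_iff.1 (show stageOf i - 1 < stageOf i by omega)
        rwa [Nat.sub_add_cancel (by omega)] at this
      have h4 := two_rpow_le_of_ell_le (ε := ε) (hK.trans
        (mul_le_mul_of_nonneg_left (Nat.cast_le.2 h.le) hε.le)) h3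
      nlinarith [sq_nonneg (ell (K + 1) : ℝ)]
  push_cast at h2 ⊢
  have hD : (0 : ℝ) ≤ D := Nat.cast_nonneg D
  nlinarith [mul_le_mul_of_nonneg_left h2 hD]

end BPS

theorem theorem3p17 (ε : ℝ) (hε : 0 < ε) :
    ∃ X : ℕ → Bool,
      BPS.IsBPSRandom X ∧
      BPS.IsDSPACEReal (fun n => (2 : ℝ) ^ (ε * Real.logb 2 n ^ 2)) X ∧
      (¬ ∃ L : ℝ, Tendsto (BPS.density X) atTop (𝓝 L)) ∧
      ¬ BPS.IsLutzPSPACERandom X :=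
  ⟨BPS.randomSeq, BPS.randomSeq_isBPSRandom, BPS.randomSeq_isDSPACEReal hε,
    BPS.density_not_tendsto, BPS.randomSeq_not_isLutzPSPACERandom⟩
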